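/- Time is counted in steps of a word RAM: a single fixed program, unit-cost arithmetic ($+,-,\times,\mathrm{div},\bmod$), memory accesses and tests, and words of $O(\log n)$ bits, where $n$ is the size parameter below. Let $\omega>2$ be a real number such that two $n\times n$ matrices over $\mathbb{Z}_2$ can be multiplied in $O(n^\omega)$ time. For an $m\times n$ matrix $A$ over $\mathbb{Z}_2$ of rank $r$, the earliest basis $B_{opt}$ of $A$ consists of the columns $a_{i_1},\dots,a_{i_r}$ of $A$, $i_1<\dots<i_r$, whose index set is the lexicographically smallest one such that the corresponding $r$ columns have full rank $r$; $B_{opt}$ also denotes the $m\times r$ matrix $[a_{i_1}\ \cdots\ a_{i_r}]$. Then each of the following can be computed in $O(n^\omega)$ time, where the constants do not depend on $m$ or on $A$: (a) given an $n\times n$ matrix $A$ over $\mathbb{Z}_2$ of full rank, its inverse $A^{-1}$; (b) given an $m\times n$ matrix $A$ over $\mathbb{Z}_2$ with $m\le n$, its earliest basis $B_{opt}$ (the rank $r$, the column indices $i_1<\dots<i_r$, and the matrix $B_{opt}$); (c) given an $m\times n$ matrix $A$ over $\mathbb{Z}_2$ with $m\le n$, the coordinates of all columns of $A$ in the earliest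 basis $B_{opt}$, in the form of a decomposition $AP=B_{opt}\,[I_r\mid R]$: the rank $r$, an $n\times n$ permutation matrix $P$, the $m\times r$ matrix $B_{opt}$ and an $r\times(n-r)$ matrix $R$, where $I_r$ is the $r\times r$ identity matrix. -/

import Mathlib

/-! ## The machine model: a word RAM

A machine has registers and a random-access memory, both indexed by `ℕ` and holding natural numbers.
A program is a fixed finite expression (hence it mentions finitely many registers), it does not
depend on the input. Each elementary instruction and each evaluation of a test costs one step.
No value that is put in a register may reach the bound `W`; since addresses are read from registers
and stored values come from registers, only cells with address below `W` can be touched and only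
values below `W` can be stored. In the problems below `W` is polynomial in the size of the input,
that is, words have `O(log n)` bits. -/

namespace WordRAM

/-- The arithmetic operations (`sub` is truncated; division by zero gives `0`). -/
inductive Op
  | add | sub | mul | div | mod

/-- The meaning of the arithmetic operations. -/
def Op.eval : Op → ℕ → ℕ → ℕ
  | .add, x, y => x + y
  | .sub, x, y => x - y
  | .mul, x, y => x * y
  | .div, x, y => x / y
  | .mod, x, y => x % y

/-- Programs. -/
inductive Prog
  /-- `reg dst := k` -/
  | const (dst k : ℕ)
  /-- `reg dst := o (reg a) (reg b)` -/
  | arith (o : Op) (dst a b : ℕ)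
  /-- `reg dst := mem (reg addr)` -/
  | load (dst addr : ℕ)
  /-- `mem (reg addr) := reg src` -/
  | store (addr src : ℕ)
  /-- first `p`, then `q` -/
  | seq (p q : Prog)
  /-- if `reg r ≠ 0` then `p`, else `q` -/
  | cond (r : ℕ) (p q : Prog)
  /-- while `reg r ≠ 0` repeat `p` -/
  | loop (r : ℕ) (p : Prog)

/-- The contents of the registers and of the memory. -/
structure State where
  reg : ℕ → ℕ
  mem : ℕ → ℕ

/-- The state after writing `v` to register `r`. -/
def State.setReg (s : State) (r v : ℕ) : State :=
  { s with reg := Function.update s.reg r v }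

/-- The state after writing `v` to memory cell `a`. -/
def State.setMem (s : State) (a v : ℕ) : State :=
  { s with mem := Function.update s.mem a v }

/-- `Exec W p s s' t`: started in state `s`, the program `p` halts in state `s'` after exactly `t`
steps, and every value that it puts in a register on the way is smaller than `W`. -/
inductive Exec (W : ℕ) : Prog → State → State → ℕ → Prop
  | const (s : State) (dst k : ℕ) (h : k < W) :
      Exec W (.const dst k) s (s.setReg dst k) 1
  | arith (s : State) (o : Op) (dst a b : ℕ) (h : o.eval (s.reg a) (s.reg b) < W) :
      Exec W (.arith o dst a b) s (s.setReg dst (o.eval (s.reg a) (s.reg b))) 1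
  | load (s : State) (dst addr : ℕ) (h : s.mem (s.reg addr) < W) :
      Exec W (.load dst addr) s (s.setReg dst (s.mem (s.reg addr))) 1
  | store (s : State) (addr src : ℕ) :
      Exec W (.store addr src) s (s.setMem (s.reg addr) (s.reg src)) 1
  | seq {p q : Prog} {s₁ s₂ s₃ : State} {t₁ t₂ : ℕ}
      (hp : Exec W p s₁ s₂ t₁) (hq : Exec W q s₂ s₃ t₂) :
      Exec W (.seq p q) s₁ s₃ (t₁ + t₂)
  | cond_true {r : ℕ} {p : Prog} (q : Prog) {s s' : State} {t : ℕ}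
      (hr : s.reg r ≠ 0) (hp : Exec W p s s' t) :
      Exec W (.cond r p q) s s' (t + 1)
  | cond_false {r : ℕ} (p : Prog) {q : Prog} {s s' : State} {t : ℕ}
      (hr : s.reg r = 0) (hq : Exec W q s s' t) :
      Exec W (.cond r p q) s s' (t + 1)
  | loop_done {r : ℕ} (p : Prog) {s : State} (hr : s.reg r = 0) :
      Exec W (.loop r p) s s 1
  | loop_step {r : ℕ} {p : Prog} {s₁ s₂ s₃ : State} {t₁ t₂ : ℕ}
      (hr : s₁.reg r ≠ 0) (hp : Exec W p s₁ s₂ t₁) (hq : Exec W (.loop r p) s₂ s₃ t₂) :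
      Exec W (.loop r p) s₁ s₃ (t₁ + t₂ + 1)

/-- The initial state: the input occupies the memory cells `0, 1, 2, …`; all other cells and
all registers are `0`. -/
def State.init (input : List ℕ) : State where
  reg := fun _ => 0
  mem := fun k => input.getD k 0

/-- In the state `s` the list `out` occupies the memory cells `0, 1, 2, …`. -/
def State.HasOutput (s : State) (out : List ℕ) : Prop :=
  ∀ (k : ℕ) (hk : k < out.length), s.mem k = out[k]

/-- A computational problem: instances with a size and an encoding in memory, and the
outputs that are correct for each instance. -/
structure Problem where
  Inst : Type
  size : Inst → ℕ
  input : Inst → List ℕ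
  IsOutput : Inst → List ℕ → Prop

/-- The problem can be solved in `O(f n)` time, `n` being the size of the instance: one program, with
words of `O(log n)` bits (the bound on the values is `(n + 2) ^ c`), halts with a correct
output on each instance of size `n` after at most `T n` steps, where `T = O(f)`. -/
def Problem.SolvableInTime (Q : Problem) (f : ℕ → ℝ) : Prop :=
  ∃ (p : Prog) (c : ℕ) (T : ℕ → ℕ),
    ((fun n => (T n : ℝ)) =O[Filter.atTop] f) ∧
    ∀ x : Q.Inst, ∃ (out : List ℕ) (s : State) (t : ℕ),
      Exec ((Q.size x + 2) ^ c) p (State.init (Q.input x)) s t ∧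
      t ≤ T (Q.size x) ∧ s.HasOutput out ∧ Q.IsOutput x out

end WordRAM

/-! ## Matrices over `ℤ/2` -/

namespace BinaryMatrix

/-- A matrix as the list of its entries `0` and `1`, row by row. -/
def encode {m n : ℕ} (M : Matrix (Fin m) (Fin n) (ZMod 2)) : List ℕ :=
  List.ofFn fun k : Fin (m * n) => (M k.divNat k.modNat).val

/-- The indices `e 0 < e 1 < ⋯ < e (r - 1)`, where `r` is the rank of `A`, are those of the earliest
basis of `A`: the corresponding columns have full rank `r`, and `e` is lexicographically smallest
among the increasing sequences of `r` column indices with this property. -/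
def IsEarliestBasis {m n : ℕ} (A : Matrix (Fin m) (Fin n) (ZMod 2))
    (e : Fin A.rank ↪o Fin n) : Prop :=
  (A.submatrix id e).rank = A.rank ∧
  ∀ e' : Fin A.rank ↪o Fin n, (A.submatrix id e').rank = A.rank →
    toLex (e : Fin A.rank → Fin n) ≤ toLex (e' : Fin A.rank → Fin n)

/-- The `r × n` matrix `[I_r | R]`. -/
def idBlock {r n : ℕ} (h : r ≤ n) (R : Matrix (Fin r) (Fin (n - r)) (ZMod 2)) :
    Matrix (Fin r) (Fin n) (ZMod 2) :=
  (Matrix.fromCols (1 : Matrix (Fin r) (Fin r) (ZMod 2)) R).reindex (Equiv.refl (Fin r))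
    (finSumFinEquiv.trans (finCongr (Nat.add_sub_of_le h)))

/-- Two square matrices of the same size. -/
structure SquarePair where
  n : ℕ
  A : Matrix (Fin n) (Fin n) (ZMod 2)
  B : Matrix (Fin n) (Fin n) (ZMod 2)

/-- Multiplication of two `n × n` matrices. -/
def multiplication : WordRAM.Problem where
  Inst := SquarePair
  size := fun x => x.n
  input := fun x => x.n :: (encode x.A ++ encode x.B)
  IsOutput := fun x out => out = encode (x.A * x.B)

/-- A square matrix of full rank. -/
structure FullRankSquare where
  n : ℕ
  A : Matrix (Fin n) (Fin n) (ZMod 2)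
  full_rank : A.rank = n

/-- Inversion of an `n × n` matrix of full rank. -/
def inversion : WordRAM.Problem where
  Inst := FullRankSquare
  size := fun x => x.n
  input := fun x => x.n :: encode x.A
  IsOutput := fun x out => out = encode x.A⁻¹

/-- An `m × n` matrix with `m ≤ n`. -/
structure Wide where
  m : ℕ
  n : ℕ
  le : m ≤ n
  A : Matrix (Fin m) (Fin n) (ZMod 2)

/-- Computing the earliest basis: the output is the rank `r`, the increasing list of the `r` column
indices (counted from `0`), and the `m × r` matrix that these columns of `A` form. -/
def earliestBasis : WordRAM.Problem where
  Inst := Wide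
  size := fun x => x.n
  input := fun x => x.m :: x.n :: encode x.A
  IsOutput := fun x out => ∃ e : Fin x.A.rank ↪o Fin x.n, IsEarliestBasis x.A e ∧
    out = x.A.rank :: ((List.ofFn fun i => (e i : ℕ)) ++ encode (x.A.submatrix id e))

/-- Computing the decomposition `A P = B [I_r | R]`, where `r` is the rank of `A`, `P` is a
permutation matrix and `B` is the matrix of the earliest basis of `A`: the output is the number `r`
and the three matrices `P` (`n × n`), `B` (`m × r`) and `R` (`r × (n - r)`). -/
def earliestBasisCoordinates : WordRAM.Problem where
  Inst := Wide
  size := fun x => x.n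
  input := fun x => x.m :: x.n :: encode x.A
  IsOutput := fun x out =>
    ∃ (e : Fin x.A.rank ↪o Fin x.n) (σ : Equiv.Perm (Fin x.n))
      (P : Matrix (Fin x.n) (Fin x.n) (ZMod 2))
      (R : Matrix (Fin x.A.rank) (Fin (x.n - x.A.rank)) (ZMod 2)),
      IsEarliestBasis x.A e ∧ P = σ.permMatrix (ZMod 2) ∧
      x.A * P = x.A.submatrix id e * idBlock x.A.rank_le_width R ∧
      out = x.A.rank :: (encode P ++ encode (x.A.submatrix id e) ++ encode R)

end BinaryMatrix

namespace WordRAM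

/-! All three tasks are read off from one block Gauss–Jordan elimination of the matrix, padded with
zeros to `N × N`, where `N` is the least power of two that is at least `n`.

The elimination works in place. If `E` denotes the row operations of a block of columns, a column
`c` of the block with pivot row `p` stores `E e_p - e_p`, so that `E x = x + ∑ x_p • col c` (this is
`elim`). A column without a pivot stores its image under `E`, which is supported on the pivot rows
of earlier columns. Two adjacent blocks of `w` columns are combined (`Eliminated.merge`) by applying
the operations of the left block to the right one, eliminating the right block, and applying its
operations to the left one. Applying a block to `w` other columns amounts to `N / w` products of `w
× w` matrices, that is, time `O(N w^(ω-1))`. With about `N / w` such applications for each power of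
two `w`, the total is of the order of `N² ∑ w^(ω-2)`, a geometric sum dominated by its largest term
because `ω > 2` (`stepTime_le`, `blockTime_le`, `totalTime_isBigO`).

At the end `E` is injective, sends the pivot columns of `A` to distinct unit vectors, and sends each
other column to a vector supported on the pivot rows of earlier columns. Hence the pivot columns are
a basis of the column space, every column is a combination of pivot columns that are not later than
itself, and the coordinates are stored entries (`Eliminated.col_eq_sum`,
`Eliminated.isEarliestBasis`, `Eliminated.decomposition`). If `A` is square of full rank, all its
columns have pivots, and the rows of `E` in the order of the pivots form the inverse
(`Eliminated.inv_apply`).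

On the machine, the given multiplication program expects cleared registers and a memory that is zero
outside its input, and it may leave values in polynomially many cells, too many to erase in time. It
is relocated (`Exec.reloc`): before each call its boundedly many registers are cleared, and each
call works in a fresh region of memory that is still zero. There are at most `2 N` block updates
with at most `N` calls each, so the addresses stay polynomial in `n` and words have `O(log n)` bits
(`word_size_bound`). As the machine has no recursion, the divide and conquer is run as a single
loop, in which the parity of `j / w` tells whether the last finished block is a left or a right half
(`run_driverBody`, `run_driver_block`). -/

theorem Exec.mono {W W' : ℕ} (h : W ≤ W') {p : Prog} {s s' : State} {t : ℕ}
    (H : Exec W p s s' t) : Exec W' p s s' t := by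
  induction H with
  | const s dst k hk => exact .const s dst k (hk.trans_le h)
  | arith s o dst a b hk => exact .arith s o dst a b (hk.trans_le h)
  | load s dst a hk => exact .load s dst a (hk.trans_le h)
  | store s a b => exact .store s a b
  | seq _ _ ih1 ih2 => exact .seq ih1 ih2
  | cond_true q hr _ ih => exact .cond_true q hr ih
  | cond_false p hr _ ih => exact .cond_false p hr ih
  | loop_done p hr => exact .loop_done p hr
  | loop_step hr _ _ ih1 ih2 => exact .loop_step hr ih1 ih2

/-! ### Relocation of a program -/

/-- A bound on the registers that a program mentions. -/
def Prog.regBound : Prog → ℕ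
  | .const dst _ => dst + 1
  | .arith _ dst a b => dst + a + b + 1
  | .load dst addr => dst + addr + 1
  | .store addr src => addr + src + 1
  | .seq p q => p.regBound + q.regBound
  | .cond r p q => r + 1 + p.regBound + q.regBound
  | .loop r p => r + 1 + p.regBound

/-- The program with its registers shifted by `D` and its memory shifted by the contents of the
register `β`; the register `τ` is used for the computation of addresses. -/
def Prog.reloc (β τ D : ℕ) : Prog → Prog
  | .const dst k => .const (dst + D) k
  | .arith o dst a b => .arith o (dst + D) (a + D) (b + D)
  | .load dst addr => .seq (.arith .add τ β (addr + D)) (.load (dst + D) τ)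
  | .store addr src => .seq (.arith .add τ β (addr + D)) (.store τ (src + D))
  | .seq p q => .seq (p.reloc β τ D) (q.reloc β τ D)
  | .cond r p q => .cond (r + D) (p.reloc β τ D) (q.reloc β τ D)
  | .loop r p => .loop (r + D) (p.reloc β τ D)

/-- The state `z` contains a copy of the state `s`, with the memory at the address `B`. -/
structure Sim (W₀ B β D K : ℕ) (s z : State) : Prop where
  lt : ∀ r, s.reg r < W₀
  reg : ∀ r < K, z.reg (r + D) = s.reg r
  base : z.reg β = B
  mem : ∀ a < W₀, z.mem (B + a) = s.mem a

/-- The state `z'` differs from `z` at most in the registers `τ` and `≥ D` and in the memory cells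
from `B` up to `B + W₀`. -/
structure Untouched (W₀ B τ D : ℕ) (z z' : State) : Prop where
  reg : ∀ r < D, r ≠ τ → z'.reg r = z.reg r
  mem : ∀ a, a < B ∨ B + W₀ ≤ a → z'.mem a = z.mem a

theorem Untouched.trans {W₀ B τ D : ℕ} {z₁ z₂ z₃ : State} (h : Untouched W₀ B τ D z₁ z₂)
    (h' : Untouched W₀ B τ D z₂ z₃) : Untouched W₀ B τ D z₁ z₃ :=
  ⟨fun r hr hn => (h'.reg r hr hn).trans (h.reg r hr hn),
    fun a ha => (h'.mem a ha).trans (h.mem a ha)⟩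

theorem Sim.setReg {W₀ B β D K : ℕ} {s z : State} (h : Sim W₀ B β D K s z) (hβ : β < D)
    (r v : ℕ) (hv : v < W₀) : Sim W₀ B β D K (s.setReg r v) (z.setReg (r + D) v) where
  lt x := by
    by_cases hx : x = r
    · simpa [State.setReg, hx] using hv
    · simpa [State.setReg, Function.update_of_ne hx] using h.lt x
  reg x hx := by
    by_cases hxr : x = r
    · simp [State.setReg, hxr]
    · have : x + D ≠ r + D := by omega
      simpa [State.setReg, Function.update_of_ne hxr, Function.update_of_ne this] using h.reg x hx
  base := by
    have : β ≠ r + D := by omega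
    simpa [State.setReg, Function.update_of_ne this] using h.base
  mem := h.mem

theorem Sim.setTemp {W₀ B β D K τ : ℕ} {s z : State} (h : Sim W₀ B β D K s z) (hβ : β ≠ τ)
    (hτ : τ < D) (v : ℕ) : Sim W₀ B β D K s (z.setReg τ v) where
  lt := h.lt
  reg x hx := by
    have : x + D ≠ τ := by omega
    simpa [State.setReg, Function.update_of_ne this] using h.reg x hx
  base := by simpa [State.setReg, Function.update_of_ne hβ] using h.base
  mem := h.mem

theorem untouched_setReg {W₀ B τ D : ℕ} (z : State) (r v : ℕ) :
    Untouched W₀ B τ D z (z.setReg (r + D) v) :=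
  ⟨fun x hx _ => Function.update_of_ne (by omega) _ _, fun _ _ => rfl⟩

theorem untouched_setTemp {W₀ B τ D : ℕ} (z : State) (v : ℕ) :
    Untouched W₀ B τ D z (z.setReg τ v) :=
  ⟨fun _ _ hn => Function.update_of_ne hn _ _, fun _ _ => rfl⟩

/-- A memory access becomes the computation of an address followed by the access, whence the factor
2. All values in the simulated registers are below `W₀`, so every simulated address falls in the
window from `B` to `B + W₀`; this is why the rest of the memory survives. -/
theorem Exec.reloc {W₀ W B β τ D K : ℕ} (hβ : β < D) (hτ : τ < D) (hne : β ≠ τ)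
    (hW : B + W₀ ≤ W) {p : Prog} {s s' : State} {t : ℕ} (H : Exec W₀ p s s' t)
    (hK : p.regBound ≤ K) {z : State} (hz : Sim W₀ B β D K s z) :
    ∃ z' t', Exec W (p.reloc β τ D) z z' t' ∧ t' ≤ 2 * t ∧ Sim W₀ B β D K s' z' ∧
      Untouched W₀ B τ D z z' := by
  induction H generalizing z with
  | const s dst k h =>
    exact ⟨_, 1, .const z (dst + D) k (by omega), by omega, hz.setReg hβ _ _ h,
      untouched_setReg _ _ _⟩
  | arith s o dst a b h =>
    simp only [Prog.regBound] at hK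
    have ha := hz.reg a (by omega)
    have hb := hz.reg b (by omega)
    have := Exec.arith (W := W) z o (dst + D) (a + D) (b + D) (by rw [ha, hb]; omega)
    rw [ha, hb] at this
    exact ⟨_, 1, this, by omega, hz.setReg hβ _ _ h, untouched_setReg _ _ _⟩
  | load s dst addr h =>
    simp only [Prog.regBound] at hK
    have ha := hz.reg addr (by omega)
    have hl := hz.lt addr
    have h1 := Exec.arith (W := W) z .add τ β (addr + D)
      (by rw [ha, hz.base]; simp only [Op.eval]; omega)
    rw [ha, hz.base] at h1
    set z1 := z.setReg τ (Op.add.eval B (s.reg addr)) with hz1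
    have hm : z1.mem (z1.reg τ) = s.mem (s.reg addr) := by
      simp only [hz1, State.setReg, Function.update_self, Op.eval]
      exact hz.mem _ hl
    have h2 := Exec.load (W := W) z1 (dst + D) τ (by rw [hm]; omega)
    rw [hm] at h2
    exact ⟨_, _, .seq h1 h2, by omega, (hz.setTemp hne hτ _).setReg hβ _ _ h,
      (untouched_setTemp _ _).trans (untouched_setReg _ _ _)⟩
  | store s addr src =>
    simp only [Prog.regBound] at hK
    have ha := hz.reg addr (by omega)
    have hb := hz.reg src (by omega)
    have hl := hz.lt addr
    have h1 := Exec.arith (W := W) z .add τ β (addr + D)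
      (by rw [ha, hz.base]; simp only [Op.eval]; omega)
    rw [ha, hz.base] at h1
    set z1 := z.setReg τ (Op.add.eval B (s.reg addr)) with hz1
    have hτ1 : z1.reg τ = B + s.reg addr := by
      simp only [hz1, State.setReg, Function.update_self, Op.eval]
    have hs1 : z1.reg (src + D) = s.reg src := by
      simp only [hz1, State.setReg]
      rw [Function.update_of_ne (by omega), hb]
    have h2 := Exec.store (W := W) z1 τ (src + D)
    rw [hτ1, hs1] at h2
    have hz1' : Sim W₀ B β D K s z1 := hz.setTemp hne hτ _
    refine ⟨_, _, .seq h1 h2, by omega, ⟨hz1'.lt, hz1'.reg, hz1'.base, ?_⟩,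
      (untouched_setTemp z _).trans ⟨fun _ _ _ => rfl, ?_⟩⟩
    · intro x hx
      by_cases hxa : x = s.reg addr
      · simp [State.setMem, hxa]
      · have : B + x ≠ B + s.reg addr := by omega
        simpa [State.setMem, Function.update_of_ne hxa, Function.update_of_ne this]
          using hz1'.mem x hx
    · intro x hx
      exact Function.update_of_ne (by omega) _ _
  | seq _ _ ih1 ih2 =>
    simp only [Prog.regBound] at hK
    obtain ⟨z1, t1, e1, l1, s1, u1⟩ := ih1 (by omega) hz
    obtain ⟨z2, t2, e2, l2, s2, u2⟩ := ih2 (by omega) s1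
    exact ⟨z2, _, .seq e1 e2, by omega, s2, u1.trans u2⟩
  | cond_true q hr _ ih =>
    simp only [Prog.regBound] at hK
    obtain ⟨z1, t1, e1, l1, s1, u1⟩ := ih (by omega) hz
    exact ⟨z1, _, .cond_true _ (by rwa [hz.reg _ (by omega)]) e1, by omega, s1, u1⟩
  | cond_false p hr _ ih =>
    simp only [Prog.regBound] at hK
    obtain ⟨z1, t1, e1, l1, s1, u1⟩ := ih (by omega) hz
    exact ⟨z1, _, .cond_false _ (by rwa [hz.reg _ (by omega)]) e1, by omega, s1, u1⟩
  | loop_done p hr =>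
    simp only [Prog.regBound] at hK
    exact ⟨z, _, .loop_done _ (by rwa [hz.reg _ (by omega)]), by omega, hz,
      ⟨fun _ _ _ => rfl, fun _ _ => rfl⟩⟩
  | loop_step hr _ _ ih1 ih2 =>
    have hK' := hK
    simp only [Prog.regBound] at hK
    obtain ⟨z1, t1, e1, l1, s1, u1⟩ := ih1 (by omega) hz
    obtain ⟨z2, t2, e2, l2, s2, u2⟩ := ih2 hK' s1
    exact ⟨z2, _, .loop_step (by rwa [hz.reg _ (by omega)]) e1 e2, by omega, s2, u1.trans u2⟩

/-- The program that clears the registers from `D` up to `D + k`. -/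
def Prog.clear (D : ℕ) : ℕ → Prog
  | 0 => .const D 0
  | k + 1 => .seq (Prog.clear D k) (.const (k + D) 0)

theorem exec_clear {W : ℕ} (hW : 0 < W) (D k : ℕ) (s : State) :
    ∃ s', Exec W (Prog.clear D k) s s' (k + 1) ∧ (∀ r < k, s'.reg (r + D) = 0) ∧
      (∀ r < D, s'.reg r = s.reg r) ∧ s'.mem = s.mem := by
  induction k with
  | zero =>
    exact ⟨_, .const s D 0 hW, by simp, fun r hr => Function.update_of_ne (by omega) _ _, rfl⟩
  | succ k ih =>
    obtain ⟨s1, h1, h2, h3, h4⟩ := ih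
    refine ⟨_, .seq h1 (.const s1 (k + D) 0 hW), fun r hr => ?_, fun r hr => ?_, h4⟩
    · by_cases h : r = k
      · simp [State.setReg, h]
      · simp only [State.setReg]
        rw [Function.update_of_ne (by omega)]
        exact h2 r (by omega)
    · simp only [State.setReg]
      rw [Function.update_of_ne (by omega)]
      exact h3 r hr

/-! ### Specifications of programs -/

/-- Started with the registers below `d` as in `env` and the memory `m`, the program `p` halts after
at most `T` steps, with the registers below `d` unchanged and with a memory that satisfies `Q`. -/
def Run (W d : ℕ) (p : Prog) (T : ℕ) (env m : ℕ → ℕ) (Q : (ℕ → ℕ) → Prop) : Prop :=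
  ∀ s : State, (∀ r < d, s.reg r = env r) → s.mem = m → ∃ s' t, Exec W p s s' t ∧ t ≤ T ∧
    (∀ r < d, s'.reg r = env r) ∧ Q s'.mem

theorem Run.mono {W d : ℕ} {p : Prog} {T T' : ℕ} {env m : ℕ → ℕ} {Q Q' : (ℕ → ℕ) → Prop}
    (h : Run W d p T env m Q) (hT : T ≤ T') (hQ : ∀ m', Q m' → Q' m') :
    Run W d p T' env m Q' := by
  intro s hs hm
  obtain ⟨s', t, h1, h2, h3, h4⟩ := h s hs hm
  exact ⟨s', t, h1, h2.trans hT, h3, hQ _ h4⟩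

theorem Run.seq {W d : ℕ} {p q : Prog} {T₁ T₂ : ℕ} {env m : ℕ → ℕ} {Q R : (ℕ → ℕ) → Prop}
    (h : Run W d p T₁ env m R) (h' : ∀ m', R m' → Run W d q T₂ env m' Q) :
    Run W d (.seq p q) (T₁ + T₂) env m Q := by
  intro s hs hm
  obtain ⟨s1, t1, h1, h2, h3, h4⟩ := h s hs hm
  obtain ⟨s2, t2, k1, k2, k3, k4⟩ := h' _ h4 s1 h3 rfl
  exact ⟨s2, _, .seq h1 k1, by omega, k3, k4⟩

/-- Arithmetic expressions in the registers and the memory. -/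
inductive Expr
  | var (r : ℕ)
  | lit (k : ℕ)
  | bin (o : Op) (a b : Expr)
  | get (a : Expr)

@[simp] theorem Op.eval_add (x y : ℕ) : Op.add.eval x y = x + y := rfl
@[simp] theorem Op.eval_sub (x y : ℕ) : Op.sub.eval x y = x - y := rfl
@[simp] theorem Op.eval_mul (x y : ℕ) : Op.mul.eval x y = x * y := rfl
@[simp] theorem Op.eval_div (x y : ℕ) : Op.div.eval x y = x / y := rfl
@[simp] theorem Op.eval_mod (x y : ℕ) : Op.mod.eval x y = x % y := rfl

namespace Expr

/-- The value of an expression. -/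
@[simp] def eval (env m : ℕ → ℕ) : Expr → ℕ
  | var r => env r
  | lit k => k
  | bin o a b => o.eval (a.eval env m) (b.eval env m)
  | get a => m (a.eval env m)

/-- The expression mentions registers below `d` only, and its evaluation stays below `W`. -/
@[simp] def Ok (W d : ℕ) (env m : ℕ → ℕ) : Expr → Prop
  | var r => r < d ∧ env r < W
  | lit k => k < W
  | bin o a b => a.Ok W d env m ∧ b.Ok W d env m ∧ o.eval (a.eval env m) (b.eval env m) < W
  | get a => a.Ok W d env m ∧ m (a.eval env m) < W

/-- The number of steps that the evaluation of an expression takes. -/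
@[simp] def cost : Expr → ℕ
  | var _ => 2
  | lit _ => 1
  | bin _ a b => a.cost + b.cost + 1
  | get a => a.cost + 1

/-- The program that evaluates an expression in the registers `≥ t`, with the result in `t`. -/
def compile (t : ℕ) : Expr → Prog
  | var r => .seq (.const t 0) (.arith .add t r t)
  | lit k => .const t k
  | bin o a b => .seq (a.compile t) (.seq (b.compile (t + 1)) (.arith o t t (t + 1)))
  | get a => .seq (a.compile t) (.load t t)

instance : Add Expr := ⟨bin .add⟩
instance : Sub Expr := ⟨bin .sub⟩
instance : Mul Expr := ⟨bin .mul⟩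
instance : Div Expr := ⟨bin .div⟩
instance : Mod Expr := ⟨bin .mod⟩

theorem add_def (a b : Expr) : a + b = bin .add a b := rfl
theorem sub_def (a b : Expr) : a - b = bin .sub a b := rfl
theorem mul_def (a b : Expr) : a * b = bin .mul a b := rfl
theorem div_def (a b : Expr) : a / b = bin .div a b := rfl
theorem mod_def (a b : Expr) : a % b = bin .mod a b := rfl

attribute [simp] add_def sub_def mul_def div_def mod_def

theorem Ok.lt {W d : ℕ} {env m : ℕ → ℕ} {e : Expr} (h : e.Ok W d env m) : e.eval env m < W := by
  cases e with
  | var r => exact h.2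
  | lit k => exact h
  | bin o a b => exact h.2.2
  | get a => exact h.2

/-- Only registers from `t` on are changed, so the second operand of an operation can be evaluated
at `t + 1` while the first one waits in `t`. -/
theorem exec_compile {W d : ℕ} {env m : ℕ → ℕ} (e : Expr) (h : e.Ok W d env m) {t : ℕ}
    (ht : d ≤ t) (s : State) (hs : ∀ r < d, s.reg r = env r) (hm : s.mem = m) :
    ∃ s', Exec W (e.compile t) s s' e.cost ∧ (∀ r < t, s'.reg r = s.reg r) ∧
      s'.reg t = e.eval env m ∧ s'.mem = m := by
  induction e generalizing t s with
  | var r =>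
    obtain ⟨hr, hv⟩ := h
    -- There is no move instruction: a register is copied by adding it to a zero.
    have h1 := Exec.const (W := W) s t 0 (by omega)
    have ha : (s.setReg t 0).reg r = env r := by
      simp only [State.setReg]
      rw [Function.update_of_ne (by omega), hs r hr]
    have hb : (s.setReg t 0).reg t = 0 := by simp [State.setReg]
    have h2 := Exec.arith (W := W) (s.setReg t 0) .add t r t (by rw [ha, hb]; simpa using hv)
    rw [ha, hb] at h2
    refine ⟨_, .seq h1 h2, fun x hx => ?_, by simp [State.setReg], hm⟩
    simp only [State.setReg]
    rw [Function.update_of_ne (by omega), Function.update_of_ne (by omega)]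
  | lit k =>
    exact ⟨_, .const s t k h, fun x hx => Function.update_of_ne (by omega) _ _,
      by simp [State.setReg], hm⟩
  | bin o a b iha ihb =>
    obtain ⟨ha, hb, hv⟩ := h
    obtain ⟨s1, e1, r1, v1, m1⟩ := iha ha ht s hs hm
    obtain ⟨s2, e2, r2, v2, m2⟩ := ihb hb (t := t + 1) (by omega) s1
      (fun r hr => by rw [r1 r (by omega), hs r hr]) m1
    have ht2 : s2.reg t = a.eval env m := by rw [r2 t (by omega), v1]
    have h3 := Exec.arith (W := W) s2 o t t (t + 1) (by rw [ht2, v2]; exact hv)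
    rw [ht2, v2] at h3
    refine ⟨s2.setReg t (o.eval (a.eval env m) (b.eval env m)), ?_, fun x hx => ?_,
      by simp [State.setReg], m2⟩
    · have := Exec.seq e1 (.seq e2 h3)
      rwa [← add_assoc] at this
    · simp only [State.setReg]
      rw [Function.update_of_ne (by omega), r2 x (by omega), r1 x hx]
  | get a ih =>
    obtain ⟨ha, hv⟩ := h
    obtain ⟨s1, e1, r1, v1, m1⟩ := ih ha ht s hs hm
    have h2 := Exec.load (W := W) s1 t t (by rw [v1, m1]; exact hv)
    rw [v1, m1] at h2
    refine ⟨_, .seq e1 h2, fun x hx => ?_, by simp [State.setReg], m1⟩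
    simp only [State.setReg]
    rw [Function.update_of_ne (by omega), r1 x hx]

end Expr

/-! ### Composite statements -/

/-- `mem a := v`. -/
def Prog.put (d : ℕ) (a v : Expr) : Prog :=
  .seq (a.compile d) (.seq (v.compile (d + 1)) (.store d (d + 1)))

theorem Run.put {W d : ℕ} {a v : Expr} {T : ℕ} {env m : ℕ → ℕ} {Q : (ℕ → ℕ) → Prop}
    (ha : a.Ok W d env m) (hv : v.Ok W d env m) (hT : a.cost + v.cost + 1 ≤ T)
    (hQ : Q (Function.update m (a.eval env m) (v.eval env m))) :
    Run W d (.put d a v) T env m Q := by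
  intro s hs hm
  obtain ⟨s1, e1, r1, v1, m1⟩ := a.exec_compile ha le_rfl s hs hm
  obtain ⟨s2, e2, r2, v2, m2⟩ := v.exec_compile hv (Nat.le_succ d) s1
    (fun r hr => by rw [r1 r hr, hs r hr]) m1
  have h3 := Exec.store (W := W) s2 d (d + 1)
  rw [v2, r2 d (by omega), v1] at h3
  refine ⟨_, _, .seq e1 (.seq e2 h3), by omega, fun r hr => ?_, ?_⟩
  · change s2.reg r = _
    rw [r2 r (by omega), r1 r hr, hs r hr]
  · simpa [State.setMem, m2] using hQ

/-- `let reg d := e` in `p`. -/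
def Prog.bind (d : ℕ) (e : Expr) (p : Prog) : Prog :=
  .seq (e.compile d) p

/-- Variables form a stack: the body protects one more register, which becomes scratch space again
afterwards. -/
theorem Run.bind {W d : ℕ} {e : Expr} {p : Prog} {T₀ T : ℕ} {env m : ℕ → ℕ} {Q : (ℕ → ℕ) → Prop}
    (he : e.Ok W d env m) (hT : e.cost + T₀ ≤ T)
    (h : Run W (d + 1) p T₀ (Function.update env d (e.eval env m)) m Q) :
    Run W d (.bind d e p) T env m Q := by
  intro s hs hm
  obtain ⟨s1, e1, r1, v1, m1⟩ := e.exec_compile he le_rfl s hs hm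
  obtain ⟨s2, t2, k1, k2, k3, k4⟩ := h s1 (fun r hr => by
    by_cases hrd : r = d
    · simp [hrd, v1]
    · rw [Function.update_of_ne hrd, r1 r (by omega), hs r (by omega)]) m1
  refine ⟨s2, _, .seq e1 k1, by omega, fun r hr => ?_, k4⟩
  rw [k3 r (by omega), Function.update_of_ne (by omega)]

/-- `if e ≠ 0 then p else q`. -/
def Prog.ite (d : ℕ) (e : Expr) (p q : Prog) : Prog :=
  .seq (e.compile d) (.cond d p q)

theorem Run.ite {W d : ℕ} {e : Expr} {p q : Prog} {T₀ T : ℕ} {env m : ℕ → ℕ}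
    {Q : (ℕ → ℕ) → Prop} (he : e.Ok W d env m) (hT : e.cost + T₀ + 1 ≤ T)
    (hp : e.eval env m ≠ 0 → Run W d p T₀ env m Q) (hq : e.eval env m = 0 → Run W d q T₀ env m Q) :
    Run W d (.ite d e p q) T env m Q := by
  intro s hs hm
  obtain ⟨s1, e1, r1, v1, m1⟩ := e.exec_compile he le_rfl s hs hm
  have hs1 : ∀ r < d, s1.reg r = env r := fun r hr => by rw [r1 r hr, hs r hr]
  by_cases h0 : e.eval env m = 0
  · obtain ⟨s2, t2, k1, k2, k3, k4⟩ := hq h0 s1 hs1 m1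
    exact ⟨s2, _, .seq e1 (.cond_false _ (by rw [v1, h0]) k1), by omega, k3, k4⟩
  · obtain ⟨s2, t2, k1, k2, k3, k4⟩ := hp h0 s1 hs1 m1
    exact ⟨s2, _, .seq e1 (.cond_true _ (by rwa [v1]) k1), by omega, k3, k4⟩

/-- Do nothing. -/
def Prog.skip (d : ℕ) : Prog := .const d 0

theorem Run.skip {W d : ℕ} {T : ℕ} {env m : ℕ → ℕ} {Q : (ℕ → ℕ) → Prop} (hW : 0 < W)
    (hT : 1 ≤ T) (hQ : Q m) : Run W d (.skip d) T env m Q := by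
  intro s hs hm
  refine ⟨_, _, .const s d 0 hW, hT, fun r hr => ?_, by simpa [State.setReg, hm] using hQ⟩
  simp only [State.setReg]
  rw [Function.update_of_ne (by omega), hs r hr]

/-- `while e ≠ 0 do p`. -/
def Prog.while (d : ℕ) (e : Expr) (p : Prog) : Prog :=
  .seq (e.compile d) (.loop d (.seq p (e.compile d)))

theorem Run.while_done {W d : ℕ} {e : Expr} {p : Prog} {T : ℕ} {env m : ℕ → ℕ}
    {Q : (ℕ → ℕ) → Prop} (he : e.Ok W d env m) (h0 : e.eval env m = 0) (hT : e.cost + 1 ≤ T)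
    (hQ : Q m) : Run W d (.while d e p) T env m Q := by
  intro s hs hm
  obtain ⟨s1, e1, r1, v1, m1⟩ := e.exec_compile he le_rfl s hs hm
  exact ⟨s1, _, .seq e1 (.loop_done _ (by rw [v1, h0])), hT,
    fun r hr => by rw [r1 r hr, hs r hr], by rwa [m1]⟩

/-- Unrolls one iteration and leaves the rest of the loop to a continuation. No invariant is fixed,
which suits the elimination loop, whose analysis follows a recursion tree. -/
theorem Run.while_step {W d : ℕ} {e : Expr} {p : Prog} {T₁ T₂ T : ℕ} {env m : ℕ → ℕ}
    {R Q : (ℕ → ℕ) → Prop} (he : e.Ok W d env m) (h0 : e.eval env m ≠ 0)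
    (hT : e.cost + T₁ + T₂ + 1 ≤ T) (hp : Run W d p T₁ env m R)
    (h : ∀ m', R m' → Run W d (.while d e p) T₂ env m' Q) :
    Run W d (.while d e p) T env m Q := by
  intro s hs hm
  obtain ⟨s1, e1, r1, v1, m1⟩ := e.exec_compile he le_rfl s hs hm
  obtain ⟨s2, t2, k1, k2, k3, k4⟩ := hp s1 (fun r hr => by rw [r1 r hr, hs r hr]) m1
  obtain ⟨s3, t3, l1, l2, l3, l4⟩ := h _ k4 s2 k3 rfl
  -- The remaining loop starts with its own evaluation of the test. This is the evaluation that ends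
  -- the body of the current iteration, so the pieces can be regrouped.
  obtain _ | _ | _ | _ | @⟨_, _, _, s4, _, t4, t5, hc, hl⟩ := l1
  exact ⟨s3, _, .seq e1 (.loop_step (by rwa [v1]) (.seq k1 hc) hl), by omega, l3, l4⟩

/-- `for i < e do p`; the counter `i` is the register `d`. -/
def Prog.for (d : ℕ) (e : Expr) (p : Prog) : Prog :=
  .seq (e.compile (d + 1)) (.seq (.const d 0)
    (.seq ((Expr.var (d + 1) - Expr.var d).compile (d + 2))
      (.loop (d + 2) (.seq p (.seq ((Expr.var d + Expr.lit 1).compile (d + 2))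
      (.seq (.arith .sub (d + 3) (d + 2) (d + 2)) (.seq (.arith .add d (d + 2) (d + 3))
        ((Expr.var (d + 1) - Expr.var d).compile (d + 2)))))))))

/-- The bound is kept in `d + 1` and the test value `k - i` in `d + 2`. The 12 extra steps of an
iteration are the loop test (1), the increment (4), the copy of the counter (2) and the new test
value (5). The 7 steps outside are the initialization (1 + 5) and the last test. -/
theorem Run.for {W d : ℕ} {e : Expr} {p : Prog} {T₀ T : ℕ} {env m : ℕ → ℕ}
    {Q : (ℕ → ℕ) → Prop} (I : ℕ → (ℕ → ℕ) → Prop) (k : ℕ) (hk : e.eval env m = k)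
    (he : e.Ok W d env m) (hT : e.cost + k * (T₀ + 12) + 7 ≤ T) (h0 : I 0 m)
    (hp : ∀ i < k, ∀ m', I i m' →
      Run W (d + 2) p T₀ (Function.update (Function.update env d i) (d + 1) k) m' (I (i + 1)))
    (hQ : ∀ m', I k m' → Q m') :
    Run W d (.for d e p) T env m Q := by
  have hkW : k < W := hk ▸ he.lt
  -- the loop, started with the counter `i`
  have key : ∀ j i m', i + j = k → I i m' → ∀ s : State, (∀ r < d, s.reg r = env r) →
      s.reg d = i → s.reg (d + 1) = k → s.reg (d + 2) = k - i → s.mem = m' →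
      ∃ s' t, Exec W
      (.loop (d + 2) (.seq p (.seq ((Expr.var d + Expr.lit 1).compile (d + 2))
        (.seq (.arith .sub (d + 3) (d + 2) (d + 2)) (.seq (.arith .add d (d + 2) (d + 3))
        ((Expr.var (d + 1) - Expr.var d).compile (d + 2))))))) s s' t ∧ t ≤ j * (T₀ + 12) + 1 ∧
        (∀ r < d, s'.reg r = env r) ∧ Q s'.mem := by
    intro j
    induction j with
    | zero =>
      intro i m' hi hI s hs hd hd1 hd2 hm
      have : i = k := by omega
      subst this
      exact ⟨s, 1, .loop_done _ (by omega), by omega, hs, hm ▸ hQ _ hI⟩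
    | succ j ih =>
      intro i m' hi hI s hs hd hd1 hd2 hm
      obtain ⟨s1, t1, e1, l1, r1, q1⟩ := hp i (by omega) m' hI s (fun r hr => by
        by_cases h1 : r = d + 1
        · simp [h1, hd1]
        · rw [Function.update_of_ne h1]
          by_cases h2 : r = d
          · simp [h2, hd]
          · rw [Function.update_of_ne h2, hs r (by omega)]) hm
      have r1d : s1.reg d = i := by simp [r1 d (by omega)]
      have r1d1 : s1.reg (d + 1) = k := by simp [r1 (d + 1) (by omega)]
      obtain ⟨s2, e2, r2, v2, m2⟩ := (Expr.var d + Expr.lit 1).exec_compile (W := W) (d := d + 2)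
        (env := s1.reg) (m := s1.mem) (by simp [r1d]; omega) le_rfl s1 (fun _ _ => rfl) rfl
      have v2' : s2.reg (d + 2) = i + 1 := by simpa [r1d] using v2
      -- A zero is produced in `d + 3`, so that the incremented counter can be copied from `d + 2`
      -- to `d` by an addition.
      have e3 := Exec.arith (W := W) s2 .sub (d + 3) (d + 2) (d + 2) (by simp; omega)
      set s3 := s2.setReg (d + 3) (Op.sub.eval (s2.reg (d + 2)) (s2.reg (d + 2))) with hs3
      have a3 : s3.reg (d + 3) = 0 := by simp [hs3, State.setReg]
      have b3 : s3.reg (d + 2) = i + 1 := by simp [hs3, State.setReg, v2']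
      have e4 := Exec.arith (W := W) s3 .add d (d + 2) (d + 3) (by rw [a3, b3]; simp; omega)
      rw [a3, b3] at e4
      set s4 := s3.setReg d (Op.add.eval (i + 1) 0) with hs4
      have r4 : ∀ r < d, s4.reg r = env r := fun r hr => by
        simp only [hs4, hs3, State.setReg]
        rw [Function.update_of_ne (by omega), Function.update_of_ne (by omega), r2 r (by omega),
          r1 r (by omega), Function.update_of_ne (by omega), Function.update_of_ne (by omega)]
      have a4 : s4.reg d = i + 1 := by simp [hs4, State.setReg]
      have b4 : s4.reg (d + 1) = k := by
        simp only [hs4, hs3, State.setReg]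
        rw [Function.update_of_ne (by omega), Function.update_of_ne (by omega), r2 _ (by omega),
          r1d1]
      have m4 : s4.mem = s1.mem := m2
      obtain ⟨s5, e5, r5, v5, m5⟩ := (Expr.var (d + 1) - Expr.var d).exec_compile (W := W)
        (d := d + 2) (env := s4.reg) (m := s4.mem) (by simp [a4, b4]; omega) le_rfl s4
        (fun _ _ => rfl) rfl
      obtain ⟨s6, t6, e6, l6, r6, q6⟩ := ih (i + 1) s1.mem (by omega) q1 s5
        (fun r hr => by rw [r5 r (by omega), r4 r hr]) (by rw [r5 d (by omega), a4])
        (by rw [r5 _ (by omega), b4]) (by simpa [a4, b4] using v5) (by rw [m5, m4])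
      refine ⟨s6, _, .loop_step (by omega) (.seq e1 (.seq e2 (.seq e3 (.seq e4 e5)))) e6, ?_,
        r6, q6⟩
      simp only [Expr.sub_def, Expr.cost]
      have : (j + 1) * (T₀ + 12) = j * (T₀ + 12) + T₀ + 12 := by ring
      omega
  intro s hs hm
  obtain ⟨s1, e1, r1, v1, m1⟩ := e.exec_compile he (Nat.le_succ d) s hs hm
  have e2 := Exec.const (W := W) s1 d 0 (by omega)
  set s2 := s1.setReg d 0 with hs2
  have a2 : s2.reg d = 0 := by simp [hs2, State.setReg]
  have b2 : s2.reg (d + 1) = k := by simp [hs2, State.setReg, v1, hk]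
  obtain ⟨s3, e3, r3, v3, m3⟩ := (Expr.var (d + 1) - Expr.var d).exec_compile (W := W)
    (d := d + 2) (env := s2.reg) (m := s2.mem) (by simp [a2, b2]; omega) le_rfl s2
    (fun _ _ => rfl) rfl
  obtain ⟨s4, t4, e4, l4, r4, q4⟩ := key k 0 m (by omega) h0 s3 (fun r hr => by
      rw [r3 r (by omega), hs2]
      simp only [State.setReg]
      rw [Function.update_of_ne (by omega), r1 r (by omega), hs r hr])
    (by rw [r3 d (by omega), a2]) (by rw [r3 _ (by omega), b2]) (by simpa [a2, b2] using v3)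
    (by rw [m3]; exact m1)
  refine ⟨s4, _, .seq e1 (.seq e2 (.seq e3 e4)), ?_, r4, q4⟩
  simp only [Expr.sub_def, Expr.cost]
  omega

/-! ### Row-major addresses and loops over a rectangle of cells. -/

theorem addr_inj {st i j i' j' : ℕ} (hj : j < st) (hj' : j' < st)
    (h : i * st + j = i' * st + j') : i = i' ∧ j = j' := by
  have hst : 0 < st := by omega
  have h1 : (j + st * i) / st = (j' + st * i') / st := by
    rw [mul_comm st, mul_comm st, add_comm j, add_comm j', h]
  have h2 : (j + st * i) % st = (j' + st * i') % st := by
    rw [mul_comm st, mul_comm st, add_comm j, add_comm j', h]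
  rw [Nat.add_mul_div_left _ _ hst, Nat.add_mul_div_left _ _ hst, Nat.div_eq_of_lt hj,
    Nat.div_eq_of_lt hj'] at h1
  rw [Nat.add_mul_mod_self_left, Nat.add_mul_mod_self_left, Nat.mod_eq_of_lt hj,
    Nat.mod_eq_of_lt hj'] at h2
  omega

theorem addr_lt {st i j a : ℕ} (hi : i < a) (hj : j < st) : i * st + j < a * st := by
  calc i * st + j < i * st + st := by omega
    _ = (i + 1) * st := by ring
    _ ≤ a * st := Nat.mul_le_mul_right _ hi

/-- `for i < a do for j < b do mem (base + i * stride + j) := val`, with `i` in the register `d` and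
`j` in the register `d + 2`. -/
def Prog.fill (d : ℕ) (a b base stride val : Expr) : Prog :=
  .for d a (.for (d + 2) b (.put (d + 4) (base + .var d * stride + .var (d + 2)) val))

/-- The registers inside the loops of `Prog.fill`. -/
def fillEnv (env : ℕ → ℕ) (d i na j nb : ℕ) : ℕ → ℕ :=
  Function.update (Function.update (Function.update (Function.update env d i) (d + 1) na) (d + 2) j)
    (d + 3) nb

/-- When `val` is evaluated for the cell `(i, j)`, the memory is known to be the original one except
at the other cells of the rectangle. In particular the cell `(i, j)` itself still has its old value,
which permits updates in place. -/
theorem Run.fill {W d : ℕ} {a b base stride val : Expr} {T : ℕ} {env m : ℕ → ℕ}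
    {Q : (ℕ → ℕ) → Prop} (na nb B st : ℕ) (f : ℕ → ℕ → ℕ)
    (ha : a.Ok W d env m) (hna : a.eval env m = na) (hst : nb ≤ st)
    (hb : ∀ i < na, ∀ m', b.Ok W (d + 2) (Function.update (Function.update env d i) (d + 1) na) m' ∧
      b.eval (Function.update (Function.update env d i) (d + 1) na) m' = nb)
    (hval : ∀ i < na, ∀ j < nb, ∀ m' : ℕ → ℕ,
      (∀ x, (∀ i' < na, ∀ j' < nb, (i' ≠ i ∨ j' ≠ j) → x ≠ B + i' * st + j') → m' x = m x) →
      (base.Ok W (d + 4) (fillEnv env d i na j nb) m' ∧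
        base.eval (fillEnv env d i na j nb) m' = B) ∧
      (stride.Ok W (d + 4) (fillEnv env d i na j nb) m' ∧
        stride.eval (fillEnv env d i na j nb) m' = st) ∧
      B + i * st + j < W ∧
      (val.Ok W (d + 4) (fillEnv env d i na j nb) m' ∧
        val.eval (fillEnv env d i na j nb) m' = f i j))
    (hT : a.cost + na * (b.cost + nb * (base.cost + stride.cost + val.cost + 20) + 19) + 7 ≤ T)
    (hQ : ∀ m', (∀ i < na, ∀ j < nb, m' (B + i * st + j) = f i j) →
      (∀ x, (∀ i < na, ∀ j < nb, x ≠ B + i * st + j) → m' x = m x) → Q m') :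
    Run W d (.fill d a b base stride val) T env m Q := by
  have hnaW : na < W := hna ▸ ha.lt
  refine Run.for (T₀ := b.cost + nb * (base.cost + stride.cost + val.cost + 20) + 7)
    (fun i m' => (∀ i' < i, ∀ j < nb, m' (B + i' * st + j) = f i' j) ∧
      ∀ x, (∀ i' < i, ∀ j < nb, x ≠ B + i' * st + j) → m' x = m x) na hna ha ?_ ?_ ?_
    (fun m' h => hQ m' h.1 h.2)
  · convert hT using 2
  · exact ⟨fun _ h => absurd h (Nat.not_lt_zero _), fun _ _ => rfl⟩
  · rintro i hi m1 ⟨hf1, hm1⟩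
    refine Run.for (T₀ := base.cost + stride.cost + val.cost + 8)
      (fun j m' => (∀ i' < i, ∀ j < nb, m' (B + i' * st + j) = f i' j) ∧
        (∀ j' < j, m' (B + i * st + j') = f i j') ∧
        ∀ x, (∀ i' < i, ∀ j < nb, x ≠ B + i' * st + j) → (∀ j' < j, x ≠ B + i * st + j') →
          m' x = m x) nb (hb i hi m1).2 (hb i hi m1).1 le_rfl ?_ ?_ ?_
    · exact ⟨hf1, fun _ h => absurd h (Nat.not_lt_zero _), fun x hx _ => hm1 x hx⟩
    · rintro j hj m2 ⟨hf2, hg2, hm2⟩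
      have hnbW : nb < W := (hb i hi m1).2 ▸ (hb i hi m1).1.lt
      obtain ⟨⟨ob, eb⟩, ⟨os, es⟩, hlt, ov, ev⟩ := hval i hi j hj m2 (fun x hx => hm2 x
        (fun i' hi' j' hj' => hx i' (by omega) j' hj' (by omega))
        (fun j' hj' => hx i hi j' (by omega) (by omega)))
      have e1 : fillEnv env d i na j nb d = i := by
        simp [fillEnv]
      have e2 : fillEnv env d i na j nb (d + 2) = j := by
        simp [fillEnv]
      change Run W (d + 4) _ _ (fillEnv env d i na j nb) m2 _
      have hadr : (base + Expr.var d * stride + Expr.var (d + 2)).eval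
          (fillEnv env d i na j nb) m2 = B + i * st + j := by
        simp [e1, e2, eb, es]
      have hle : i * st ≤ B + i * st + j := by omega
      refine Run.put ?_ ov ?_ ?_
      · simp only [Expr.Ok, Expr.eval, Op.eval_add, Op.eval_mul, e1, e2,
          eb, es]
        refine ⟨⟨ob, ⟨⟨by omega, by omega⟩, os, by omega⟩, by omega⟩, ⟨by omega, by omega⟩, hlt⟩
      · simp only [Expr.cost]
        omega
      · rw [hadr, ev]
        refine ⟨fun i' hi' j' hj' => ?_, fun j' hj' => ?_, fun x hx hx' => ?_⟩
        · rw [Function.update_of_ne, hf2 i' hi' j' hj']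
          intro h
          have := addr_inj (st := st) (i := i') (j := j') (i' := i) (j' := j) (by omega) (by omega)
            (by omega)
          omega
        · by_cases h : j' = j
          · simp [h]
          · rw [Function.update_of_ne (by omega), hg2 j' (by omega)]
        · rw [Function.update_of_ne (hx' j (by omega)), hm2 x hx (fun j' hj' => hx' j' (by omega))]
    · rintro m2 ⟨hf2, hg2, hm2⟩
      refine ⟨fun i' hi' j hj => ?_, fun x hx => ?_⟩
      · rcases Nat.lt_succ_iff_lt_or_eq.mp hi' with h | rfl
        · exact hf2 i' h j hj
        · exact hg2 j hj
      · exact hm2 x (fun i' hi' => hx i' (by omega)) (hx i (by omega))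

end WordRAM

namespace BinaryMatrix

open WordRAM

set_option linter.unusedSimpArgs false

/-! ### Lists and matrices in memory. -/

theorem length_encode {m n : ℕ} (M : Matrix (Fin m) (Fin n) (ZMod 2)) :
    (encode M).length = m * n := by
  simp [encode]

theorem getElem_encode {m n : ℕ} (M : Matrix (Fin m) (Fin n) (ZMod 2)) {q : ℕ}
    (hq : q < (encode M).length) (hi : q / n < m) (hj : q % n < n) :
    (encode M)[q] = (M ⟨q / n, hi⟩ ⟨q % n, hj⟩).val := by
  simp only [encode, List.getElem_ofFn]
  rfl

theorem getElem_encode_mul_add {m n : ℕ} (M : Matrix (Fin m) (Fin n) (ZMod 2)) (i : Fin m)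
    (j : Fin n) (hq : i * n + j < (encode M).length) :
    (encode M)[(i : ℕ) * n + j] = (M i j).val := by
  have hn : 0 < n := by have := j.2; omega
  have h1 : (i * n + j : ℕ) / n = i := by
    rw [mul_comm, Nat.mul_add_div hn, Nat.div_eq_of_lt j.2, add_zero]
  have h2 : (i * n + j : ℕ) % n = j := by
    rw [mul_comm, Nat.mul_add_mod, Nat.mod_eq_of_lt j.2]
  rw [getElem_encode M hq (by rw [h1]; exact i.2) (by rw [h2]; exact j.2)]
  congr 2
  · exact Fin.ext h1
  · exact Fin.ext h2

/-- The list `L` occupies the memory from the address `B`. -/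
def ListAt (mem : ℕ → ℕ) (B : ℕ) (L : List ℕ) : Prop :=
  ∀ (k : ℕ) (hk : k < L.length), mem (B + k) = L[k]

theorem listAt_cons {mem : ℕ → ℕ} {B x : ℕ} {L : List ℕ} :
    ListAt mem B (x :: L) ↔ mem B = x ∧ ListAt mem (B + 1) L := by
  constructor
  · intro h
    refine ⟨h 0 (Nat.succ_pos _), fun k hk => ?_⟩
    have := h (k + 1) (by simpa using hk)
    simpa [add_assoc, add_comm 1] using this
  · rintro ⟨h1, h2⟩ k hk
    cases k with
    | zero => simpa using h1
    | succ k =>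
      have := h2 k (by simpa using hk)
      simpa [add_assoc, add_comm 1] using this

theorem listAt_append {mem : ℕ → ℕ} {B : ℕ} {L L' : List ℕ} :
    ListAt mem B (L ++ L') ↔ ListAt mem B L ∧ ListAt mem (B + L.length) L' := by
  constructor
  · intro h
    refine ⟨fun k hk => ?_, fun k hk => ?_⟩
    · have := h k (by simp; omega)
      rwa [List.getElem_append_left hk] at this
    · have := h (L.length + k) (by simp; omega)
      rw [List.getElem_append_right (by omega)] at this
      simpa [add_assoc] using this
  · rintro ⟨h1, h2⟩ k hk
    by_cases h : k < L.length
    · rw [List.getElem_append_left h]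
      exact h1 k h
    · rw [List.getElem_append_right (by omega)]
      have := h2 (k - L.length) (by simp at hk; omega)
      rwa [show B + L.length + (k - L.length) = B + k by omega] at this

theorem listAt_encode {mem : ℕ → ℕ} {B m n : ℕ} {M : Matrix (Fin m) (Fin n) (ZMod 2)} :
    ListAt mem B (encode M) ↔ ∀ (i : Fin m) (j : Fin n), mem (B + (i * n + j)) = (M i j).val := by
  constructor
  · intro h i j
    have hl : (i * n + j : ℕ) < (encode M).length := by
      rw [length_encode]
      exact addr_lt i.2 j.2
    rw [h _ hl, getElem_encode_mul_add]
  · intro h k hk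
    have hk' := hk
    rw [length_encode] at hk'
    have hn : 0 < n := Nat.pos_of_ne_zero fun h0 => by simp [h0] at hk'
    have hi : k / n < m := Nat.div_lt_of_lt_mul (by rwa [mul_comm])
    rw [getElem_encode M hk hi (Nat.mod_lt _ hn), ← h]
    congr 2
    rw [mul_comm]
    exact (Nat.div_add_mod k n).symm

theorem listAt_ofFn {mem : ℕ → ℕ} {B n : ℕ} {f : Fin n → ℕ} :
    ListAt mem B (List.ofFn f) ↔ ∀ i : Fin n, mem (B + i) = f i := by
  constructor
  · intro h i
    simpa using h i (by simp)
  · intro h k hk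
    simpa using h ⟨k, by simpa using hk⟩

theorem listAt_init (L : List ℕ) : ListAt (State.init L).mem 0 L := by
  intro k hk
  simp [State.init, hk]

theorem init_mem_of_le {L : List ℕ} {k : ℕ} (h : L.length ≤ k) : (State.init L).mem k = 0 := by
  simp [State.init, h]

/-! ### The multiplication program as a subroutine. -/

/-- The program `p₀` multiplies `w × w` matrices in time `T₀ w`, with values below
`(w + 2) ^ c₀`. -/
def Multiplies (p₀ : Prog) (c₀ : ℕ) (T₀ : ℕ → ℕ) : Prop :=
  ∀ x : SquarePair, ∃ (s : State) (t : ℕ),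
    Exec ((x.n + 2) ^ c₀) p₀ (State.init (x.n :: (encode x.A ++ encode x.B))) s t ∧
      t ≤ T₀ x.n ∧ s.HasOutput (encode (x.A * x.B))

/-- Clear the registers of `p₀`, then run `p₀` at the address in the register `β`. -/
def callMul (β τ D : ℕ) (p₀ : Prog) : Prog :=
  .seq (Prog.clear D p₀.regBound) (p₀.reloc β τ D)

/-- After the clearing, the registers of `p₀` and the memory from `B` on look exactly like its
initial state; this needs zeros behind the two operands. The cost of a call is twice that of `p₀`,
plus a constant for the clearing. -/
theorem run_callMul {p₀ : Prog} {c₀ : ℕ} {T₀ : ℕ → ℕ} (hp₀ : Multiplies p₀ c₀ T₀) (hc : 3 ≤ c₀)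
    {W d β τ D w B T : ℕ} {env m : ℕ → ℕ} {Q : (ℕ → ℕ) → Prop} (X Y : ℕ → ℕ → ZMod 2)
    (hβ : β < d) (hτ : d ≤ τ) (hD : τ < D) (hB : env β = B) (hW : B + (w + 2) ^ c₀ ≤ W)
    (hw : m B = w) (hX : ∀ i < w, ∀ k < w, m (B + 1 + (i * w + k)) = (X i k).val)
    (hY : ∀ i < w, ∀ k < w, m (B + 1 + w * w + (i * w + k)) = (Y i k).val)
    (h0 : ∀ x, B + 1 + w * w + w * w ≤ x → m x = 0) (hT : 2 * T₀ w + p₀.regBound + 1 ≤ T)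
    (hQ : ∀ m' : ℕ → ℕ, (∀ i < w, ∀ l < w, m' (B + (i * w + l)) =
        (∑ k ∈ Finset.range w, X i k * Y k l).val) →
      (∀ x, x < B ∨ B + (w + 2) ^ c₀ ≤ x → m' x = m x) → Q m') :
    Run W d (callMul β τ D p₀) T env m Q := by
  intro s hs hm
  let P : SquarePair := ⟨w, .of fun i j => X i j, .of fun i j => Y i j⟩
  obtain ⟨s0, t0, e0, l0, o0⟩ := hp₀ P
  change Exec ((w + 2) ^ c₀) _ _ _ _ at e0
  change t0 ≤ T₀ w at l0
  set L := P.n :: (encode P.A ++ encode P.B) with hL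
  have hlen : L.length = 1 + w * w + w * w := by simp [hL, length_encode, P]; omega
  have hpow : 0 < (w + 2) ^ c₀ := by positivity
  obtain ⟨s1, e1, r1, k1, m1⟩ := exec_clear (W := W) (by omega) D p₀.regBound s
  have hLm : ListAt m B L := by
    rw [hL, listAt_cons, listAt_append, listAt_encode, listAt_encode]
    refine ⟨hw, fun i j => hX i i.2 j j.2, fun i j => ?_⟩
    rw [length_encode]
    exact hY i i.2 j j.2
  have hsim : Sim ((w + 2) ^ c₀) B β D p₀.regBound (State.init L) s1 := by
    refine ⟨fun r => by simp [State.init], fun r hr => by simp [State.init, r1 r hr], ?_, ?_⟩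
    · rw [k1 β (by omega), hs β hβ, hB]
    · intro a _
      rw [m1, hm]
      by_cases ha : a < L.length
      · rw [hLm a ha]
        simp [State.init, ha]
      · rw [init_mem_of_le (by omega), h0 _ (by omega)]
  obtain ⟨z, t, e2, l2, s2, u2⟩ := e0.reloc (W := W) (by omega) hD (by omega) hW le_rfl hsim
  refine ⟨z, _, .seq e1 e2, by omega, fun r hr => ?_, hQ _ ?_ ?_⟩
  · rw [u2.reg r (by omega) (by omega), k1 r (by omega), hs r hr]
  · intro i hi l hl
    -- The product has to lie inside the simulated window in order to be found at `B`.
    have hsq : w * w < (w + 2) ^ c₀ := by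
      calc w * w < (w + 2) ^ 2 := by ring_nf; omega
        _ ≤ (w + 2) ^ c₀ := Nat.pow_le_pow_right (by omega) (by omega)
    have hil := addr_lt hi hl
    rw [s2.mem _ (by omega)]
    have := (listAt_encode (mem := s0.mem) (B := 0)).mp
      (fun k hk => by rw [zero_add]; exact o0 k hk)
      ⟨i, hi⟩ ⟨l, hl⟩
    simp only [zero_add] at this
    refine this.trans ?_
    simp only [P, Matrix.mul_apply, Matrix.of_apply]
    rw [Fin.sum_univ_eq_sum_range (fun k => X i k * Y k l)]
  · intro x hx
    rw [u2.mem x hx, m1, hm]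

/-! ### Gauss–Jordan elimination on blocks of columns -/

/-- The row operations that the columns `a, …, b - 1` describe: a column `c` with `piv c = p + 1`
stands for adding `x p` times the column `c` to the vector `x`. -/
def elim (col : ℕ → ℕ → ZMod 2) (piv : ℕ → ℕ) (a b : ℕ) :
    (ℕ → ZMod 2) →ₗ[ZMod 2] (ℕ → ZMod 2) :=
  LinearMap.id + ∑ c ∈ Finset.Ico a b,
    if piv c = 0 then 0 else (LinearMap.proj (piv c - 1)).smulRight (col c)

theorem elim_apply (col : ℕ → ℕ → ZMod 2) (piv : ℕ → ℕ) (a b : ℕ) (x : ℕ → ZMod 2) :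
    elim col piv a b x =
      x + ∑ c ∈ Finset.Ico a b, if piv c = 0 then 0 else x (piv c - 1) • col c := by
  rw [elim, LinearMap.add_apply, LinearMap.id_apply, LinearMap.sum_apply]
  congr 1
  refine Finset.sum_congr rfl fun c _ => ?_
  split_ifs <;> simp

theorem elim_eq_self {col : ℕ → ℕ → ZMod 2} {piv : ℕ → ℕ} {a b : ℕ} {x : ℕ → ZMod 2}
    (h : ∀ c, a ≤ c → c < b → piv c ≠ 0 → x (piv c - 1) = 0) : elim col piv a b x = x := by
  rw [elim_apply, Finset.sum_eq_zero, add_zero]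
  intro c hc
  rw [Finset.mem_Ico] at hc
  split_ifs with h0
  · rfl
  · rw [h c hc.1 hc.2 h0, zero_smul]

/-- The columns `a, …, b - 1` after the row operations described by the columns `s, …, e - 1`. -/
def update (col : ℕ → ℕ → ZMod 2) (piv : ℕ → ℕ) (s e a b : ℕ) : ℕ → ℕ → ZMod 2 :=
  fun c => if a ≤ c ∧ c < b then elim col piv s e (col c) else col c

/-- The columns `a, …, b - 1` of `col₀` have been eliminated in place. The pivot row of a column is
recorded in `piv`, as its index plus one, and `0` stands for a column without a pivot. -/
structure Eliminated (a b : ℕ) (col₀ : ℕ → ℕ → ZMod 2) (piv₀ : ℕ → ℕ) (col : ℕ → ℕ → ZMod 2)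
    (piv : ℕ → ℕ) : Prop where
  col_eq : ∀ c, c < a ∨ b ≤ c → col c = col₀ c
  piv_eq : ∀ c, c < a ∨ b ≤ c → piv c = piv₀ c
  injective : Function.Injective (elim col piv a b)
  pivot : ∀ c, a ≤ c → c < b → piv c ≠ 0 → elim col piv a b (col₀ c) = Pi.single (piv c - 1) 1
  fresh : ∀ c, a ≤ c → c < b → piv c ≠ 0 → ∀ c' < c, piv c' ≠ piv c
  not_pivot : ∀ c, a ≤ c → c < b → piv c = 0 → elim col piv a b (col₀ c) = col c
  support : ∀ c, a ≤ c → c < b → piv c = 0 → ∀ p, (∀ c' < c, piv c' ≠ p + 1) → col c p = 0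

/-- Without a pivot the block has no row operations, and `elim` is the identity. -/
theorem eliminated_of_not_pivot {j : ℕ} {col : ℕ → ℕ → ZMod 2} {piv : ℕ → ℕ} (h0 : piv j = 0)
    (hs : ∀ p, (∀ c < j, piv c ≠ p + 1) → col j p = 0) :
    Eliminated j (j + 1) col piv col piv := by
  have hid : ∀ x, elim col piv j (j + 1) x = x := fun x => elim_eq_self fun c h1 h2 h3 => by
    obtain rfl : c = j := by omega
    exact absurd h0 h3
  refine ⟨fun _ _ => rfl, fun _ _ => rfl, fun x y h => by rwa [hid, hid] at h, fun c h1 h2 h3 => ?_,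
    fun c h1 h2 h3 => ?_, fun c _ _ _ => hid _, fun c h1 h2 h3 => ?_⟩
  all_goals obtain rfl : c = j := by omega
  · exact absurd h0 h3
  · exact absurd h0 h3
  · exact hs

/-- Adding `x_p` times the column with its entry at `p` replaced by 0 sends the column itself to
`e_p`, since `1 + 1 = 0`. It keeps the coordinate `x_p`, so it is its own inverse; this gives
injectivity. -/
theorem eliminated_of_pivot {j p : ℕ} {col : ℕ → ℕ → ZMod 2} {piv : ℕ → ℕ} (h1 : col j p = 1)
    (hf : ∀ c < j, piv c ≠ p + 1) :
    Eliminated j (j + 1) col piv (Function.update col j (Function.update (col j) p 0))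
      (Function.update piv j (p + 1)) := by
  set col' := Function.update col j (Function.update (col j) p 0) with hcol'
  set piv' := Function.update piv j (p + 1) with hpiv'
  have hcj : col' j = Function.update (col j) p 0 := by simp [col']
  have hpj : piv' j = p + 1 := by simp [piv']
  have hE : ∀ x, elim col' piv' j (j + 1) x = x + x p • col' j := fun x => by
    simp [elim_apply, hpj]
  have hinv : ∀ x, elim col' piv' j (j + 1) (elim col' piv' j (j + 1) x) = x := fun x => by
    rw [hE (elim _ _ _ _ x), hE x]
    have : (x + x p • col' j) p = x p := by simp [hcj]
    rw [this, add_assoc, CharTwo.add_self_eq_zero, add_zero]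
  refine ⟨fun c hc => ?_, fun c hc => ?_, Function.LeftInverse.injective hinv, fun c a1 a2 a3 => ?_,
    fun c a1 a2 a3 => ?_, fun c a1 a2 a3 => ?_, fun c a1 a2 a3 => ?_⟩
  · exact Function.update_of_ne (by omega) _ _
  · exact Function.update_of_ne (by omega) _ _
  all_goals obtain rfl : c = j := by omega
  · rw [hE, h1, one_smul, hpj, hcj]
    ext i
    by_cases hi : i = p
    · simp [hi, h1]
    · simp [hi, CharTwo.add_self_eq_zero]
  · intro c' hc'
    rw [hpj, hpiv', Function.update_of_ne (by omega)]
    exact hf c' hc'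
  · omega
  · omega

/-- The step of the divide and conquer. Besides composing the two operators, one has to see that the
right half spoils nothing on the left: its pivot rows are fresh, hence distinct from those on which
the finished left columns are supported. -/
theorem Eliminated.merge {a mid b : ℕ} (ham : a ≤ mid) (hmb : mid ≤ b)
    {col₀ col₁ col₃ : ℕ → ℕ → ZMod 2} {piv₀ piv₁ piv₃ : ℕ → ℕ}
    (h₁ : Eliminated a mid col₀ piv₀ col₁ piv₁)
    (h₃ : Eliminated mid b (update col₁ piv₁ a mid mid b) piv₁ col₃ piv₃) :
    Eliminated a b col₀ piv₀ (update col₃ piv₃ mid b a mid) piv₃ := by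
  set col₂ := update col₁ piv₁ a mid mid b with hcol₂
  set col₄ := update col₃ piv₃ mid b a mid with hcol₄
  have hl3 : ∀ c < mid, col₃ c = col₁ c := fun c hc => by
    rw [h₃.col_eq c (.inl hc), hcol₂, update, if_neg (by omega)]
  have hp3 : ∀ c < mid, piv₃ c = piv₁ c := fun c hc => h₃.piv_eq c (.inl hc)
  have hl4 : ∀ c, a ≤ c → c < mid → col₄ c = elim col₃ piv₃ mid b (col₁ c) := fun c hc hc' => by
    rw [hcol₄, update, if_pos ⟨hc, hc'⟩, hl3 c hc']
  have hr4 : ∀ c, mid ≤ c → col₄ c = col₃ c := fun c hc => by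
    rw [hcol₄, update, if_neg (by omega)]
  have hr2 : ∀ c, mid ≤ c → c < b → col₂ c = elim col₁ piv₁ a mid (col₀ c) := fun c hc hc' => by
    rw [hcol₂, update, if_pos ⟨hc, hc'⟩, h₁.col_eq c (.inr hc)]
  -- By linearity `E₃ (x + ∑ x_p • col₁ c) = E₃ x + ∑ x_p • E₃ (col₁ c)`, and the columns `E₃ (col₁
  -- c)` are the updated left columns. So the stored columns describe the composite operator, with
  -- no separate transformation matrix.
  have hcomp : ∀ x, elim col₄ piv₃ a b x = elim col₃ piv₃ mid b (elim col₁ piv₁ a mid x) := by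
    intro x
    rw [elim_apply col₁, map_add, elim_apply col₃, elim_apply col₄, map_sum,
      ← Finset.sum_Ico_consecutive _ ham hmb, add_assoc, add_comm (Finset.sum _ _)]
    congr 2
    · refine Finset.sum_congr rfl fun c hc => ?_
      rw [Finset.mem_Ico] at hc
      rw [hr4 c hc.1]
    · refine Finset.sum_congr rfl fun c hc => ?_
      rw [Finset.mem_Ico] at hc
      rw [hl4 c hc.1 hc.2, hp3 c hc.2]
      split_ifs <;> simp
  -- the row operations of the right half do not affect vectors supported on earlier pivot rows
  have hfix : ∀ c < mid, piv₁ c = 0 → a ≤ c → elim col₃ piv₃ mid b (col₁ c) = col₁ c :=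
    fun c hc h0 hac => elim_eq_self fun c' h1 h2 h3 => h₁.support c hac hc h0 _ fun c'' h'' => by
      have := h₃.fresh c' h1 h2 h3 c'' (by omega)
      rw [← hp3 c'' (by omega)]
      omega
  refine ⟨fun c hc => ?_, fun c hc => ?_, ?_, fun c h1 h2 h0 => ?_, fun c h1 h2 h0 => ?_,
    fun c h1 h2 h0 => ?_, fun c h1 h2 h0 => ?_⟩
  · rcases hc with hc | hc
    · rw [hcol₄, update, if_neg (by omega), hl3 c (by omega), h₁.col_eq c (.inl hc)]
    · rw [hr4 c (by omega), h₃.col_eq c (.inr hc), hcol₂, update, if_neg (by omega),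
        h₁.col_eq c (.inr (by omega))]
  · rcases hc with hc | hc
    · rw [hp3 c (by omega), h₁.piv_eq c (.inl hc)]
    · rw [h₃.piv_eq c (.inr hc), h₁.piv_eq c (.inr (by omega))]
  · intro x y hxy
    rw [hcomp, hcomp] at hxy
    exact h₁.injective (h₃.injective hxy)
  · rw [hcomp]
    by_cases hc : c < mid
    · rw [hp3 c hc] at h0 ⊢
      rw [h₁.pivot c h1 hc h0]
      -- The unit vector reached by a left pivot column vanishes on the pivot rows of the right
      -- half.
      refine elim_eq_self fun c' k1 k2 k3 => ?_
      have := h₃.fresh c' k1 k2 k3 c (by omega)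
      rw [hp3 c hc] at this
      exact Pi.single_eq_of_ne (by omega) _
    · rw [← hr2 c (by omega) h2, h₃.pivot c (by omega) h2 h0]
  · by_cases hc : c < mid
    · intro c' hc'
      rw [hp3 c hc] at h0 ⊢
      rw [hp3 c' (by omega)]
      exact h₁.fresh c h1 hc h0 c' hc'
    · exact h₃.fresh c (by omega) h2 h0
  · rw [hcomp]
    by_cases hc : c < mid
    · rw [hl4 c h1 hc, h₁.not_pivot c h1 hc (by rwa [hp3 c hc] at h0)]
    · rw [← hr2 c (by omega) h2, h₃.not_pivot c (by omega) h2 h0, hr4 c (by omega)]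
  · intro p hp
    by_cases hc : c < mid
    · have h0' : piv₁ c = 0 := by rwa [hp3 c hc] at h0
      rw [hl4 c h1 hc, hfix c hc h0' h1]
      exact h₁.support c h1 hc h0' p fun c' hc' => by rw [← hp3 c' (by omega)]; exact hp c' hc'
    · rw [hr4 c (by omega)]
      exact h₃.support c (by omega) h2 h0 p hp

/-! ### Rank, coordinates and earliest basis from a finished elimination. -/

/-- Extension of a vector by zeros. -/
def extendZero (m : ℕ) : (Fin m → ZMod 2) →ₗ[ZMod 2] (ℕ → ZMod 2) where
  toFun x i := if h : i < m then x ⟨i, h⟩ else 0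
  map_add' x y := by ext i; by_cases h : i < m <;> simp [h]
  map_smul' a x := by ext i; by_cases h : i < m <;> simp [h]

theorem extendZero_apply_fin {m : ℕ} (x : Fin m → ZMod 2) (i : Fin m) : extendZero m x i = x i := by
  simp [extendZero]

theorem extendZero_apply_of_le {m : ℕ} (x : Fin m → ZMod 2) {i : ℕ} (hi : m ≤ i) :
    extendZero m x i = 0 := by
  simp [extendZero, hi]

theorem extendZero_injective (m : ℕ) : Function.Injective (extendZero m) := fun x y h => by
  ext i
  rw [← extendZero_apply_fin x, h, extendZero_apply_fin]

/-- The columns of a matrix, extended by zeros. -/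
def colOf {m n : ℕ} (A : Matrix (Fin m) (Fin n) (ZMod 2)) (c : ℕ) : ℕ → ZMod 2 :=
  if h : c < n then extendZero m (A.col ⟨c, h⟩) else 0

theorem colOf_fin {m n : ℕ} (A : Matrix (Fin m) (Fin n) (ZMod 2)) (c : Fin n) :
    colOf A c = extendZero m (A.col c) := by
  simp [colOf]

theorem colOf_fin_fin {m n : ℕ} (A : Matrix (Fin m) (Fin n) (ZMod 2)) (i : Fin m) (c : Fin n) :
    colOf A c i = A i c := by
  rw [colOf_fin, extendZero_apply_fin, Matrix.col_apply]

theorem colOf_of_le {m n : ℕ} (A : Matrix (Fin m) (Fin n) (ZMod 2)) {c : ℕ} (h : n ≤ c) :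
    colOf A c = 0 := by
  simp [colOf, h]

theorem colOf_apply_of_le {m n : ℕ} (A : Matrix (Fin m) (Fin n) (ZMod 2)) {c i : ℕ} (h : m ≤ i) :
    colOf A c i = 0 := by
  unfold colOf
  split_ifs
  · exact extendZero_apply_of_le _ h
  · rfl

/-- The number of pivots among the first `n` columns. -/
def numPivots (piv : ℕ → ℕ) (n : ℕ) : ℕ := Nat.count (fun c => piv c ≠ 0) n

/-- The `k`-th column with a pivot. -/
noncomputable def nthPivot (piv : ℕ → ℕ) (k : ℕ) : ℕ := Nat.nth (fun c => piv c ≠ 0) k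

theorem nthPivot_spec {piv : ℕ → ℕ} {k n : ℕ} (h : k < numPivots piv n) :
    nthPivot piv k < n ∧ piv (nthPivot piv k) ≠ 0 ∧ numPivots piv (nthPivot piv k) = k :=
  have h' : ∀ hf : (Set.ofPred fun c => piv c ≠ 0).Finite, k < hf.toFinset.card := fun hf =>
    h.trans_le (Nat.count_le_card hf n)
  ⟨Nat.nth_lt_of_lt_count h, Nat.nth_mem k h', Nat.count_nth h'⟩

theorem nthPivot_lt_nthPivot {piv : ℕ → ℕ} {k l n : ℕ} (hkl : k < l) (h : l < numPivots piv n) :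
    nthPivot piv k < nthPivot piv l :=
  Nat.nth_lt_nth' hkl fun hf => h.trans_le (Nat.count_le_card hf n)

theorem nthPivot_numPivots {piv : ℕ → ℕ} {c : ℕ} (h : piv c ≠ 0) :
    nthPivot piv (numPivots piv c) = c :=
  Nat.nth_count (p := fun c => piv c ≠ 0) h

theorem numPivots_lt {piv : ℕ → ℕ} {c n : ℕ} (h : piv c ≠ 0) (hc : c < n) :
    numPivots piv c < numPivots piv n :=
  Nat.count_strict_mono (p := fun c => piv c ≠ 0) h hc

theorem numPivots_le (piv : ℕ → ℕ) (n : ℕ) : numPivots piv n ≤ n := Nat.count_le _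

theorem numPivots_succ (piv : ℕ → ℕ) (n : ℕ) :
    numPivots piv (n + 1) = numPivots piv n + if piv n ≠ 0 then 1 else 0 :=
  Nat.count_succ _ _

/-- The coordinates of the column `c` in the columns with a pivot. -/
noncomputable def coord (col : ℕ → ℕ → ZMod 2) (piv : ℕ → ℕ) (c k : ℕ) : ZMod 2 :=
  if piv c = 0 then col c (piv (nthPivot piv k) - 1) else if nthPivot piv k = c then 1 else 0

section

variable {m n N : ℕ} {A : Matrix (Fin m) (Fin n) (ZMod 2)} {col : ℕ → ℕ → ZMod 2} {piv : ℕ → ℕ}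

/-- Padding columns get no pivot: they are zero, and a linear map does not send 0 to a unit vector.
-/
theorem Eliminated.lt_of_ne_zero (h : Eliminated 0 N (colOf A) (fun _ => 0) col piv) {c : ℕ}
    (hc : piv c ≠ 0) : c < N ∧ c < n := by
  have hN : c < N := by
    by_contra h'
    exact hc (h.piv_eq c (.inr (by omega)))
  refine ⟨hN, ?_⟩
  by_contra h'
  have := h.pivot c (Nat.zero_le _) hN hc
  rw [colOf_of_le A (by omega), map_zero] at this
  exact one_ne_zero (Pi.single_eq_zero_iff.mp this.symm)

theorem Eliminated.piv_inj (h : Eliminated 0 N (colOf A) (fun _ => 0) col piv) {c c' : ℕ}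
    (hc : piv c ≠ 0) (he : piv c = piv c') : c = c' := by
  have h1 := (h.lt_of_ne_zero hc).1
  have h2 := (h.lt_of_ne_zero (he ▸ hc)).1
  rcases lt_trichotomy c c' with hlt | rfl | hlt
  · exact absurd he (h.fresh c' (Nat.zero_le _) h2 (he ▸ hc) c hlt)
  · rfl
  · exact absurd he.symm (h.fresh c (Nat.zero_le _) h1 hc c' hlt)

/-- This triangularity makes the basis the earliest one: a column involves no pivot column to its
right, because its reduced form is supported on earlier pivot rows and pivot rows are never reused.
-/
theorem Eliminated.coord_eq_zero (h : Eliminated 0 N (colOf A) (fun _ => 0) col piv) (hn : n ≤ N)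
    {c k : ℕ} (hc : c < n) (hk : k < numPivots piv n) (hlt : c < nthPivot piv k) :
    coord col piv c k = 0 := by
  unfold coord
  obtain ⟨k1, k2, k3⟩ := nthPivot_spec hk
  split_ifs with h0 h1
  · refine h.support c (Nat.zero_le _) (by omega) h0 _ fun c' hc' => ?_
    have := h.fresh _ (Nat.zero_le _) (k1.trans_le hn) k2 c' (hc'.trans hlt)
    omega
  · omega
  · rfl

/-- For a column without a pivot, apply the injective operator `E`: the pivot columns become unit
vectors and the column becomes its stored form, whose entries in the pivot rows are the coordinates.
-/
theorem Eliminated.col_eq_sum (h : Eliminated 0 N (colOf A) (fun _ => 0) col piv) (hn : n ≤ N)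
    {c : ℕ} (hc : c < n) :
    colOf A c = ∑ k : Fin (numPivots piv n), coord col piv c k • colOf A (nthPivot piv k) := by
  by_cases h0 : piv c = 0
  · apply h.injective
    rw [h.not_pivot c (Nat.zero_le _) (hc.trans_le hn) h0, map_sum]
    ext p
    rw [Finset.sum_apply]
    have hterm : ∀ k : Fin (numPivots piv n),
        (elim col piv 0 N (coord col piv c k • colOf A (nthPivot piv k))) p =
          if piv (nthPivot piv k) = p + 1 then col c p else 0 := fun k => by
      obtain ⟨k1, k2, k3⟩ := nthPivot_spec k.2
      rw [map_smul, h.pivot _ (Nat.zero_le _) (k1.trans_le hn) k2, coord, if_pos h0, Pi.smul_apply,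
        Pi.single_apply, smul_eq_mul]
      by_cases he : piv (nthPivot piv k) = p + 1
      · simp [he]
      · rw [if_neg he, if_neg (by omega), mul_zero]
    simp only [hterm]
    -- In the pivot row of an earlier column exactly one term of the sum survives; in any other row
    -- the stored column is zero.
    by_cases hp : ∃ c' < c, piv c' = p + 1
    · obtain ⟨c', hc', hp'⟩ := hp
      have hcp : piv c' ≠ 0 := by omega
      have hk0 : numPivots piv c' < numPivots piv n := numPivots_lt hcp (by omega)
      have hnth : nthPivot piv (numPivots piv c') = c' := nthPivot_numPivots hcp
      rw [Finset.sum_eq_single ⟨_, hk0⟩]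
      · rw [if_pos]
        rw [hnth, hp']
      · intro k _ hk
        rw [if_neg]
        intro he
        apply hk
        ext
        change (k : ℕ) = numPivots piv c'
        rw [← (nthPivot_spec k.2).2.2, h.piv_inj (nthPivot_spec k.2).2.1 (he.trans hp'.symm)]
      · simp
    · push Not at hp
      rw [h.support c (Nat.zero_le _) (by omega) h0 p hp]
      simp
  · have hk0 : numPivots piv c < numPivots piv n := numPivots_lt h0 hc
    have hnth : nthPivot piv (numPivots piv c) = c := nthPivot_numPivots h0
    rw [Finset.sum_eq_single ⟨_, hk0⟩]
    · simp [coord, h0, hnth]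
    · intro k _ hk
      have : nthPivot piv k ≠ c := fun he => hk (by
        ext
        change (k : ℕ) = numPivots piv c
        rw [← (nthPivot_spec k.2).2.2, he])
      simp [coord, h0, this]
    · simp

/-- The `k`-th column with a pivot, as a column index of the matrix. -/
noncomputable def pivotFin (piv : ℕ → ℕ) (n : ℕ) (k : Fin (numPivots piv n)) : Fin n :=
  ⟨nthPivot piv k, (nthPivot_spec k.2).1⟩

theorem Eliminated.col_eq_sum_fin (h : Eliminated 0 N (colOf A) (fun _ => 0) col piv) (hn : n ≤ N)
    (c : Fin n) : A.col c =
      ∑ k : Fin (numPivots piv n), coord col piv c k • A.col (pivotFin piv n k) := by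
  apply extendZero_injective
  rw [← colOf_fin, h.col_eq_sum hn c.2, map_sum]
  refine Finset.sum_congr rfl fun k _ => ?_
  rw [map_smul, ← colOf_fin]
  rfl

/-- `E` sends these columns to distinct unit vectors, so the row of the `k`-th pivot isolates the
coefficient `g k`. -/
theorem Eliminated.linearIndependent (h : Eliminated 0 N (colOf A) (fun _ => 0) col piv)
    (hn : n ≤ N) : LinearIndependent (ZMod 2) fun k => A.col (pivotFin piv n k) := by
  rw [Fintype.linearIndependent_iff]
  intro g hg k
  have h1 := congrArg (fun x => elim col piv 0 N (extendZero m x)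
    (piv (nthPivot piv k) - 1)) hg
  have hk := nthPivot_spec k.2
  simp only [map_sum, map_smul, map_zero, ← colOf_fin, Finset.sum_apply] at h1
  rw [Finset.sum_eq_single k] at h1
  · change (g k • elim col piv 0 N (colOf A (nthPivot piv k))) _ = _ at h1
    rw [h.pivot _ (Nat.zero_le _) (hk.1.trans_le hn) hk.2.1] at h1
    simpa using h1
  · intro l _ hl
    have hl' := nthPivot_spec l.2
    change (g l • elim col piv 0 N (colOf A (nthPivot piv l))) _ = _
    rw [h.pivot _ (Nat.zero_le _) (hl'.1.trans_le hn) hl'.2.1, Pi.smul_apply, Pi.single_eq_of_ne,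
      smul_zero]
    intro he
    apply hl
    ext
    rw [← hl'.2.2, ← hk.2.2, h.piv_inj hk.2.1 (c' := nthPivot piv l)
      (by have := hk.2.1; have := hl'.2.1; omega)]
  · simp

theorem Eliminated.rank_eq (h : Eliminated 0 N (colOf A) (fun _ => 0) col piv) (hn : n ≤ N) :
    A.rank = numPivots piv n := by
  have hspan : Submodule.span (ZMod 2) (Set.range A.col) =
      Submodule.span (ZMod 2) (Set.range fun k => A.col (pivotFin piv n k)) := by
    apply le_antisymm
    · rw [Submodule.span_le]
      rintro _ ⟨c, rfl⟩
      rw [h.col_eq_sum_fin hn c]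
      exact Submodule.sum_mem _ fun k _ => Submodule.smul_mem _ _ (Submodule.subset_span ⟨k, rfl⟩)
    · apply Submodule.span_mono
      rintro _ ⟨k, rfl⟩
      exact ⟨_, rfl⟩
  rw [Matrix.rank_eq_finrank_span_cols, hspan, finrank_span_eq_card (h.linearIndependent hn),
    Fintype.card_fin]

/-- The earliest basis, as found by the elimination. -/
noncomputable def pivotEmb {r : ℕ} (piv : ℕ → ℕ) (n : ℕ) (hr : r = numPivots piv n) :
    Fin r ↪o Fin n :=
  OrderEmbedding.ofStrictMono (fun k => pivotFin piv n (k.cast hr)) fun _ l hkl =>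
    nthPivot_lt_nthPivot (n := n) hkl (l.cast hr).2

theorem pivotEmb_val {r : ℕ} (piv : ℕ → ℕ) (n : ℕ) (hr : r = numPivots piv n) (k : Fin r) :
    (pivotEmb piv n hr k : ℕ) = nthPivot piv k := rfl

/-- The pivot sequence is minimal even termwise, which implies lexicographic minimality. If the
`k`-th term of a competitor came before the `k`-th pivot, its first `k + 1` columns would be
independent vectors in the span of the first `k` pivot columns. -/
theorem Eliminated.isEarliestBasis (h : Eliminated 0 N (colOf A) (fun _ => 0) col piv)
    (hn : n ≤ N) : IsEarliestBasis A (pivotEmb piv n (h.rank_eq hn)) := by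
  have hcols : ∀ e : Fin A.rank ↪o Fin n, (A.submatrix id e).col = fun k => A.col (e k) :=
    fun _ => rfl
  have hr := h.rank_eq hn
  refine ⟨?_, fun e' he' => Pi.toLex_monotone fun k => ?_⟩
  · rw [Matrix.rank_eq_finrank_span_cols, hcols, finrank_span_eq_card, Fintype.card_fin]
    exact (h.linearIndependent hn).comp (Fin.cast hr) (Fin.cast_injective hr)
  · by_contra! hlt
    have hind : LinearIndependent (ZMod 2) fun k => A.col (e' k) := by
      rw [linearIndependent_iff_card_eq_finrank_span, Fintype.card_fin, Set.finrank, ← hcols,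
        ← Matrix.rank_eq_finrank_span_cols, he']
    have hind' := hind.comp (fun j : Fin (k + 1) => (⟨j, by omega⟩ : Fin A.rank)) fun i j hij => by
      simpa [Fin.ext_iff] using hij
    have hle : Submodule.span (ZMod 2) (Set.range ((fun k => A.col (e' k)) ∘
        fun j : Fin (k + 1) => (⟨j, by omega⟩ : Fin A.rank))) ≤ Submodule.span (ZMod 2)
        (Set.range fun j : Fin k => A.col (pivotFin piv n ⟨j, by omega⟩)) := by
      rw [Submodule.span_le]
      rintro _ ⟨j, rfl⟩
      simp only [Function.comp]
      rw [h.col_eq_sum_fin hn]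
      refine Submodule.sum_mem _ fun l _ => ?_
      by_cases hl : (l : ℕ) < k
      · exact Submodule.smul_mem _ _ (Submodule.subset_span ⟨⟨l, hl⟩, rfl⟩)
      -- A column up to `e' k` lies before the `k`-th pivot, hence before the `l`-th one for `l ≥
      -- k`.
      · rw [h.coord_eq_zero hn (Fin.is_lt _) l.2, zero_smul]
        · exact Submodule.zero_mem _
        have h1 : e' ⟨j, by omega⟩ ≤ e' k := e'.monotone (Fin.le_def.mpr (by
          have := j.2
          simp only
          omega))
        have h2 : nthPivot piv k ≤ nthPivot piv l := by
          rcases (not_lt.mp hl).eq_or_lt with he | hlt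
          · rw [he]
          · exact (nthPivot_lt_nthPivot hlt l.2).le
        exact (Fin.le_def.mp h1).trans_lt ((Fin.lt_def.mp hlt).trans_le h2)
    have := Submodule.finrank_mono hle
    rw [finrank_span_eq_card hind', Fintype.card_fin] at this
    have h3 := (finrank_range_le_card (R := ZMod 2)
      fun j : Fin k => A.col (pivotFin piv n ⟨j, by omega⟩))
    rw [Fintype.card_fin] at h3
    exact absurd (this.trans h3) (by omega)

end

/-! ### The permutation that moves the columns with a pivot to the front -/

/-- The position of the column `c` after the columns with a pivot are moved to the front. -/
def position (piv : ℕ → ℕ) (n c : ℕ) : ℕ :=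
  if piv c ≠ 0 then numPivots piv c else numPivots piv n + Nat.count (fun c => piv c = 0) c

theorem numPivots_add_count (piv : ℕ → ℕ) (n : ℕ) :
    numPivots piv n + Nat.count (fun c => piv c = 0) n = n := by
  induction n with
  | zero => simp [numPivots]
  | succ n ih =>
    rw [numPivots_succ, Nat.count_succ]
    split_ifs <;> omega

theorem position_lt {piv : ℕ → ℕ} {n c : ℕ} (hc : c < n) : position piv n c < n := by
  have := numPivots_add_count piv n
  unfold position
  split_ifs with h
  · exact (numPivots_le piv c).trans_lt hc
  · have : Nat.count (fun c => piv c = 0) c < Nat.count (fun c => piv c = 0) n :=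
      Nat.count_strict_mono (by simpa using h) hc
    omega

/-- Columns with a pivot have positions below their total number, the others have positions from
there on, and within each kind positions count predecessors. -/
theorem position_inj {piv : ℕ → ℕ} {n c c' : ℕ} (hc : c < n) (hc' : c' < n)
    (h : position piv n c = position piv n c') : c = c' := by
  unfold position at h
  split_ifs at h with h1 h2 h2
  · exact Nat.count_injective (p := fun c => piv c ≠ 0) h1 h2 h
  · have : numPivots piv c < numPivots piv n := numPivots_lt h1 hc
    omega
  · have : numPivots piv c' < numPivots piv n := numPivots_lt h2 hc'
    omega
  · exact Nat.count_injective (p := fun c => piv c = 0) (by simpa using h1) (by simpa using h2)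
      (by omega)

/-- The permutation that moves the columns with a pivot to the front. -/
noncomputable def positionPerm (piv : ℕ → ℕ) (n : ℕ) : Equiv.Perm (Fin n) :=
  Equiv.ofBijective (fun c => ⟨position piv n c, position_lt c.2⟩)
    (Finite.injective_iff_bijective.mp fun c c' h =>
      Fin.ext (position_inj c.2 c'.2 (congrArg Fin.val h)))

theorem positionPerm_val (piv : ℕ → ℕ) (n : ℕ) (c : Fin n) :
    (positionPerm piv n c : ℕ) = position piv n c := rfl

theorem position_symm (piv : ℕ → ℕ) (n : ℕ) (j : Fin n) :
    position piv n ((positionPerm piv n).symm j) = j := by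
  rw [← positionPerm_val, Equiv.apply_symm_apply]

theorem positionPerm_symm_of_lt {piv : ℕ → ℕ} {n : ℕ} {j : Fin n} (hj : j < numPivots piv n) :
    ((positionPerm piv n).symm j : ℕ) = nthPivot piv j := by
  obtain ⟨h1, h2, h3⟩ := nthPivot_spec hj
  have : (positionPerm piv n).symm j = ⟨nthPivot piv j, h1⟩ := by
    rw [Equiv.symm_apply_eq]
    ext
    rw [positionPerm_val, position, if_pos h2, h3]
  rw [this]

theorem piv_positionPerm_symm {piv : ℕ → ℕ} {n : ℕ} {j : Fin n} (hj : numPivots piv n ≤ j) :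
    piv ((positionPerm piv n).symm j) = 0 := by
  by_contra h0
  have h1 := position_symm piv n j
  rw [position, if_pos h0] at h1
  have := numPivots_lt h0 ((positionPerm piv n).symm j).2
  omega

theorem permMatrix_apply {n : ℕ} (σ : Equiv.Perm (Fin n)) (i j : Fin n) :
    σ.permMatrix (ZMod 2) i j = if σ.symm j = i then 1 else 0 := by
  rw [Equiv.Perm.permMatrix, PEquiv.toMatrix_apply]
  simp only [Equiv.toPEquiv_apply, Option.mem_def, Option.some.injEq, Equiv.symm_apply_eq]
  simp only [eq_comm]

section

variable {m n N : ℕ} {A : Matrix (Fin m) (Fin n) (ZMod 2)} {col : ℕ → ℕ → ZMod 2} {piv : ℕ → ℕ}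

/-- The coordinates of the columns without a pivot. -/
noncomputable def coordMatrix (col : ℕ → ℕ → ZMod 2) (piv : ℕ → ℕ) (n r : ℕ) :
    Matrix (Fin r) (Fin (n - r)) (ZMod 2) :=
  .of fun k t => col ((positionPerm piv n).symm ⟨r + t, by omega⟩) (piv (nthPivot piv k) - 1)

/-- Column `j` of `A * P` is the column of `A` whose position is `j`. The first `rank` of them are
the pivot columns, whose coordinates form the identity block; the coordinates of the others form
`R`. -/
theorem Eliminated.decomposition (h : Eliminated 0 N (colOf A) (fun _ => 0) col piv)
    (hn : n ≤ N) : A * (positionPerm piv n).permMatrix (ZMod 2) =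
      A.submatrix id (pivotEmb piv n (h.rank_eq hn)) *
        idBlock A.rank_le_width (coordMatrix col piv n A.rank) := by
  have hr := h.rank_eq hn
  ext i j
  rw [Matrix.mul_apply, Matrix.mul_apply]
  simp only [permMatrix_apply, mul_ite, mul_one, mul_zero, Finset.sum_ite_eq, Finset.mem_univ,
    if_true, Matrix.submatrix_apply, id]
  have hcol := congrFun (h.col_eq_sum_fin hn ((positionPerm piv n).symm j)) i
  rw [Finset.sum_apply] at hcol
  rw [Matrix.col_apply] at hcol
  rw [hcol, ← Equiv.sum_comp (finCongr hr)]
  refine Finset.sum_congr rfl fun k _ => ?_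
  rw [Pi.smul_apply, smul_eq_mul, mul_comm]
  congr 1
  by_cases hj : (j : ℕ) < A.rank
  · have h1 : ((finSumFinEquiv.trans (finCongr (Nat.add_sub_of_le A.rank_le_width))).symm j) =
        Sum.inl ⟨j, hj⟩ := by
      rw [Equiv.symm_apply_eq]
      rfl
    rw [idBlock, Matrix.reindex_apply, Matrix.submatrix_apply, h1, Matrix.fromCols_apply_inl,
      Matrix.one_apply, coord, positionPerm_symm_of_lt (hr ▸ hj)]
    have h2 := nthPivot_spec (hr ▸ hj)
    rw [if_neg h2.2.1]
    have hk := nthPivot_spec (k.cast hr).2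
    congr 1
    simp only [finCongr_apply, Fin.val_cast, Equiv.refl_symm, Equiv.refl_apply, eq_iff_iff]
    constructor
    · intro he
      ext
      exact hk.2.2.symm.trans ((congrArg (numPivots piv) he).trans h2.2.2)
    · rintro rfl
      rfl
  · have h1 : ((finSumFinEquiv.trans (finCongr (Nat.add_sub_of_le A.rank_le_width))).symm j) =
        Sum.inr ⟨j - A.rank, by omega⟩ := by
      rw [Equiv.symm_apply_eq]
      ext
      simp
      omega
    rw [idBlock, Matrix.reindex_apply, Matrix.submatrix_apply, h1, Matrix.fromCols_apply_inr,
      coord, if_pos (piv_positionPerm_symm (by omega)), coordMatrix, Matrix.of_apply]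
    congr 3
    ext
    simp
    omega

/-! ### The inverse of a matrix of full rank -/

/-- Full rank forces a pivot in each of the `n` columns, and `E` sends column `c` to the unit vector
of its pivot row. So the matrix of `E`, with its rows taken in the order of the pivots, is a left
inverse of `A`. -/
theorem Eliminated.inv_apply {A : Matrix (Fin n) (Fin n) (ZMod 2)}
    (h : Eliminated 0 N (colOf A) (fun _ => 0) col piv) (hn : n ≤ N) (hA : A.rank = n)
    (j i : Fin n) :
    piv j ≠ 0 ∧ A⁻¹ j i = elim col piv 0 N (Pi.single (i : ℕ) 1) (piv j - 1) := by
  have hall : ∀ c : Fin n, piv c ≠ 0 := fun c =>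
    Nat.count_iff_forall.mp ((h.rank_eq hn).symm.trans hA) c c.2
  refine ⟨hall j, ?_⟩
  let B : Matrix (Fin n) (Fin n) (ZMod 2) :=
    .of fun j i => elim col piv 0 N (Pi.single (i : ℕ) 1) (piv j - 1)
  have hB : B * A = 1 := by
    ext j c
    have h1 := h.pivot c (Nat.zero_le _) (by omega) (hall c)
    -- Expanding the column in unit vectors turns `E (A e_c)`, by linearity, into an entry of `B *
    -- A`.
    have h2 : colOf A c = ∑ i : Fin n, A i c • (Pi.single (i : ℕ) 1 : ℕ → ZMod 2) := by
      ext p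
      rw [Finset.sum_apply]
      by_cases hp : p < n
      · rw [Finset.sum_eq_single ⟨p, hp⟩]
        · simpa using colOf_fin_fin A ⟨p, hp⟩ c
        · intro i _ hi
          rw [Pi.smul_apply, Pi.single_eq_of_ne, smul_zero]
          rintro rfl
          exact hi rfl
        · simp
      · rw [colOf_apply_of_le A (by omega), Finset.sum_eq_zero]
        intro i _
        rw [Pi.smul_apply, Pi.single_eq_of_ne (by omega), smul_zero]
    rw [h2, map_sum] at h1
    have h3 := congrFun h1 (piv j - 1)
    rw [Finset.sum_apply] at h3
    rw [Matrix.mul_apply, Matrix.one_apply]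
    refine Eq.trans (Finset.sum_congr rfl fun i _ => ?_) (h3.trans ?_)
    · rw [map_smul, Pi.smul_apply, smul_eq_mul, mul_comm]
      rfl
    · rw [Pi.single_apply]
      congr 1
      rw [eq_iff_iff]
      constructor
      · intro he
        exact Fin.ext (h.piv_inj (hall j) (by have := hall j; have := hall c; omega))
      · rintro rfl
        rfl
  rw [Matrix.inv_eq_left_inv hB]
  rfl

end

/-! ### Memory layout, and block updates by matrix multiplication. -/

/-- The memory holds the partially eliminated matrix, with the pivot row of each column, and for
each row the column in which it is the pivot row. -/
structure Rep (N : ℕ) (m : ℕ → ℕ) (col : ℕ → ℕ → ZMod 2) (piv : ℕ → ℕ) : Prop where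
  mat : ∀ i < N, ∀ c < N, m (5 * (N * N) + i * N + c) = (col c i).val
  piv_mem : ∀ c < N, m (7 * (N * N) + c) = piv c
  used : ∀ p < N, (m (8 * (N * N) + p) = 0 ∧ ∀ c, piv c ≠ p + 1) ∨
    ∃ c, m (8 * (N * N) + p) = c + 1 ∧ piv c = p + 1
  piv_le : ∀ c, piv c ≤ N
  piv_zero : ∀ c, N ≤ c → piv c = 0
  col_zero : ∀ c i, N ≤ i → col c i = 0

theorem zmod_val_lt (a : ZMod 2) : a.val < 2 := ZMod.val_lt a

/-- The rows of the pivots of a block, in the columns of another block. -/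
def pivotRows (col : ℕ → ℕ → ZMod 2) (piv : ℕ → ℕ) (src dst i j : ℕ) : ZMod 2 :=
  if piv (src + i) = 0 then 0 else col (dst + j) (piv (src + i) - 1)

/-- The update of a block as a matrix product: destination plus (source columns) times (pivot rows
of the source, taken in the destination columns). This is where fast multiplication enters. -/
theorem elim_block_apply (col : ℕ → ℕ → ZMod 2) (piv : ℕ → ℕ) (src dst w l i : ℕ) :
    elim col piv src (src + w) (col (dst + l)) i =
      col (dst + l) i + ∑ k ∈ Finset.range w, col (src + k) i * pivotRows col piv src dst k l := by
  rw [elim_apply, Pi.add_apply, Finset.sum_apply, Finset.sum_Ico_eq_sum_range,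
    Nat.add_sub_cancel_left]
  congr 1
  refine Finset.sum_congr rfl fun k _ => ?_
  unfold pivotRows
  split_ifs
  · simp
  · rw [Pi.smul_apply, smul_eq_mul, mul_comm]

/-- Copy the pivot rows of the block `[src, src + w)`, in the columns `[dst, dst + w)`. Here the
registers `2, 3, 4` hold `N`, `N * N` and the size of the memory of a multiplication, the register
`6` holds `w`, the register `7` the address of free memory, and `8` and `9` hold `src` and `dst`. -/
def copyPivotRows : Prog :=
  .fill 10 (.var 6) (.var 6) (.lit 6 * .var 3) (.var 6)
    ((.lit 1 - (.lit 1 - .get (.lit 7 * .var 3 + .var 8 + .var 10))) *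
      .get (.lit 5 * .var 3 + (.get (.lit 7 * .var 3 + .var 8 + .var 10) - .lit 1) * .var 2 +
        (.var 9 + .var 12)))

theorem run_copyPivotRows {N w src dst W T : ℕ} {env m : ℕ → ℕ} {col : ℕ → ℕ → ZMod 2}
    {piv : ℕ → ℕ} {Q : (ℕ → ℕ) → Prop} (hsrc : src + w ≤ N) (hdst : dst + w ≤ N)
    (e2 : env 2 = N) (e3 : env 3 = N * N) (e6 : env 6 = w) (e8 : env 8 = src) (e9 : env 9 = dst)
    (hm : Rep N m col piv) (hN : 1 ≤ N) (hW : 10 * (N * N) + 2 ≤ W)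
    (hT : 100 * (w * w) + 100 * w + 100 ≤ T)
    (hQ : ∀ m' : ℕ → ℕ, (∀ i < w, ∀ j < w,
        m' (6 * (N * N) + i * w + j) = (pivotRows col piv src dst i j).val) →
      (∀ x, x < 6 * (N * N) ∨ 7 * (N * N) ≤ x → m' x = m x) → Q m') :
    Run W 10 copyPivotRows T env m Q := by
  have hNN : N ≤ N * N := Nat.le_mul_self N
  have hww : w * w ≤ N * N := Nat.mul_le_mul (by omega) (by omega)
  refine Run.fill w w (6 * (N * N)) w (fun i j => (pivotRows col piv src dst i j).val)
    (by simp [e6]; omega) (by simp [e6]) le_rfl (fun i hi m' => ?_)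
    (fun i hi j hj m' hm' => ?_) ?_ (fun m' h1 h2 => hQ m' h1 fun x hx => h2 x fun i hi j hj => ?_)
  · simp [e6]; omega
  · have hm1 : m' (7 * (N * N) + src + i) = piv (src + i) := by
      rw [hm' _ fun i' hi' j' hj' _ => ?_, add_assoc, hm.piv_mem _ (by omega)]
      have := addr_lt hi' hj'
      omega
    have hp := hm.piv_le (src + i)
    have hp1 : piv (src + i) - 1 < N := by omega
    have hm2 : m' (5 * (N * N) + (piv (src + i) - 1) * N + (dst + j)) =
        (col (dst + j) (piv (src + i) - 1)).val := by
      have hj' : dst + j < N := by omega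
      rw [hm' _ fun i' hi' j' hj' _ => ?_, hm.mat _ hp1 _ hj']
      have := addr_lt hi' hj'
      have := addr_lt hp1 (show dst + j < N by omega)
      omega
    have hv := zmod_val_lt (col (dst + j) (piv (src + i) - 1))
    have ha := addr_lt hp1 (show dst + j < N by omega)
    have ha' := addr_lt hi hj
    set E := fillEnv env 10 i w j w with hE
    have E2 : E 2 = N := by simp [hE, fillEnv, e2]
    have E3 : E 3 = N * N := by simp [hE, fillEnv, e3]
    have E6 : E 6 = w := by simp [hE, fillEnv, e6]
    have E8 : E 8 = src := by simp [hE, fillEnv, e8]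
    have E9 : E 9 = dst := by simp [hE, fillEnv, e9]
    have E10 : E 10 = i := by simp [hE, fillEnv]
    have E12 : E 12 = j := by simp [hE, fillEnv]
    -- With truncated subtraction, `1 - (1 - x)` is the indicator of `x ≠ 0`. For a column without a
    -- pivot the row `piv - 1` is read as row 0, and the value is multiplied by 0.
    have hle : (1 - (1 - piv (src + i))) * (col (dst + j) (piv (src + i) - 1)).val < 2 := by
      rcases Nat.eq_zero_or_pos (piv (src + i)) with h0 | h0
      · simp [h0]
      · rw [show 1 - (1 - piv (src + i)) = 1 by omega]
        omega
    simp only [Expr.add_def, Expr.mul_def, Expr.sub_def, Expr.Ok, Expr.eval, Op.eval_add,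
      Op.eval_mul, Op.eval_sub,
      E2, E3, E6, E8, E9, E10, E12, hm1, hm2]
    and_intros
    all_goals first | exact trivial | omega | skip
    unfold pivotRows
    split_ifs with h0
    · simp [h0]
    · rw [show 1 - (1 - piv (src + i)) = 1 by omega, one_mul]
  · simp only [Expr.cost, Expr.sub_def, Expr.add_def, Expr.mul_def]
    linarith
  · have := addr_lt hi hj
    omega

/-- Update `w` rows, from the row `q * w` on, in the columns `[dst, dst + w)`; the register `10`
holds `q` and the register `12` the address of free memory. -/
def updateRows (p₀ : Prog) : Prog :=
  .seq (.put 13 (.var 12) (.var 6)) <|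
  .seq (.fill 13 (.var 6) (.var 6) (.var 12 + .lit 1) (.var 6)
    (.get (.lit 5 * .var 3 + (.var 10 * .var 6 + .var 13) * .var 2 + (.var 8 + .var 15)))) <|
  .seq (.fill 13 (.var 6) (.var 6) (.var 12 + .lit 1 + .var 6 * .var 6) (.var 6)
    (.get (.lit 6 * .var 3 + .var 13 * .var 6 + .var 15))) <|
  .seq (callMul 12 13 14 p₀)
    (.fill 13 (.var 6) (.var 6) (.lit 5 * .var 3 + .var 10 * .var 6 * .var 2 + .var 9) (.var 2)
      ((.get (.lit 5 * .var 3 + .var 10 * .var 6 * .var 2 + .var 9 + .var 13 * .var 2 + .var 15) +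
        .get (.var 12 + (.var 13 * .var 6 + .var 15))) % .lit 2))

theorem val_add_zmod_two (a b : ZMod 2) : (a.val + b.val) % 2 = (a + b).val :=
  (ZMod.val_add a b).symm

/-- One product of `w × w` matrices: `w` rows of the source columns `X`, times the copied pivot rows
`G`, are added to the same rows of the destination columns. All cells from `B` on must be zero
beforehand; afterwards this holds again past the region used. -/
theorem run_updateRows {p₀ : Prog} {c₀ : ℕ} {T₀ : ℕ → ℕ} (hp₀ : Multiplies p₀ c₀ T₀)
    (hc : 3 ≤ c₀) {N w q src dst B W T : ℕ} {env m : ℕ → ℕ} {X : ℕ → ℕ → ZMod 2}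
    {G : ℕ → ℕ → ZMod 2} {Q : (ℕ → ℕ) → Prop} (hsrc : src + w ≤ N) (hdst : dst + w ≤ N)
    (hw : 1 ≤ w)
    (hq : q * w + w ≤ N)
    (e2 : env 2 = N) (e3 : env 3 = N * N) (e6 : env 6 = w) (e8 : env 8 = src) (e9 : env 9 = dst)
    (e10 : env 10 = q) (e12 : env 12 = B)
    (hX : ∀ i < N, ∀ c < N, m (5 * (N * N) + i * N + c) = (X c i).val)
    (hG : ∀ i < w, ∀ j < w, m (6 * (N * N) + i * w + j) = (G i j).val)
    (h0 : ∀ x, B ≤ x → m x = 0) (hB : 10 * (N * N) ≤ B) (hN : 1 ≤ N)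
    (hW : B + (N + 2) ^ c₀ ≤ W)
    (hT : 2 * T₀ w + p₀.regBound + 300 * (w * w) + 300 * w + 300 ≤ T)
    (hQ : ∀ m' : ℕ → ℕ,
      (∀ i < N, ∀ c < N, m' (5 * (N * N) + i * N + c) =
        (X c i + if q * w ≤ i ∧ i < q * w + w ∧ dst ≤ c ∧ c < dst + w then
          ∑ k ∈ Finset.range w, X (src + k) i * G k (c - dst) else 0).val) →
      (∀ x, x < 5 * (N * N) ∨ (6 * (N * N) ≤ x ∧ x < B) → m' x = m x) →
      (∀ x, B + (N + 2) ^ c₀ ≤ x → m' x = 0) → Q m') :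
    Run W 13 (updateRows p₀) T env m Q := by
  have hNN : N ≤ N * N := Nat.le_mul_self N
  have hww : w * w ≤ N * N := Nat.mul_le_mul (by omega) (by omega)
  have hwN : (w + 2) ^ c₀ ≤ (N + 2) ^ c₀ := Nat.pow_le_pow_left (by omega) _
  -- The region must hold the dimension and both operands; a cubic bound suffices, hence the
  -- assumption `3 ≤ c₀`.
  have hS : 1 + w * w + w * w + 2 ≤ (N + 2) ^ c₀ := by
    calc 1 + w * w + w * w + 2 ≤ (N + 2) ^ 3 := by
          have : 0 ≤ N * N * N := Nat.zero_le _
          linarith [show (N + 2) ^ 3 = N * N * N + 6 * (N * N) + 12 * N + 8 by ring]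
      _ ≤ (N + 2) ^ c₀ := Nat.pow_le_pow_right (by omega) hc
  set S := (N + 2) ^ c₀
  have hqw : q ≤ q * w := Nat.le_mul_of_pos_right _ hw
  have hrow : ∀ {i j : ℕ}, i < w → j < N → (q * w + i) * N + j < N * N := fun hi hj =>
    addr_lt (by omega) hj
  have hrow' : ∀ i, (q * w + i) * N = q * w * N + i * N := fun i => by ring
  have hT' : (.var 12 : Expr).cost + (.var 6 : Expr).cost + 1 +
      (100 * (w * w) + 50 * w + 50 + (100 * (w * w) + 50 * w + 50 +
        (2 * T₀ w + p₀.regBound + 1 + (100 * (w * w) + 50 * w + 50)))) ≤ T := by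
    simp only [Expr.cost]
    linarith
  refine Run.mono (Q := Q) ?_ hT' (fun _ h => h)
  refine Run.seq (R := fun m' => m' = Function.update m B w) (Run.put (by simp [e12]; omega)
    (by simp [e6]; omega) le_rfl (by simp [e12, e6])) ?_
  rintro m1 rfl
  refine Run.seq (R := fun m' => m' B = w ∧
    (∀ i < w, ∀ k < w, m' (B + 1 + i * w + k) = (X (src + k) (q * w + i)).val) ∧
    (∀ x, x < B → m' x = m x) ∧ ∀ x, B + 1 + w * w ≤ x → m' x = 0) ?_ ?_
  · refine Run.fill w w (B + 1) w (fun i k => (X (src + k) (q * w + i)).val)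
      (by simp [e6]; omega) (by simp [e6]) le_rfl (fun i hi m' => ?_)
      (fun i hi j hj m' hm' => ?_) ?_ (fun m' h1 h2 => ⟨?_, h1, fun x hx => ?_, fun x hx => ?_⟩)
    · simp [e6]; omega
    · have ha := addr_lt hi hj
      have hr := hrow hi (show src + j < N by omega)
      have hv := zmod_val_lt (X (src + j) (q * w + i))
      have hg : m' (5 * (N * N) + (q * w + i) * N + (src + j)) = (X (src + j) (q * w + i)).val := by
        rw [hm' _ fun i' hi' j' hj' _ => by omega, Function.update_of_ne (by omega),
          hX _ (by omega) _ (by omega)]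
      set E := fillEnv env 13 i w j w with hE
      have E2 : E 2 = N := by simp [hE, fillEnv, e2]
      have E3 : E 3 = N * N := by simp [hE, fillEnv, e3]
      have E6 : E 6 = w := by simp [hE, fillEnv, e6]
      have E8 : E 8 = src := by simp [hE, fillEnv, e8]
      have E10 : E 10 = q := by simp [hE, fillEnv, e10]
      have E12 : E 12 = B := by simp [hE, fillEnv, e12]
      have E13 : E 13 = i := by simp [hE, fillEnv]
      have E15 : E 15 = j := by simp [hE, fillEnv]
      have := hrow' i
      have : q * w + i ≤ (q * w + i) * N := Nat.le_mul_of_pos_right _ hN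
      simp only [Expr.add_def, Expr.mul_def, Expr.Ok, Expr.eval, Op.eval_add, Op.eval_mul,
        E2, E3, E6, E8, E10, E12, E13, E15, hg]
      and_intros
      all_goals first | exact trivial | omega
    · simp only [Expr.cost, Expr.add_def, Expr.mul_def]
      linarith [Nat.zero_le (w * w)]
    · rw [h2 _ fun i hi j hj => by omega, Function.update_self]
    · rw [h2 _ fun i hi j hj => by omega, Function.update_of_ne (by omega)]
    · rw [h2 _ fun i hi j hj => by have := addr_lt hi hj; omega, Function.update_of_ne (by omega),
        h0 x (by omega)]
  rintro m2 ⟨hB2, hX2, hl2, hz2⟩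
  refine Run.seq (R := fun m' => m' B = w ∧
    (∀ i < w, ∀ k < w, m' (B + 1 + i * w + k) = (X (src + k) (q * w + i)).val) ∧
    (∀ i < w, ∀ k < w, m' (B + 1 + w * w + i * w + k) = (G i k).val) ∧
    (∀ x, x < B → m' x = m x) ∧ ∀ x, B + 1 + w * w + w * w ≤ x → m' x = 0) ?_ ?_
  · refine Run.fill w w (B + 1 + w * w) w (fun i k => (G i k).val)
      (by simp [e6]; omega) (by simp [e6]) le_rfl (fun i hi m' => ?_)
      (fun i hi j hj m' hm' => ?_) ?_
      (fun m' h1 h2 => ⟨?_, fun i hi k hk => ?_, h1, fun x hx => ?_, fun x hx => ?_⟩)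
    · simp [e6]; omega
    · have ha := addr_lt hi hj
      have hv := zmod_val_lt (G i j)
      have hg : m' (6 * (N * N) + i * w + j) = (G i j).val := by
        rw [hm' _ fun i' hi' j' hj' _ => by omega, hl2 _ (by omega), hG _ hi _ hj]
      set E := fillEnv env 13 i w j w with hE
      have E2 : E 2 = N := by simp [hE, fillEnv, e2]
      have E3 : E 3 = N * N := by simp [hE, fillEnv, e3]
      have E6 : E 6 = w := by simp [hE, fillEnv, e6]
      have E12 : E 12 = B := by simp [hE, fillEnv, e12]
      have E13 : E 13 = i := by simp [hE, fillEnv]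
      have E15 : E 15 = j := by simp [hE, fillEnv]
      simp only [Expr.add_def, Expr.mul_def, Expr.Ok, Expr.eval, Op.eval_add, Op.eval_mul,
        E3, E6, E12, E13, E15, hg]
      and_intros
      all_goals first | exact trivial | omega
    · simp only [Expr.cost, Expr.add_def, Expr.mul_def]
      linarith [Nat.zero_le (w * w)]
    · rw [h2 _ fun i hi j hj => by omega, hB2]
    · have := addr_lt hi hk
      rw [h2 _ fun i hi j hj => by omega, hX2 i hi k hk]
    · rw [h2 _ fun i hi j hj => by omega, hl2 x hx]
    · rw [h2 _ fun i hi j hj => by have := addr_lt hi hj; omega, hz2 x (by omega)]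
  rintro m3 ⟨hB3, hX3, hG3, hl3, hz3⟩
  refine Run.seq (R := fun m' => (∀ i < w, ∀ l < w, m' (B + (i * w + l)) =
      (∑ k ∈ Finset.range w, X (src + k) (q * w + i) * G k l).val) ∧
    (∀ x, x < B → m' x = m x) ∧ ∀ x, B + S ≤ x → m' x = 0) ?_ ?_
  · refine run_callMul hp₀ hc (fun i k => X (src + k) (q * w + i)) G (by omega) le_rfl
      (by omega) e12 (by omega) hB3 (fun i hi k hk => ?_) (fun i hi k hk => ?_) hz3 le_rfl
      (fun m' h1 h2 => ⟨h1, fun x hx => ?_, fun x hx => ?_⟩)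
    · rw [← hX3 i hi k hk, add_assoc (B + 1)]
    · rw [← hG3 i hi k hk, add_assoc (B + 1 + w * w)]
    · rw [h2 x (.inl hx), hl3 x hx]
    · rw [h2 x (.inr (by omega)), hz3 x (by omega)]
  rintro m4 ⟨hP4, hl4, hz4⟩
  refine Run.fill w w (5 * (N * N) + q * w * N + dst) N (fun i l =>
    (X (dst + l) (q * w + i) +
      ∑ k ∈ Finset.range w, X (src + k) (q * w + i) * G k l).val)
      (by simp [e6]; omega) (by simp [e6]) (by omega) (fun i hi m' => ?_)
      (fun i hi j hj m' hm' => ?_) ?_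
      (fun m' h1 h2 => hQ m' (fun i hi c hcN => ?_) (fun x hx => ?_) (fun x hx => ?_))
  · simp [e6]; omega
  · have ha := addr_lt hi hj
    have hr := hrow hi (show dst + j < N by omega)
    -- The addition is done in place: the cell about to be written still has its old value.
    have hg1 : m' (5 * (N * N) + q * w * N + dst + i * N + j) = (X (dst + j) (q * w + i)).val := by
      rw [hm' _ fun i' hi' j' hj' hne => ?_, hl4 _ (by have := hrow' i; omega),
        ← hX _ (by omega) _ (show dst + j < N by omega)]
      · congr 1
        have := hrow' i
        omega
      · intro he
        have := addr_inj (st := N) (i := i) (j := j) (i' := i') (j' := j') (by omega) (by omega)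
          (by omega)
        omega
    have hg2 : m' (B + (i * w + j)) =
        (∑ k ∈ Finset.range w, X (src + k) (q * w + i) * G k j).val := by
      rw [hm' _ fun i' hi' j' hj' hne => ?_, hP4 i hi j hj]
      have := hrow hi' (show dst + j' < N by omega)
      have := hrow' i'
      omega
    have hv1 := zmod_val_lt (X (dst + j) (q * w + i))
    have hv2 := zmod_val_lt (∑ k ∈ Finset.range w, X (src + k) (q * w + i) * G k j)
    set E := fillEnv env 13 i w j w with hE
    have E2 : E 2 = N := by simp [hE, fillEnv, e2]
    have E3 : E 3 = N * N := by simp [hE, fillEnv, e3]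
    have E6 : E 6 = w := by simp [hE, fillEnv, e6]
    have E9 : E 9 = dst := by simp [hE, fillEnv, e9]
    have E10 : E 10 = q := by simp [hE, fillEnv, e10]
    have E12 : E 12 = B := by simp [hE, fillEnv, e12]
    have E13 : E 13 = i := by simp [hE, fillEnv]
    have E15 : E 15 = j := by simp [hE, fillEnv]
    have := hrow' i
    simp only [Expr.add_def, Expr.mul_def, Expr.mod_def, Expr.Ok, Expr.eval, Op.eval_add,
      Op.eval_mul, Op.eval_mod, E2, E3, E6, E9, E10, E12, E13, E15, hg1, hg2]
    and_intros
    all_goals first | exact trivial | omega | exact val_add_zmod_two _ _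
  · simp only [Expr.cost, Expr.add_def, Expr.mul_def, Expr.mod_def]
    linarith [Nat.zero_le (w * w)]
  · split_ifs with hin
    · have := h1 (i - q * w) (by omega) (c - dst) (by omega)
      have e := hrow' (i - q * w)
      rw [show q * w + (i - q * w) = i by omega] at this e
      rw [show dst + (c - dst) = c by omega] at this
      rw [← this]
      congr 1
      omega
    · have hic := addr_lt hi hcN
      rw [add_zero, h2 _ fun i' hi' j' hj' => ?_, hl4 _ (by omega), hX i hi c hcN]
      intro he
      have := hrow' i'
      have := addr_inj (st := N) (i := i) (j := c) (i' := q * w + i') (j' := dst + j') hcN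
        (by omega) (by omega)
      omega
  · rw [h2 _ fun i' hi' j' hj' => ?_, hl4 _ (by omega)]
    have := hrow hi' (show dst + j' < N by omega)
    have := hrow' i'
    omega
  · rw [h2 _ fun i' hi' j' hj' => ?_, hz4 _ hx]
    have := hrow hi' (show dst + j' < N by omega)
    have := hrow' i'
    omega

/-- Apply the row operations of the block `[src, src + w)` to the columns `[dst, dst + w)`, with the
registers as in `copyPivotRows`. -/
def updateBlock (p₀ : Prog) : Prog :=
  .seq copyPivotRows
    (.for 10 (.var 2 / .var 6) (.bind 12 (.var 7 + .var 10 * .var 4) (updateRows p₀)))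

/-- The `N` rows are treated in `k = N / w` groups. The pivot rows are copied beforehand, as the
update overwrites them in the destination columns while later groups need the old values. Group `q`
has its own region at `fp + q * (N + 2) ^ c₀`, so no memory is erased between products. -/
theorem run_updateBlock {p₀ : Prog} {c₀ : ℕ} {T₀ : ℕ → ℕ} (hp₀ : Multiplies p₀ c₀ T₀)
    (hc : 3 ≤ c₀) {N w k src dst fp W T : ℕ} {env m : ℕ → ℕ} {col : ℕ → ℕ → ZMod 2}
    {piv : ℕ → ℕ} {Q : (ℕ → ℕ) → Prop} (hNw : N = k * w) (hw : 1 ≤ w) (hsrc : src + w ≤ N)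
    (hdst : dst + w ≤ N) (_hdisj : src + w ≤ dst ∨ dst + w ≤ src)
    (e2 : env 2 = N) (e3 : env 3 = N * N) (e4 : env 4 = (N + 2) ^ c₀) (e6 : env 6 = w)
    (e7 : env 7 = fp) (e8 : env 8 = src) (e9 : env 9 = dst) (hm : Rep N m col piv)
    (h0 : ∀ x, fp ≤ x → m x = 0) (hfp : 10 * (N * N) ≤ fp)
    (hW : fp + N * (N + 2) ^ c₀ ≤ W)
    (hT : k * (2 * T₀ w + p₀.regBound + 700 * (w * w) + 500) + 500 * (w * w) + 500 ≤ T)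
    (hQ : ∀ m' : ℕ → ℕ, Rep N m' (update col piv src (src + w) dst (dst + w)) piv →
      (∀ x, x < 5 * (N * N) → m' x = m x) → (∀ x, fp + N * (N + 2) ^ c₀ ≤ x → m' x = 0) → Q m') :
    Run W 10 (updateBlock p₀) T env m Q := by
  have hN : 1 ≤ N := by omega
  have hNN : N ≤ N * N := Nat.le_mul_self N
  have hww : w ≤ w * w := Nat.le_mul_self w
  have hS : N + 2 ≤ (N + 2) ^ c₀ := Nat.le_self_pow (by omega) _
  have hkN : k ≤ N := hNw ▸ Nat.le_mul_of_pos_right _ hw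
  set S := (N + 2) ^ c₀ with hSdef
  have hSN : S ≤ N * S := Nat.le_mul_of_pos_left _ hN
  have hT' : (100 * (w * w) + 100 * w + 100) + ((.var 2 / .var 6 : Expr).cost +
      k * ((.var 7 + .var 10 * .var 4 : Expr).cost +
        (2 * T₀ w + p₀.regBound + 300 * (w * w) + 300 * w + 300) + 12) + 7) ≤ T := by
    have : k * ((.var 7 + .var 10 * .var 4 : Expr).cost +
        (2 * T₀ w + p₀.regBound + 300 * (w * w) + 300 * w + 300) + 12) ≤
        k * (2 * T₀ w + p₀.regBound + 700 * (w * w) + 500) := by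
      apply Nat.mul_le_mul_left
      simp only [Expr.cost, Expr.add_def, Expr.mul_def]
      generalize T₀ w = t, p₀.regBound = b, w * w = v at *
      linarith
    simp only [Expr.cost, Expr.div_def] at this ⊢
    omega
  refine Run.mono (Q := Q) ?_ hT' (fun _ h => h)
  set col' := update col piv src (src + w) dst (dst + w) with hcol'
  have hcz : ∀ c i, N ≤ i → col' c i = 0 := fun c i hi => by
    rw [hcol', update]
    split_ifs
    · rw [elim_apply, Pi.add_apply, Finset.sum_apply, hm.col_zero c i hi, Finset.sum_eq_zero,
        add_zero]
      intro c' _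
      split_ifs
      · rfl
      · rw [Pi.smul_apply, hm.col_zero _ i hi, smul_zero]
    · exact hm.col_zero c i hi
  refine Run.seq (R := fun m' => (∀ i < w, ∀ j < w,
      m' (6 * (N * N) + i * w + j) = (pivotRows col piv src dst i j).val) ∧
      (∀ x, x < 6 * (N * N) ∨ 7 * (N * N) ≤ x → m' x = m x))
    (run_copyPivotRows hsrc hdst e2 e3 e6 e8 e9 hm hN (by omega) le_rfl
      fun m' h1 h2 => ⟨h1, h2⟩) ?_
  rintro m1 ⟨hG1, hm1⟩
  refine Run.for (T₀ := (.var 7 + .var 10 * .var 4 : Expr).cost +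
        (2 * T₀ w + p₀.regBound + 300 * (w * w) + 300 * w + 300)) (fun q m' =>
      (∀ i < N, ∀ c < N, m' (5 * (N * N) + i * N + c) =
        (if i < q * w ∧ dst ≤ c ∧ c < dst + w then col' c i else col c i).val) ∧
      (∀ x, x < 5 * (N * N) ∨ (6 * (N * N) ≤ x ∧ x < fp) → m' x = m1 x) ∧
      ∀ x, fp + q * S ≤ x → m' x = 0) k ?_ ?_ le_rfl ?_ ?_ ?_
  · simp [e2, e6, hNw, Nat.mul_div_cancel _ hw]
  · simp only [Expr.div_def, Expr.Ok, Expr.eval, Op.eval_div, e2, e6]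
    have := Nat.div_le_self N w
    omega
  · refine ⟨fun i hi c hcN => ?_, fun x _ => rfl, fun x hx => ?_⟩
    · rw [if_neg (by omega)]
      have := addr_lt hi hcN
      rw [hm1 _ (by omega), hm.mat i hi c hcN]
    · rw [hm1 _ (by omega), h0 x (by omega)]
  · rintro q hq m2 ⟨hX2, hf2, hz2⟩
    have hqw : q * w + w ≤ N := by
      rw [hNw, ← Nat.succ_mul]
      exact Nat.mul_le_mul_right _ hq
    have hqS : q * S + S ≤ N * S := by
      rw [← Nat.succ_mul]
      exact Nat.mul_le_mul_right _ (by omega)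
    refine Run.bind (T₀ := 2 * T₀ w + p₀.regBound + 300 * (w * w) + 300 * w + 300) ?_ le_rfl ?_
    · simp [e7, e4]
      omega
    -- The matrix after `q` groups: the first `q * w` rows of the destination block are updated. The
    -- source columns are disjoint from it and unchanged.
    set X : ℕ → ℕ → ZMod 2 := fun c i =>
      if i < q * w ∧ dst ≤ c ∧ c < dst + w then col' c i else col c i with hX
    refine run_updateRows hp₀ hc (X := X) (G := pivotRows col piv src dst) (src := src)
      (dst := dst) (q := q) (B := fp + q * S) (w := w) hsrc hdst hw hqw (by simp [e2])
      (by simp [e3]) (by simp [e6]) (by simp [e8]) (by simp [e9]) (by simp) (by simp [e7, e4])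
      hX2 (fun i hi j hj => ?_) hz2 (by omega) hN (by omega) le_rfl
      (fun m' h1 h2 h3 => ⟨fun i hi c hcN => ?_, fun x hx => ?_, fun x hx => ?_⟩)
    · have := addr_lt hi hj
      have : w * w ≤ N * N := Nat.mul_le_mul (by omega) (by omega)
      rw [hf2 _ (by omega), hG1 i hi j hj]
    · rw [h1 i hi c hcN]
      congr 1
      by_cases hin : q * w ≤ i ∧ i < q * w + w ∧ dst ≤ c ∧ c < dst + w
      · obtain ⟨c, rfl⟩ := Nat.exists_eq_add_of_le hin.2.2.1
        rw [if_pos hin, if_pos (by rw [Nat.succ_mul]; omega), hX, hcol', update,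
          if_pos hin.2.2, elim_block_apply]
        simp only
        rw [if_neg (by omega)]
        congr 1
        refine Finset.sum_congr rfl fun l hl => ?_
        rw [if_neg (by omega), Nat.add_sub_cancel_left]
      · rw [if_neg hin, add_zero, hX]
        simp only [Nat.succ_mul]
        congr 1
        rw [eq_iff_iff]
        omega
    · rw [h2 x (by omega), hf2 x (by omega)]
    · rw [Nat.succ_mul] at hx
      exact h3 x (by omega)
  · rintro m2 ⟨hX2, hf2, hz2⟩
    have hfr : ∀ x, x < 5 * (N * N) ∨ 7 * (N * N) ≤ x ∧ x < fp → m2 x = m x := fun x hx => by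
      rw [hf2 x (by omega), hm1 x (by omega)]
    refine hQ m2 ⟨fun i hi c hcN => ?_, fun c hcN => ?_, fun p hp => ?_, hm.piv_le, hm.piv_zero,
      hcz⟩ (fun x hx => hfr x (.inl hx)) (fun x hx => hz2 x ?_)
    · rw [hX2 i hi c hcN]
      split_ifs with h
      · rfl
      · rw [hcol', update, if_neg]
        rw [hNw] at hi
        omega
    · rw [hfr _ (by omega), hm.piv_mem c hcN]
    · rw [hfr _ (by omega)]
      exact hm.used p hp
    · have := Nat.mul_le_mul_right S hkN
      omega

/-! ### Pivot search in a single column. -/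

theorem zmod_two_eq_one {a : ZMod 2} (h : a.val ≠ 0) : a = 1 := by
  revert h
  revert a
  decide

/-- Search for a pivot in the column in the register `5`, and record it. -/
def procColumn : Prog :=
  .seq (.for 8 (.var 2) (.ite 10 (.get (.lit 5 * .var 3 + .var 8 * .var 2 + .var 5) *
      (.lit 1 - .get (.lit 8 * .var 3 + .var 8)))
    (.put 10 (.lit 7 * .var 3 + .var 5) (.var 8 + .lit 1)) (.skip 10))) <|
  .bind 8 (.get (.lit 7 * .var 3 + .var 5)) <|
  .ite 9 (.var 8)
    (.seq (.put 9 (.lit 8 * .var 3 + (.var 8 - .lit 1)) (.var 5 + .lit 1))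
      (.put 9 (.lit 5 * .var 3 + (.var 8 - .lit 1) * .var 2 + .var 5) (.lit 0)))
    (.skip 9)

/-- Elimination of a block of width one. Any row with entry 1 that is not yet a pivot row will do;
the scan keeps the last one. The array at `8 * (N * N)`, which inverts `piv`, makes the test of a
row take constant time. -/
theorem run_procColumn {N j W T : ℕ} {env m : ℕ → ℕ} {col : ℕ → ℕ → ZMod 2} {piv : ℕ → ℕ}
    {Q : (ℕ → ℕ) → Prop} (hj : j < N) (e2 : env 2 = N) (e3 : env 3 = N * N) (e5 : env 5 = j)
    (hm : Rep N m col piv) (hz : ∀ c, j ≤ c → piv c = 0) (hW : 10 * (N * N) < W)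
    (hT : 100 * N + 100 ≤ T)
    (hQ : ∀ (m' : ℕ → ℕ) (col' : ℕ → ℕ → ZMod 2) (piv' : ℕ → ℕ), Rep N m' col' piv' →
      Eliminated j (j + 1) col piv col' piv' →
      (∀ x, x < 5 * (N * N) ∨ 9 * (N * N) ≤ x → m' x = m x) → Q m') :
    Run W 8 procColumn T env m Q := by
  have hNN : N ≤ N * N := Nat.le_mul_self N
  refine Run.mono (T := (2 + N * (60 + 12) + 7) + 60) (Q := Q) ?_ (by omega) (fun _ h => h)
  -- During the scan the cell of `piv j` holds the candidate row plus one, or 0 as long as there is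
  -- none.
  refine Run.seq (R := fun m' => (∀ x, x ≠ 7 * (N * N) + j → m' x = m x) ∧
    ((m' (7 * (N * N) + j) = 0 ∧ ∀ p < N, col j p = 0 ∨ m (8 * (N * N) + p) ≠ 0) ∨
      ∃ p < N, m' (7 * (N * N) + j) = p + 1 ∧ col j p = 1 ∧ m (8 * (N * N) + p) = 0)) ?_ ?_
  · refine Run.for (T₀ := 60) (fun i m' => (∀ x, x ≠ 7 * (N * N) + j → m' x = m x) ∧
      ((m' (7 * (N * N) + j) = 0 ∧ ∀ p < i, col j p = 0 ∨ m (8 * (N * N) + p) ≠ 0) ∨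
        ∃ p < N, m' (7 * (N * N) + j) = p + 1 ∧ col j p = 1 ∧ m (8 * (N * N) + p) = 0))
      N (by simp [e2]) (by simp [e2]; omega) le_rfl ?_ ?_ (fun _ h => h)
    · refine ⟨fun _ _ => rfl, .inl ⟨?_, fun p hp => absurd hp (Nat.not_lt_zero _)⟩⟩
      rw [hm.piv_mem j hj, hz j le_rfl]
    · rintro i hi m1 ⟨hf1, h1⟩
      have ha := addr_lt hi hj
      have hg1 : m1 (5 * (N * N) + i * N + j) = (col j i).val := by
        rw [hf1 _ (by omega), hm.mat i hi j hj]
      have hg2 : m1 (8 * (N * N) + i) = m (8 * (N * N) + i) := hf1 _ (by omega)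
      have hv := zmod_val_lt (col j i)
      have hu : m (8 * (N * N) + i) ≤ N := by
        rcases hm.used i hi with ⟨h, _⟩ | ⟨c, h, hc⟩
        · omega
        · have : c < N := by
            by_contra hcN
            rw [hm.piv_zero c (by omega)] at hc
            omega
          omega
      set E := Function.update (Function.update env 8 i) (8 + 1) N with hE
      have E2 : E 2 = N := by simp [hE, e2]
      have E3 : E 3 = N * N := by simp [hE, e3]
      have E5 : E 5 = j := by simp [hE, e5]
      have E8 : E 8 = i := by simp [hE]
      -- The factor `1 - used` vanishes as soon as the row is already a pivot row, by truncation.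
      have hle : (col j i).val * (1 - m (8 * (N * N) + i)) < 2 := by
        rcases Nat.eq_zero_or_pos (m (8 * (N * N) + i)) with h0 | h0
        · simp [h0, hv]
        · simp [show 1 - m (8 * (N * N) + i) = 0 by omega]
      refine Run.ite (T₀ := 15) ?_ (by decide) (fun hne => ?_) (fun heq => ?_)
      · simp only [Expr.add_def, Expr.mul_def, Expr.sub_def, Expr.Ok, Expr.eval, Op.eval_add,
          Op.eval_mul, Op.eval_sub, E2, E3, E5, E8, hg1, hg2]
        and_intros
        all_goals omega
      · simp only [Expr.add_def, Expr.mul_def, Expr.sub_def, Expr.eval, Op.eval_add,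
          Op.eval_mul, Op.eval_sub, E2, E3, E5, E8, hg1, hg2] at hne
        refine Run.put ?_ ?_ (by decide) ?_
        · simp only [Expr.add_def, Expr.mul_def, Expr.Ok, Expr.eval, Op.eval_add,
            Op.eval_mul, E3, E5]
          and_intros
          all_goals omega
        · simp only [Expr.add_def, Expr.Ok, Expr.eval, Op.eval_add, E8]
          and_intros
          all_goals omega
        · simp only [Expr.add_def, Expr.mul_def, Expr.eval, Op.eval_add, Op.eval_mul, E3, E5, E8]
          refine ⟨fun x hx => by rw [Function.update_of_ne hx, hf1 x hx], .inr ⟨i, hi, by simp,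
            zmod_two_eq_one (left_ne_zero_of_mul hne), ?_⟩⟩
          have := right_ne_zero_of_mul hne
          omega
      · simp only [Expr.add_def, Expr.mul_def, Expr.sub_def, Expr.eval, Op.eval_add,
          Op.eval_mul, Op.eval_sub, E2, E3, E5, E8, hg1, hg2] at heq
        refine Run.skip (by omega) (by decide) ⟨hf1, h1.imp_left fun h => ⟨h.1, fun p hp => ?_⟩⟩
        rcases Nat.lt_succ_iff_lt_or_eq.mp hp with hlt | rfl
        · exact h.2 p hlt
        · rcases Nat.mul_eq_zero.mp heq with h | h
          · exact .inl ((ZMod.val_eq_zero _).mp h)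
          · exact .inr (by omega)
  rintro m1 ⟨hf1, h1⟩
  have hle1 : m1 (7 * (N * N) + j) ≤ N := by
    rcases h1 with ⟨h, _⟩ | ⟨p, hp, h, _⟩ <;> omega
  refine Run.bind (T₀ := 35) ?_ (by decide) ?_
  · simp only [Expr.add_def, Expr.mul_def, Expr.Ok, Expr.eval, Op.eval_add, Op.eval_mul, e3, e5]
    and_intros
    all_goals omega
  simp only [Expr.add_def, Expr.mul_def, Expr.eval, Op.eval_add, Op.eval_mul, e3, e5]
  set v := m1 (7 * (N * N) + j) with hv
  refine Run.ite (T₀ := 32) ?_ (by decide) (fun hne => ?_) (fun heq => ?_)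
  · simp
    omega
  · simp only [Expr.eval, Function.update_self] at hne
    obtain ⟨h, -⟩ | ⟨p, hp, hvp, hcp, hup⟩ := h1
    · exact absurd h hne
    rw [hvp]
    have hpu : ∀ c, piv c ≠ p + 1 := by
      rcases hm.used p hp with ⟨-, h⟩ | ⟨c, h, hc⟩
      · exact h
      · omega
    have ha := addr_lt hp hj
    set E := Function.update env 8 (p + 1) with hE
    have E2 : E 2 = N := by simp [hE, e2]
    have E3 : E 3 = N * N := by simp [hE, e3]
    have E5 : E 5 = j := by simp [hE, e5]
    have E8 : E 8 = p + 1 := by simp [hE]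
    refine Run.mono (T := 14 + 17) (Q := Q) ?_ (by decide) (fun _ h => h)
    refine Run.seq (Run.put (Q := fun m' => m' = Function.update m1 (8 * (N * N) + p) (j + 1))
      ?_ ?_ (by decide) ?_) ?_
    · simp only [Expr.add_def, Expr.mul_def, Expr.sub_def, Expr.Ok, Expr.eval, Op.eval_add,
        Op.eval_mul, Op.eval_sub, E3, E8, Nat.add_sub_cancel]
      and_intros
      all_goals omega
    · simp only [Expr.add_def, Expr.Ok, Expr.eval, Op.eval_add, E5]
      and_intros
      all_goals omega
    · simp only [Expr.add_def, Expr.mul_def, Expr.sub_def, Expr.eval, Op.eval_add, Op.eval_mul,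
        Op.eval_sub, E3, E5, E8, Nat.add_sub_cancel]
    rintro m2 rfl
    refine Run.put ?_ ?_ (by decide) ?_
    · simp only [Expr.add_def, Expr.mul_def, Expr.sub_def, Expr.Ok, Expr.eval, Op.eval_add,
        Op.eval_mul, Op.eval_sub, E2, E3, E5, E8, Nat.add_sub_cancel]
      and_intros
      all_goals omega
    · simp only [Expr.Ok]
      omega
    simp only [Expr.add_def, Expr.mul_def, Expr.sub_def, Expr.eval, Op.eval_add, Op.eval_mul,
      Op.eval_sub, E2, E3, E5, E8, Nat.add_sub_cancel]
    refine hQ _ _ _ ⟨fun i hi c hc => ?_, fun c hc => ?_, fun p' hp' => ?_, fun c => ?_,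
      fun c hc => ?_, fun c i hi => ?_⟩ (eliminated_of_pivot hcp fun c _ => hpu c) fun x hx => ?_
    · have ha' := addr_lt hi hc
      by_cases hc' : c = j
      · subst hc'
        by_cases hi' : i = p
        · subst hi'
          simp
        · have hne : 5 * (N * N) + i * N + c ≠ 5 * (N * N) + p * N + c := fun he => by
            have := addr_inj (st := N) (i := i) (j := c) (i' := p) (j' := c) hc hc (by omega)
            omega
          rw [Function.update_of_ne hne, Function.update_of_ne (by omega), hf1 _ (by omega),
            hm.mat i hi c hc, Function.update_self, Function.update_of_ne hi']
      · have hne : 5 * (N * N) + i * N + c ≠ 5 * (N * N) + p * N + j := fun he => by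
          have := addr_inj (st := N) (i := i) (j := c) (i' := p) (j' := j) hc hj (by omega)
          omega
        rw [Function.update_of_ne hne, Function.update_of_ne (by omega), hf1 _ (by omega),
          hm.mat i hi c hc, Function.update_of_ne hc']
    · rw [Function.update_of_ne (by omega), Function.update_of_ne (by omega)]
      by_cases hc' : c = j
      · subst hc'
        rw [← hv, hvp, Function.update_self]
      · rw [hf1 _ (by omega), hm.piv_mem c hc, Function.update_of_ne hc']
    · rw [Function.update_of_ne (by omega)]
      by_cases hpp : p' = p
      · subst hpp
        exact .inr ⟨j, by simp, by simp⟩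
      · rw [Function.update_of_ne (by omega), hf1 _ (by omega)]
        refine (hm.used p' hp').imp (fun h => ⟨h.1, fun c => ?_⟩) (fun ⟨c, h1, h2⟩ => ⟨c, h1, ?_⟩)
        · by_cases hc' : c = j
          · subst hc'
            rw [Function.update_self]
            omega
          · rw [Function.update_of_ne hc']
            exact h.2 c
        · rwa [Function.update_of_ne]
          rintro rfl
          rw [hz c le_rfl] at h2
          omega
    · by_cases hc' : c = j
      · subst hc'
        rw [Function.update_self]
        omega
      · rw [Function.update_of_ne hc']
        exact hm.piv_le c
    · rw [Function.update_of_ne (by omega), hm.piv_zero c hc]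
    · by_cases hc' : c = j
      · subst hc'
        rw [Function.update_self, Function.update_of_ne (by omega), hm.col_zero c i hi]
      · rw [Function.update_of_ne hc', hm.col_zero c i hi]
    · rw [Function.update_of_ne (by omega), Function.update_of_ne (by omega), hf1 x (by omega)]
  · simp only [Expr.eval, Function.update_self] at heq
    obtain ⟨-, h⟩ | ⟨p, hp, hvp, -⟩ := h1
    swap
    · omega
    have hmm : m1 = m := by
      ext x
      by_cases hx : x = 7 * (N * N) + j
      · rw [hx, ← hv, heq, hm.piv_mem j hj, hz j le_rfl]
      · exact hf1 x hx
    refine Run.skip (by omega) (by decide) (hQ _ col piv (hmm ▸ hm)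
      (eliminated_of_not_pivot (hz j le_rfl) fun p hp => ?_) fun x _ => by rw [hmm])
    -- No candidate was found, so a row with a nonzero entry already belongs to some pivot column;
    -- that column precedes `j`, since `piv` is still 0 from `j` on.
    by_cases hpN : p < N
    · rcases h p hpN with h | h
      · exact h
      · rcases hm.used p hpN with ⟨h', _⟩ | ⟨c, _, hc⟩
        · exact absurd h' h
        · refine absurd hc (hp c ?_)
          by_contra hcj
          rw [hz c (by omega)] at hc
          omega
    · exact hm.col_zero j p (by omega)

/-! ### The divide and conquer as a single loop. -/

/-- One step of the elimination. The memory cells `0, 1, 2` hold `j`, `w` and the address of free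
memory; the block `[j - w, j)` is eliminated. -/
def driverBody (p₀ : Prog) : Prog :=
  .bind 5 (.get (.lit 0)) <| .bind 6 (.get (.lit 1)) <| .bind 7 (.get (.lit 2)) <|
  .seq (.ite 8 (.var 5 / .var 6 % .lit 2)
    (.seq (.bind 8 (.var 5 - .var 6) (.bind 9 (.var 5) (updateBlock p₀))) <|
      .seq procColumn <|
      .seq (.put 8 (.lit 0) (.var 5 + .lit 1)) (.put 8 (.lit 1) (.lit 1)))
    (.seq (.bind 8 (.var 5 - .var 6) (.bind 9 (.var 5 - .lit 2 * .var 6) (updateBlock p₀)))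
      (.put 8 (.lit 1) (.lit 2 * .var 6))))
  (.put 8 (.lit 2) (.var 7 + .var 2 * .var 4))

/-- The elimination, after the first column. -/
def driver (p₀ : Prog) : Prog :=
  .while 5 (.var 2 - .get (.lit 1)) (driverBody p₀)

/-- The state of the elimination: the memory `m₀` is the initial one. -/
structure Driver (N : ℕ) (m₀ m : ℕ → ℕ) (j w fp : ℕ) (col : ℕ → ℕ → ZMod 2) (piv : ℕ → ℕ) :
    Prop where
  rep : Rep N m col piv
  j_eq : m 0 = j
  w_eq : m 1 = w
  fp_eq : m 2 = fp
  zero : ∀ x, fp ≤ x → m x = 0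
  le_fp : 10 * (N * N) ≤ fp
  frame : ∀ x, 4 * (N * N) ≤ x → x < 5 * (N * N) → m x = m₀ x

theorem Rep.congr {N : ℕ} {m m' : ℕ → ℕ} {col : ℕ → ℕ → ZMod 2} {piv : ℕ → ℕ}
    (h : Rep N m col piv) (hm : ∀ x, 5 * (N * N) ≤ x → x < 9 * (N * N) → m' x = m x) :
    Rep N m' col piv := by
  have hNN : N ≤ N * N := Nat.le_mul_self N
  refine ⟨fun i hi c hc => ?_, fun c hc => ?_, fun p hp => ?_, h.piv_le, h.piv_zero, h.col_zero⟩
  · have := addr_lt hi hc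
    rw [hm _ (by omega) (by omega), h.mat i hi c hc]
  · rw [hm _ (by omega) (by omega), h.piv_mem c hc]
  · rw [hm _ (by omega) (by omega)]
    exact h.used p hp

/-- The time of a step of the elimination, for blocks of `w` columns. -/
def stepTime (N b : ℕ) (T₀ : ℕ → ℕ) (w : ℕ) : ℕ :=
  N / w * (2 * T₀ w + b + 700 * (w * w) + 500) + 500 * (w * w) + 100 * N + 700

/-- If `j / w` is odd, the finished block `[j - w, j)` is a left half: its operations are applied to
the right half `[j, j + w)`, whose elimination begins at once with the column `j`. If `j / w` is
even, it is a right half: its operations are applied to the left half, and the merged block has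
width `2 * w`. Either way the free-memory pointer moves past the regions just used. -/
theorem run_driverBody {p₀ : Prog} {c₀ : ℕ} {T₀ : ℕ → ℕ} (hp₀ : Multiplies p₀ c₀ T₀)
    (hc : 3 ≤ c₀) {N w j fp W : ℕ} {env m₀ m : ℕ → ℕ} {col : ℕ → ℕ → ZMod 2}
    {piv : ℕ → ℕ} (hw : 1 ≤ w) (hwN : w ∣ N) (hwj : w ≤ j)
    (hodd : j / w % 2 = 1 → j + w ≤ N) (heven : j / w % 2 = 0 → 2 * w ≤ j ∧ j ≤ N)
    (e2 : env 2 = N) (e3 : env 3 = N * N) (e4 : env 4 = (N + 2) ^ c₀)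
    (h : Driver N m₀ m j w fp col piv) (hz : ∀ c, j ≤ c → piv c = 0)
    (hW : fp + N * (N + 2) ^ c₀ < W) :
    Run W 5 (driverBody p₀) (stepTime N p₀.regBound T₀ w) env m fun m' =>
      (j / w % 2 = 1 → ∃ col' piv', Driver N m₀ m' (j + 1) 1 (fp + N * (N + 2) ^ c₀) col' piv' ∧
        Eliminated j (j + 1) (update col piv (j - w) j j (j + w)) piv col' piv') ∧
      (j / w % 2 = 0 → Driver N m₀ m' j (2 * w) (fp + N * (N + 2) ^ c₀)
        (update col piv (j - w) j (j - 2 * w) (j - w)) piv) := by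
  obtain ⟨hrep, h0, h1, h2, hzero, hfp, hframe⟩ := h
  have hjN : j ≤ N := by
    rcases Nat.mod_two_eq_zero_or_one (j / w) with h | h
    · exact (heven h).2
    · have := hodd h
      omega
  have hN : 1 ≤ N := by omega
  have hNN : N ≤ N * N := Nat.le_mul_self N
  have hNw : N = N / w * w := (Nat.div_mul_cancel hwN).symm
  have hS : N + 2 ≤ (N + 2) ^ c₀ := Nat.le_self_pow (by omega) _
  set S := (N + 2) ^ c₀ with hSdef
  have hSN : S ≤ N * S := Nat.le_mul_of_pos_left _ hN
  set U := N / w * (2 * T₀ w + p₀.regBound + 700 * (w * w) + 500) + 500 * (w * w) + 500 with hU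
  have hT : U + 100 * N + 200 ≤ stepTime N p₀.regBound T₀ w := by
    rw [stepTime]
    omega
  clear_value U
  refine Run.bind (T₀ := U + 100 * N + 190) (by simp [h0]; omega)
    (by simp only [Expr.cost]; omega) ?_
  refine Run.bind (T₀ := U + 100 * N + 180) (by simp [h1]; omega)
    (by simp only [Expr.cost]; omega) ?_
  refine Run.bind (T₀ := U + 100 * N + 170) (by simp [h2]; omega)
    (by simp only [Expr.cost]; omega) ?_
  simp only [Expr.eval, h0, h1, h2]
  set E := Function.update (Function.update (Function.update env 5 j) 6 w) 7 fp with hE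
  have E2 : E 2 = N := by simp [hE, e2]
  have E3 : E 3 = N * N := by simp [hE, e3]
  have E4 : E 4 = S := by simp [hE, e4]
  have E5 : E 5 = j := by simp [hE]
  have E6 : E 6 = w := by simp [hE]
  have E7 : E 7 = fp := by simp [hE]
  -- the update of a block
  have hupd : ∀ (e : Expr) (dst : ℕ), e.Ok W 9 (Function.update E 8 (j - w)) m →
      e.eval (Function.update E 8 (j - w)) m = dst → e.cost ≤ 20 → dst + w ≤ N →
      j ≤ dst ∨ dst + w ≤ j - w →
      Run W 8 (.bind 8 (.var 5 - .var 6) (.bind 9 e (updateBlock p₀))) (U + 40) E m fun m' =>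
        Rep N m' (update col piv (j - w) j dst (dst + w)) piv ∧
        (∀ x, x < 5 * (N * N) → m' x = m x) ∧ ∀ x, fp + N * S ≤ x → m' x = 0 := by
    intro e dst he hev hcost hdst hdisj
    refine Run.bind (T₀ := U + 30) ?_ ?_ ?_
    · simp only [Expr.sub_def, Expr.Ok, Expr.eval, Op.eval_sub, E5, E6]
      and_intros
      all_goals omega
    · simp only [Expr.sub_def, Expr.cost]
      omega
    have : (Expr.var 5 - Expr.var 6 : Expr).eval E m = j - w := by simp [E5, E6]
    rw [this]
    refine Run.bind (T₀ := U) he (by omega) ?_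
    rw [hev]
    refine run_updateBlock hp₀ hc (w := w) (k := N / w) (src := j - w) (dst := dst) (fp := fp) hNw
      hw (by omega) hdst (by omega) (by simp [E2]) (by simp [E3]) (by simp [E4, hSdef])
      (by simp [E6]) (by simp [E7]) (by simp) (by simp) hrep hzero hfp (by rw [← hSdef]; omega)
      hU.ge fun m' r1 r2 r3 => ?_
    rw [Nat.sub_add_cancel hwj] at r1
    exact ⟨r1, r2, r3⟩
  refine Run.mono (T := (U + 100 * N + 159) + 10) ?_ (by omega) (fun _ h => h)
  refine Run.seq (R := fun m' => (m' 2 = fp ∧ ∀ x, fp + N * S ≤ x → m' x = 0) ∧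
    (∀ x, 4 * (N * N) ≤ x → x < 5 * (N * N) → m' x = m₀ x) ∧
    (j / w % 2 = 1 → (m' 0 = j + 1 ∧ m' 1 = 1) ∧ ∃ col' piv', Rep N m' col' piv' ∧
        Eliminated j (j + 1) (update col piv (j - w) j j (j + w)) piv col' piv') ∧
    (j / w % 2 = 0 → (m' 0 = j ∧ m' 1 = 2 * w) ∧
      Rep N m' (update col piv (j - w) j (j - 2 * w) (j - w)) piv)) ?_ ?_
  · refine Run.ite (T₀ := U + 100 * N + 151) ?_ ?_ (fun hne => ?_) (fun heq => ?_)
    · simp only [Expr.mod_def, Expr.div_def, Expr.Ok, Expr.eval, Op.eval_mod, Op.eval_div, E5, E6]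
      have := Nat.div_le_self j w
      and_intros
      all_goals omega
    · simp only [Expr.cost, Expr.mod_def, Expr.div_def]
      omega
    · simp only [Expr.mod_def, Expr.div_def, Expr.eval, Op.eval_mod, Op.eval_div, E5, E6] at hne
      have hjw := hodd (by omega)
      refine Run.mono (T := (U + 40) + ((100 * N + 100) + (6 + 3))) ?_ (by omega) (fun _ h => h)
      refine Run.seq (hupd (.var 5) j ?_ (by simp [E5]) (by decide) hjw (.inl le_rfl)) ?_
      · simp [E5]
        omega
      rintro m1 ⟨r1, f1, z1⟩
      refine Run.seq (R := fun m' => (∀ x, x < 5 * (N * N) ∨ 9 * (N * N) ≤ x → m' x = m1 x) ∧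
        ∃ col' piv', Rep N m' col' piv' ∧
        Eliminated j (j + 1) (update col piv (j - w) j j (j + w)) piv col' piv')
        (run_procColumn (by omega) E2 E3 E5 r1 hz (by omega) le_rfl
          fun m' col' piv' k1 k2 k3 => ⟨k3, col', piv', k1, k2⟩) ?_
      rintro m2 ⟨f2, col', piv', r2, el2⟩
      refine Run.seq (Run.put (Q := fun m' => m' = Function.update m2 0 (j + 1)) ?_ ?_ (by decide)
        (by simp [E5])) ?_
      · simp
        omega
      · simp [E5]
        omega
      rintro m3 rfl
      refine Run.put (by simp; omega) (by simp; omega) (by decide) ?_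
      simp only [Expr.eval]
      refine ⟨⟨?_, fun x hx => ?_⟩, fun x hx hx' => ?_, fun _ => ⟨⟨by simp, by simp⟩, col', piv',
        r2.congr fun x hx hx' => ?_, el2⟩, fun h => by omega⟩
      · rw [Function.update_of_ne (by omega), Function.update_of_ne (by omega), f2 _ (by omega),
          f1 _ (by omega), h2]
      · rw [Function.update_of_ne (by omega), Function.update_of_ne (by omega), f2 _ (by omega),
          z1 _ hx]
      · rw [Function.update_of_ne (by omega), Function.update_of_ne (by omega), f2 _ (by omega),
          f1 _ (by omega), hframe x hx hx']
      · rw [Function.update_of_ne (by omega), Function.update_of_ne (by omega)]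
    · simp only [Expr.mod_def, Expr.div_def, Expr.eval, Op.eval_mod, Op.eval_div, E5, E6] at heq
      have hjw := heven heq
      refine Run.mono (T := (U + 40) + 10) ?_ (by omega) (fun _ h => h)
      refine Run.seq (hupd (.var 5 - .lit 2 * .var 6) (j - 2 * w) ?_ (by simp [E5, E6])
        (by decide) (by omega) (.inr (by omega))) ?_
      · simp [E5, E6]
        omega
      rintro m1 ⟨r1, f1, z1⟩
      refine Run.put (by simp; omega) (by simp [E6]; omega) (by decide) ?_
      simp only [Expr.mul_def, Expr.eval, Op.eval_mul, E6]
      rw [show j - 2 * w + w = j - w by omega] at r1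
      refine ⟨⟨?_, fun x hx => ?_⟩, fun x hx hx' => ?_, fun h => by omega,
        fun _ => ⟨⟨?_, by simp⟩, r1.congr fun x hx hx' => ?_⟩⟩
      · rw [Function.update_of_ne (by omega), f1 _ (by omega), h2]
      · rw [Function.update_of_ne (by omega), z1 _ hx]
      · rw [Function.update_of_ne (by omega), f1 _ (by omega), hframe x hx hx']
      · rw [Function.update_of_ne (by omega), f1 _ (by omega), h0]
      · rw [Function.update_of_ne (by omega)]
  rintro m1 ⟨⟨a2, az⟩, af, ao, ae⟩
  refine Run.put (by simp; omega) ?_ (by decide) ?_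
  · simp only [Expr.add_def, Expr.mul_def, Expr.Ok, Expr.eval, Op.eval_add, Op.eval_mul, E2, E4, E7]
    and_intros
    all_goals omega
  simp only [Expr.add_def, Expr.mul_def, Expr.eval, Op.eval_add, Op.eval_mul, E2, E4, E7]
  refine ⟨fun ho => ?_, fun he => ?_⟩
  · obtain ⟨⟨k0, k1⟩, col', piv', k2, k3⟩ := ao ho
    refine ⟨col', piv', ⟨k2.congr fun x hx hx' => ?_, by simpa using k0, by simpa using k1,
      by simp, fun x hx => ?_, by omega, fun x hx hx' => ?_⟩, k3⟩
    · rw [Function.update_of_ne (by omega)]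
    · rw [Function.update_of_ne (by omega), az x hx]
    · rw [Function.update_of_ne (by omega), af x hx hx']
  · obtain ⟨⟨k0, k1⟩, k2⟩ := ae he
    refine ⟨k2.congr fun x hx hx' => ?_, by simpa using k0, by simpa using k1,
      by simp, fun x hx => ?_, by omega, fun x hx hx' => ?_⟩
    · rw [Function.update_of_ne (by omega)]
    · rw [Function.update_of_ne (by omega), az x hx]
    · rw [Function.update_of_ne (by omega), af x hx hx']

/-- The time of the elimination of a block of `2 ^ ℓ` columns, after the first one. -/
def blockTime (N b : ℕ) (T₀ : ℕ → ℕ) : ℕ → ℕ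
  | 0 => 0
  | ℓ + 1 => 2 * blockTime N b T₀ ℓ + 2 * (stepTime N b T₀ (2 ^ ℓ) + 6)

/-- Induction along the recursion tree. The recursive calls are consecutive stretches of one loop,
so the rest of the loop is passed on as a continuation of cost `T₂`. The first column of the block
is already eliminated on entry. The number `s` of iterations satisfies `s (ℓ + 1) = 2 * s ℓ + 2` and
`s 0 = 0`, hence `s ℓ = 2 ^ (ℓ + 1) - 2`, which is the factor in the free-memory pointer. -/
theorem run_driver_block {p₀ : Prog} {c₀ : ℕ} {T₀ : ℕ → ℕ} (hp₀ : Multiplies p₀ c₀ T₀)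
    (hc : 3 ≤ c₀) {N K W : ℕ} {env m₀ : ℕ → ℕ} (hN : N = 2 ^ K)
    (e2 : env 2 = N) (e3 : env 3 = N * N) (e4 : env 4 = (N + 2) ^ c₀) (ℓ : ℕ) :
    ∀ {a fp T₂ : ℕ} {m : ℕ → ℕ} {col₀ col₁ : ℕ → ℕ → ZMod 2} {piv₀ piv₁ : ℕ → ℕ}
      {Q : (ℕ → ℕ) → Prop}, 2 ^ ℓ ∣ a → a + 2 ^ ℓ ≤ N →
      Driver N m₀ m (a + 1) 1 fp col₁ piv₁ → Eliminated a (a + 1) col₀ piv₀ col₁ piv₁ →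
      (∀ c, a ≤ c → piv₀ c = 0) → fp + (2 ^ (ℓ + 1) - 2) * (N * (N + 2) ^ c₀) < W →
      (∀ m' col piv, Driver N m₀ m' (a + 2 ^ ℓ) (2 ^ ℓ)
          (fp + (2 ^ (ℓ + 1) - 2) * (N * (N + 2) ^ c₀)) col piv →
        Eliminated a (a + 2 ^ ℓ) col₀ piv₀ col piv → Run W 5 (driver p₀) T₂ env m' Q) →
      Run W 5 (driver p₀) (blockTime N p₀.regBound T₀ ℓ + T₂) env m Q := by
  have hNpos : 0 < N := hN ▸ Nat.two_pow_pos K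
  have hNN : N ≤ N * N := Nat.le_mul_self N
  induction ℓ with
  | zero =>
    intro a fp T₂ m col₀ col₁ piv₀ piv₁ Q _ _ hD hE _ _ hQ
    rw [blockTime, zero_add]
    exact hQ m col₁ piv₁ (by simpa using hD) (by simpa using hE)
  | succ ℓ ih =>
    intro a fp T₂ m col₀ col₁ piv₀ piv₁ Q hdvd haN hD hE hz hW hQ
    have hw : 0 < 2 ^ ℓ := Nat.two_pow_pos ℓ
    have hpow : 2 ^ (ℓ + 1) = 2 * 2 ^ ℓ := by rw [pow_succ, mul_comm]
    have hpow' : 2 ^ (ℓ + 1 + 1) = 4 * 2 ^ ℓ := by rw [pow_succ, hpow]; ring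
    simp only [hpow', hpow] at hQ hW ih hdvd haN
    obtain ⟨b, rfl⟩ := hdvd
    have hwN : 2 ^ ℓ ∣ N := by
      rw [hN]
      refine pow_dvd_pow 2 ?_
      by_contra hlt
      have : 2 ^ K ≤ 2 ^ ℓ := Nat.pow_le_pow_right (by omega) (by omega)
      omega
    set w := 2 ^ ℓ with hwdef
    set M := N * (N + 2) ^ c₀ with hM
    have hSS : N + 2 ≤ (N + 2) ^ c₀ := Nat.le_self_pow (by omega) _
    have hM1 : N + 2 ≤ M := hSS.trans (Nat.le_mul_of_pos_left _ hNpos)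
    set a := 2 * w * b with ha
    -- Since `a` is a multiple of `2 * w`, the parity recognizes the end of the left half, and below
    -- that of the right half.
    have hdiv1 : (a + w) / w % 2 = 1 := by
      rw [ha, show 2 * w * b + w = w * (2 * b + 1) by ring, Nat.mul_div_cancel_left _ hw]
      omega
    have hdiv2 : (a + w + w) / w % 2 = 0 := by
      rw [ha, show 2 * w * b + w + w = w * (2 * b + 2) by ring, Nat.mul_div_cancel_left _ hw]
      omega
    have hfp := hD.le_fp
    -- With the products expanded, the memory bounds are linear in `w * M` and `M`.
    have m1 : (4 * w - 2) * M = 4 * (w * M) - 2 * M := by rw [Nat.sub_mul]; ring_nf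
    have m2 : (2 * w - 2) * M = 2 * (w * M) - 2 * M := by rw [Nat.sub_mul]; ring_nf
    have hwM : M ≤ w * M := Nat.le_mul_of_pos_left _ hw
    have hguard : ∀ {m' : ℕ → ℕ}, m' 1 = w → (Expr.var 2 - .get (.lit 1)).Ok W 5 env m' ∧
        (Expr.var 2 - .get (.lit 1)).eval env m' ≠ 0 := fun {m'} h => by
      simp only [Expr.sub_def, Expr.Ok, Expr.eval, Op.eval_sub, e2, h]
      refine ⟨?_, by omega⟩
      and_intros
      all_goals omega
    have hcost : (Expr.var 2 - .get (.lit 1)).cost = 5 := rfl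
    rw [blockTime, ← hwdef]
    refine Run.mono (T := blockTime N p₀.regBound T₀ ℓ + (stepTime N p₀.regBound T₀ w + 6 +
      (blockTime N p₀.regBound T₀ ℓ + (stepTime N p₀.regBound T₀ w + 6 + T₂)))) (Q := Q) ?_
      (by omega) (fun _ h => h)
    -- the left half
    refine ih (a := a) (fp := fp) ⟨2 * b, by ring⟩ (by omega) hD hE hz (by omega) ?_
    intro m1' colL pivL hDL hEL
    obtain ⟨g1, g2⟩ := hguard hDL.w_eq
    have hzL : ∀ c, a + w ≤ c → pivL c = 0 := fun c hc => by
      rw [hEL.piv_eq c (.inr hc), hz c (by omega)]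
    refine Run.while_step g1 g2 (T₂ := blockTime N p₀.regBound T₀ ℓ +
      (stepTime N p₀.regBound T₀ w + 6 + T₂)) ?_ (run_driverBody hp₀ hc hw hwN (by omega)
      (fun _ => by omega) (fun h => by omega) e2 e3 e4 hDL hzL (by omega)) ?_
    · omega
    rintro m2' ⟨ho, -⟩
    obtain ⟨col', piv', hD2, hE2⟩ := ho hdiv1
    rw [Nat.add_sub_cancel] at hE2
    -- the right half
    refine ih (a := a + w) ⟨2 * b + 1, by rw [ha]; ring⟩ (by omega) hD2 hE2 hzL (by omega) ?_
    intro m3' colR pivR hDR hER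
    obtain ⟨g3, g4⟩ := hguard hDR.w_eq
    have hzR : ∀ c, a + w + w ≤ c → pivR c = 0 := fun c hc => by
      rw [hER.piv_eq c (.inr hc), hzL c (by omega)]
    refine Run.while_step g3 g4 (T₂ := T₂) ?_ (run_driverBody hp₀ hc hw hwN (by omega)
      (fun h => by omega) (fun _ => by omega) e2 e3 e4 hDR hzR (by omega)) ?_
    · omega
    rintro m4' ⟨-, he⟩
    have hD4 := he hdiv2
    have hmerge := hEL.merge (by omega) (by omega) hER
    rw [show a + w + w - w = a + w by omega, show a + w + w - 2 * w = a by omega] at hD4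
    rw [show a + w + w = a + 2 * w by omega] at hD4 hmerge
    refine hQ m4' _ _ ?_ hmerge
    convert hD4 using 1
    omega

/-- The loop stops when the finished block has width `w = N`. The `2 ^ (K + 1) - 2` iterations are
fewer than `2 * N`, which bounds the memory. -/
theorem run_driver {p₀ : Prog} {c₀ : ℕ} {T₀ : ℕ → ℕ} (hp₀ : Multiplies p₀ c₀ T₀)
    (hc : 3 ≤ c₀) {N K W fp : ℕ} {env m₀ m : ℕ → ℕ} {col₀ col₁ : ℕ → ℕ → ZMod 2} {piv₁ : ℕ → ℕ}
    (hN : N = 2 ^ K) (e2 : env 2 = N) (e3 : env 3 = N * N) (e4 : env 4 = (N + 2) ^ c₀)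
    (hD : Driver N m₀ m 1 1 fp col₁ piv₁) (hE : Eliminated 0 1 col₀ (fun _ => 0) col₁ piv₁)
    (hW : fp + 2 * N * (N * (N + 2) ^ c₀) < W) :
    Run W 5 (driver p₀) (blockTime N p₀.regBound T₀ K + 10) env m fun m' =>
      ∃ fp' col piv, Driver N m₀ m' N N fp' col piv ∧ Eliminated 0 N col₀ (fun _ => 0) col piv := by
  have hle : (2 ^ (K + 1) - 2) * (N * (N + 2) ^ c₀) ≤ 2 * N * (N * (N + 2) ^ c₀) := by
    apply Nat.mul_le_mul_right
    rw [pow_succ, ← hN]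
    omega
  refine run_driver_block hp₀ hc hN e2 e3 e4 K (a := 0) (by simp) (by simp [hN]) hD hE
    (fun _ _ => rfl) (by omega) fun m' col piv hD' hE' => ?_
  rw [zero_add, ← hN] at hD' hE'
  have hNpos : 0 < N := hN ▸ Nat.two_pow_pos K
  have hNN : N ≤ N * N := Nat.le_mul_self N
  have hfp := hD.le_fp
  refine Run.while_done ?_ (by simp [e2, hD'.w_eq]) (by decide) ⟨_, col, piv, hD', hE'⟩
  simp only [Expr.sub_def, Expr.Ok, Expr.eval, Op.eval_sub, e2, hD'.w_eq]
  and_intros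
  all_goals omega

end BinaryMatrix

namespace WordRAM

/-- The `k`-th power of an expression. -/
def Expr.pow (e : Expr) : ℕ → Expr
  | 0 => .lit 1
  | k + 1 => e.pow k * e

theorem Expr.eval_pow (env m : ℕ → ℕ) (e : Expr) (k : ℕ) :
    (e.pow k).eval env m = e.eval env m ^ k := by
  induction k with
  | zero => rfl
  | succ k ih =>
    rw [pow_succ, ← ih]
    rfl

theorem Expr.ok_pow {W d : ℕ} {env m : ℕ → ℕ} {e : Expr} (he : e.Ok W d env m)
    (hpos : 1 ≤ e.eval env m) {k : ℕ} (hW : e.eval env m ^ k < W) : (e.pow k).Ok W d env m := by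
  induction k with
  | zero => simpa [Expr.pow] using hW
  | succ k ih =>
    refine ⟨ih (lt_of_le_of_lt (Nat.pow_le_pow_right hpos (Nat.le_succ k)) hW), he, ?_⟩
    rw [Op.eval_mul, Expr.eval_pow, ← pow_succ]
    exact hW

theorem Expr.cost_pow (e : Expr) (k : ℕ) : (e.pow k).cost = k * (e.cost + 1) + 1 := by
  induction k with
  | zero => simp [Expr.pow]
  | succ k ih =>
    change (e.pow k).cost + e.cost + 1 = _
    rw [ih]
    ring

end WordRAM

namespace BinaryMatrix

open WordRAM

set_option linter.unusedSimpArgs false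

/-! ### Padding, and the elimination started from the input. -/

/-- The power of two that is computed below, as the number of rows and columns of the padded
matrix. -/
def padded (n : ℕ) : ℕ := 2 ^ Nat.clog 2 n

theorem le_padded (n : ℕ) : n ≤ padded n := Nat.le_pow_clog (by omega) n

/-- The summand 1 is needed only for `n = 0`, where the padded size is 1. -/
theorem padded_le (n : ℕ) : padded n ≤ 2 * n + 1 := by
  unfold padded
  rcases Nat.eq_zero_or_pos (Nat.clog 2 n) with h | h
  · rw [h]
    omega
  · obtain ⟨k, hk⟩ := Nat.exists_eq_add_of_le' h
    have : 2 ^ k < n := Nat.pow_lt_of_lt_clog (by omega)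
    rw [hk, pow_succ]
    omega

theorem clog_two_le_self (n : ℕ) : Nat.clog 2 n ≤ n :=
  Nat.clog_le_of_le_pow Nat.lt_two_pow_self.le

/-- Compute the size of the padded matrix in the memory cell `0`; the register `1` holds `n`. -/
def computePadded : Prog :=
  .seq (.put 2 (.lit 0) (.lit 1))
    (.while 2 (.var 1 - .get (.lit 0)) (.put 2 (.lit 0) (.lit 2 * .get (.lit 0))))

theorem run_computePadded {n W T : ℕ} {env m : ℕ → ℕ} {Q : (ℕ → ℕ) → Prop} (e1 : env 1 = n)
    (hW : 2 * padded n + 2 < W) (hT : 20 * n + 20 ≤ T)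
    (hQ : ∀ m' : ℕ → ℕ, m' 0 = padded n → (∀ x, 0 < x → m' x = m x) → Q m') :
    Run W 2 computePadded T env m Q := by
  have hle := le_padded n
  have key : ∀ r i m', i + r = Nat.clog 2 n → m' 0 = 2 ^ i → (∀ x, 0 < x → m' x = m x) →
      Run W 2 (.while 2 (.var 1 - .get (.lit 0)) (.put 2 (.lit 0) (.lit 2 * .get (.lit 0))))
        (r * 15 + 6) env m' Q := by
    intro r
    induction r with
    | zero =>
      intro i m' hi h0 hf
      have h0' : m' 0 = padded n := by rw [h0, padded, ← hi, add_zero]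
      refine Run.while_done ?_ (by simp [e1, h0', hle]) (by decide) (hQ m' h0' hf)
      simp [e1, h0']
      omega
    | succ r ih =>
      intro i m' hi h0 hf
      have hlt : 2 ^ i < n := Nat.pow_lt_of_lt_clog (by omega)
      refine Run.while_step (T₁ := 7) (T₂ := r * 15 + 6)
        (R := fun m2 => m2 = Function.update m' 0 (2 * 2 ^ i)) ?_ ?_ ?_
        (Run.put ?_ ?_ (by decide) ?_) ?_
      · simp [e1, h0]
        omega
      · simp [e1, h0]
        omega
      · simp only [Expr.cost, Expr.sub_def]
        omega
      · simp
        omega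
      · simp [h0]
        omega
      · simp [h0]
      · rintro m2 rfl
        refine ih (i + 1) _ (by omega) (by simp [pow_succ, mul_comm]) fun x hx => ?_
        rw [Function.update_of_ne (by omega), hf x hx]
  have hcl := clog_two_le_self n
  refine Run.mono (T := 3 + (Nat.clog 2 n * 15 + 6)) (Q := Q) ?_ (by omega) (fun _ h => h)
  refine Run.seq (R := fun m' => m' = Function.update m 0 1) (Run.put ?_ ?_ (by decide) ?_) ?_
  · simp
    omega
  · simp
    omega
  · simp
  · rintro m1 rfl
    exact key _ 0 _ (by omega) (by simp) fun x hx => Function.update_of_ne (by omega) _ _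

/-- Copy the matrix from the address `off` to its two places, and eliminate. The registers
`0, …, 4` hold the number of rows, the number of columns, the size `N` of the padded matrix, `N * N`
and the size of the memory of a multiplication. -/
def eliminate (off : ℕ) (p₀ : Prog) : Prog :=
  .seq (.fill 5 (.var 0) (.var 1) (.lit 4 * .var 3) (.var 2)
    (.get (.lit off + .var 5 * .var 1 + .var 7))) <|
  .seq (.fill 5 (.var 0) (.var 1) (.lit 5 * .var 3) (.var 2)
    (.get (.lit 4 * .var 3 + .var 5 * .var 2 + .var 7))) <|
  .seq (.bind 5 (.lit 0) (.bind 6 (.lit 0) (.bind 7 (.lit 0) procColumn))) <|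
  .seq (.put 5 (.lit 0) (.lit 1)) <|
  .seq (.put 5 (.lit 1) (.lit 1)) <|
  .seq (.put 5 (.lit 2) (.lit 10 * .var 3)) (driver p₀)

/-- The copy at `5 * (N * N)` is eliminated; the one at `4 * (N * N)` stays intact, because the
earliest basis consists of original columns. Column 0 is treated before the loop, whose invariant
requires a nonempty eliminated block. -/
theorem run_eliminate {p₀ : Prog} {c₀ : ℕ} {T₀ : ℕ → ℕ} (hp₀ : Multiplies p₀ c₀ T₀)
    (hc : 3 ≤ c₀) {off a n N W T : ℕ} {env m : ℕ → ℕ} {A : Matrix (Fin a) (Fin n) (ZMod 2)}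
    {Q : (ℕ → ℕ) → Prop} (hN : N = padded n) (han : a ≤ n) (hoff : off ≤ 2) (e0 : env 0 = a)
    (e1 : env 1 = n) (e2 : env 2 = N) (e3 : env 3 = N * N) (e4 : env 4 = (N + 2) ^ c₀)
    (hA : ∀ i < a, ∀ c < n, m (off + i * n + c) = (colOf A c i).val)
    (h0 : ∀ x, 4 * (N * N) ≤ x → m x = 0)
    (hW : 10 * (N * N) + 2 * N * (N * (N + 2) ^ c₀) < W)
    (hT : 200 * (N * N) + 300 * N + 400 + blockTime N p₀.regBound T₀ (Nat.clog 2 n) ≤ T)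
    (hQ : ∀ (m' : ℕ → ℕ) (col : ℕ → ℕ → ZMod 2) (piv : ℕ → ℕ), Rep N m' col piv →
      Eliminated 0 N (colOf A) (fun _ => 0) col piv →
      (∀ i < a, ∀ c < n, m' (4 * (N * N) + i * N + c) = (colOf A c i).val) → Q m') :
    Run W 5 (eliminate off p₀) T env m Q := by
  have hnN : n ≤ N := hN ▸ le_padded n
  have hN1 : 1 ≤ N := hN ▸ Nat.two_pow_pos _
  have hNN : N ≤ N * N := Nat.le_mul_self N
  have hnn : n * n ≤ N * N := Nat.mul_le_mul hnN hnN
  have han' : a * n ≤ n * n := Nat.mul_le_mul_right _ han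
  have haN : a * n ≤ N * N := han'.trans hnn
  have hfill : ∀ k ≤ 30, 2 + a * (2 + n * (k + 20) + 19) + 7 ≤ 50 * (N * N) + 21 * N + 9 := by
    intro k hk
    have h1 : a * (2 + n * (k + 20) + 19) ≤ N * (21 + N * 50) := by
      refine Nat.mul_le_mul (by omega) ?_
      have : n * (k + 20) ≤ N * 50 := Nat.mul_le_mul hnN (by omega)
      omega
    have h2 : N * (21 + N * 50) = 50 * (N * N) + 21 * N := by ring
    omega
  refine Run.mono (T := (50 * (N * N) + 21 * N + 9) + ((50 * (N * N) + 21 * N + 9) +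
    ((100 * N + 106) + (3 + (3 + (6 + (blockTime N p₀.regBound T₀ (Nat.clog 2 n) + 10)))))))
    (Q := Q) ?_ (by omega) (fun _ h => h)
  refine Run.seq (R := fun m' => (∀ i < a, ∀ c < n,
      m' (4 * (N * N) + i * N + c) = (colOf A c i).val) ∧
      ∀ x, 5 * (N * N) ≤ x → m' x = 0) ?_ ?_
  · refine Run.fill a n (4 * (N * N)) N (fun i c => (colOf A c i).val) (by simp [e0]; omega)
      (by simp [e0]) hnN (fun i hi m' => ?_) (fun i hi j hj m' hm' => ?_)
      (hfill _ (by simp)) (fun m' h1 h2 => ⟨h1, fun x hx => ?_⟩)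
    · simp [e1]
      omega
    · have ha := addr_lt hi hj
      have ha' := addr_lt (show i < N by omega) (show j < N by omega)
      have hv := zmod_val_lt (colOf A j i)
      have hg : m' (off + i * n + j) = (colOf A j i).val := by
        rw [hm' _ fun i' hi' j' hj' _ => by omega, hA i hi j hj]
      set E := fillEnv env 5 i a j n with hE
      have E1 : E 1 = n := by simp [hE, fillEnv, e1]
      have E2 : E 2 = N := by simp [hE, fillEnv, e2]
      have E3 : E 3 = N * N := by simp [hE, fillEnv, e3]
      have E5 : E 5 = i := by simp [hE, fillEnv]
      have E7 : E 7 = j := by simp [hE, fillEnv]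
      simp only [Expr.add_def, Expr.mul_def, Expr.Ok, Expr.eval, Op.eval_add, Op.eval_mul, E1, E2,
        E3, E5, E7, hg]
      and_intros
      all_goals first | exact trivial | omega
    · rw [h2 _ fun i hi j hj => ?_, h0 x (by omega)]
      have ha' := addr_lt (show i < N by omega) (show j < N by omega)
      omega
  rintro m1 ⟨hA1, hz1⟩
  refine Run.seq (R := fun m' => Rep N m' (colOf A) (fun _ => 0) ∧ (∀ i < a, ∀ c < n,
      m' (4 * (N * N) + i * N + c) = (colOf A c i).val) ∧
      ∀ x, 10 * (N * N) ≤ x → m' x = 0) ?_ ?_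
  · refine Run.fill a n (5 * (N * N)) N (fun i c => (colOf A c i).val) (by simp [e0]; omega)
      (by simp [e0]) hnN (fun i hi m' => ?_) (fun i hi j hj m' hm' => ?_)
      (hfill _ (by decide)) (fun m' h1 h2 => ⟨⟨fun i hi c hcN => ?_, fun c hcN => ?_,
      fun p hp => .inl ⟨?_, fun _ => by omega⟩, fun _ => by omega, fun _ _ => rfl,
      fun c i hi => colOf_apply_of_le A (by omega)⟩, fun i hi c hcn => ?_, fun x hx => ?_⟩)
    · simp [e1]
      omega
    · have ha' := addr_lt (show i < N by omega) (show j < N by omega)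
      have hv := zmod_val_lt (colOf A j i)
      have hg : m' (4 * (N * N) + i * N + j) = (colOf A j i).val := by
        rw [hm' _ fun i' hi' j' hj' _ => by omega, hA1 i hi j hj]
      set E := fillEnv env 5 i a j n with hE
      have E2 : E 2 = N := by simp [hE, fillEnv, e2]
      have E3 : E 3 = N * N := by simp [hE, fillEnv, e3]
      have E5 : E 5 = i := by simp [hE, fillEnv]
      have E7 : E 7 = j := by simp [hE, fillEnv]
      simp only [Expr.add_def, Expr.mul_def, Expr.Ok, Expr.eval, Op.eval_add, Op.eval_mul, E2,
        E3, E5, E7, hg]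
      and_intros
      all_goals first | exact trivial | omega
    · by_cases hin : i < a ∧ c < n
      · exact h1 i hin.1 c hin.2
      · rw [h2 _ fun i' hi' j' hj' he => ?_, hz1 _ (by omega)]
        · by_cases hia : i < a
          · rw [colOf_of_le A (by omega), Pi.zero_apply, ZMod.val_zero]
          · rw [colOf_apply_of_le A (by omega), ZMod.val_zero]
        · have := addr_inj (st := N) (i := i) (j := c) (i' := i') (j' := j') hcN (by omega)
            (by omega)
          omega
    · rw [h2 _ fun i' hi' j' hj' => ?_, hz1 _ (by omega)]
      have ha' := addr_lt (show i' < N by omega) (show j' < N by omega)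
      omega
    · rw [h2 _ fun i' hi' j' hj' => ?_, hz1 _ (by omega)]
      have ha' := addr_lt (show i' < N by omega) (show j' < N by omega)
      omega
    · have ha' := addr_lt (show i < N by omega) (show c < N by omega)
      rw [h2 _ fun i' hi' j' hj' => by omega, hA1 i hi c hcn]
    · rw [h2 _ fun i' hi' j' hj' => ?_, hz1 _ (by omega)]
      have ha' := addr_lt (show i' < N by omega) (show j' < N by omega)
      omega
  rintro m2 ⟨hR2, hA2, hz2⟩
  refine Run.seq (R := fun m' => ∃ col piv, Rep N m' col piv ∧
      Eliminated 0 1 (colOf A) (fun _ => 0) col piv ∧ (∀ i < a, ∀ c < n,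
      m' (4 * (N * N) + i * N + c) = (colOf A c i).val) ∧
      ∀ x, 10 * (N * N) ≤ x → m' x = 0) ?_ ?_
  -- The register 5 holds the column index 0; the registers 6 and 7 only raise the depth to the one
  -- at which `procColumn` runs.
  · refine Run.bind (T₀ := 100 * N + 104) (by simp; omega) (by simp only [Expr.cost]; omega) ?_
    refine Run.bind (T₀ := 100 * N + 102) (by simp; omega) (by simp only [Expr.cost]; omega) ?_
    refine Run.bind (T₀ := 100 * N + 100) (by simp; omega) (by simp only [Expr.cost]; omega) ?_
    refine run_procColumn (j := 0) hN1 (by simp [e2]) (by simp [e3]) (by simp) hR2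
      (fun _ _ => rfl) (by omega) le_rfl fun m' col piv h1 h2 h3 =>
      ⟨col, piv, h1, h2, fun i hi c hcn => ?_, fun x hx => ?_⟩
    · have ha' := addr_lt (show i < N by omega) (show c < N by omega)
      rw [h3 _ (by omega), hA2 i hi c hcn]
    · rw [h3 _ (by omega), hz2 x hx]
  rintro m3 ⟨col, piv, hR3, hE3, hA3, hz3⟩
  refine Run.seq (Run.put (Q := fun m' => m' = Function.update m3 0 1) (by simp; omega)
    (by simp; omega) (by decide) (by simp)) ?_
  rintro m4 rfl
  refine Run.seq (Run.put (Q := fun m' => m' = Function.update (Function.update m3 0 1) 1 1)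
    (by simp; omega) (by simp; omega) (by decide) (by simp)) ?_
  rintro m4 rfl
  refine Run.seq (Run.put (Q := fun m' => m' = Function.update (Function.update
    (Function.update m3 0 1) 1 1) 2 (10 * (N * N))) (by simp; omega) (by simp [e3]; omega)
    (by decide) (by simp [e3])) ?_
  intro m4 hm4
  have hf4 : ∀ x, 3 ≤ x → m4 x = m3 x := fun x hx => by
    rw [hm4, Function.update_of_ne (by omega), Function.update_of_ne (by omega),
      Function.update_of_ne (by omega)]
  have hD : Driver N m4 m4 1 1 (10 * (N * N)) col piv :=
    ⟨hR3.congr fun x hx _ => hf4 x (by omega), by simp [hm4], by simp [hm4], by simp [hm4],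
      fun x hx => by rw [hf4 x (by omega), hz3 x hx], le_rfl, fun _ _ _ => rfl⟩
  refine (run_driver hp₀ hc (K := Nat.clog 2 n) hN e2 e3 e4 hD hE3 hW).mono le_rfl ?_
  rintro m' ⟨fp', col', piv', hD', hE'⟩
  refine hQ m' col' piv' hD'.rep hE' fun i hi c hcn => ?_
  have ha' := addr_lt (show i < N by omega) (show c < N by omega)
  rw [hD'.frame _ (by omega) (by omega), hf4 _ (by omega), hA3 i hi c hcn]

/-- Compute the registers `2, 3, 4`, eliminate, and go on with the program `p`. -/
def withElimination (off c₀ : ℕ) (p₀ p : Prog) : Prog :=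
  .seq computePadded <| .bind 2 (.get (.lit 0)) <| .bind 3 (.var 2 * .var 2) <|
  .bind 4 ((Expr.var 2 + .lit 2).pow c₀) <| .seq (eliminate off p₀) p

/-- The time of `withElimination`, up to the program that follows. -/
def eliminationTime (c₀ b : ℕ) (T₀ : ℕ → ℕ) (n : ℕ) : ℕ :=
  200 * (padded n * padded n) + 400 * padded n + 500 + 5 * c₀ +
    blockTime (padded n) b T₀ (Nat.clog 2 n)

theorem run_withElimination {p₀ : Prog} {c₀ : ℕ} {T₀ : ℕ → ℕ} (hp₀ : Multiplies p₀ c₀ T₀)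
    (hc : 3 ≤ c₀) {off a n N W T₂ : ℕ} {env m : ℕ → ℕ} {A : Matrix (Fin a) (Fin n) (ZMod 2)}
    {p : Prog} {Q : (ℕ → ℕ) → Prop} (hN : N = padded n) (han : a ≤ n) (hoff : 1 ≤ off)
    (hoff' : off ≤ 2) (e0 : env 0 = a) (e1 : env 1 = n) (hA : ListAt m off (encode A))
    (h0 : ∀ x, off + a * n ≤ x → m x = 0)
    (hW : 10 * (N * N) + 2 * N * (N * (N + 2) ^ c₀) < W)
    (hp : ∀ (env' m' : ℕ → ℕ) (col : ℕ → ℕ → ZMod 2) (piv : ℕ → ℕ), env' 0 = a → env' 1 = n →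
      env' 2 = N → env' 3 = N * N → Rep N m' col piv →
      Eliminated 0 N (colOf A) (fun _ => 0) col piv →
      (∀ i < a, ∀ c < n, m' (4 * (N * N) + i * N + c) = (colOf A c i).val) →
      Run W 5 p T₂ env' m' Q) :
    Run W 2 (withElimination off c₀ p₀ p) (eliminationTime c₀ p₀.regBound T₀ n + T₂) env m Q := by
  have hnN : n ≤ N := hN ▸ le_padded n
  have hN1 : 1 ≤ N := hN ▸ Nat.two_pow_pos _
  have hNN : N ≤ N * N := Nat.le_mul_self N
  have haN : a * n ≤ N * N := Nat.mul_le_mul (by omega) hnN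
  have hS : N + 2 ≤ (N + 2) ^ c₀ := Nat.le_self_pow (by omega) _
  have hSN : (N + 2) ^ c₀ ≤ N * (N + 2) ^ c₀ := Nat.le_mul_of_pos_left _ hN1
  have hSN' : N * (N + 2) ^ c₀ ≤ N * (N * (N + 2) ^ c₀) := Nat.le_mul_of_pos_left _ hN1
  have hSN2 : 2 * N * (N * (N + 2) ^ c₀) = 2 * (N * (N * (N + 2) ^ c₀)) := by ring
  set B := blockTime N p₀.regBound T₀ (Nat.clog 2 n) with hB
  refine Run.mono (T := (20 * n + 20) + (2 + (5 + ((5 * c₀ + 1) +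
    ((200 * (N * N) + 300 * N + 400 + B) + T₂))))) (Q := Q) ?_ ?_ (fun _ h => h)
  swap
  · rw [eliminationTime, ← hN, ← hB]
    omega
  refine Run.seq (R := fun m' => m' 0 = N ∧ ∀ x, 0 < x → m' x = m x) (run_computePadded e1
    (by rw [← hN]; omega) le_rfl fun m' h1 h2 => ⟨h1.trans hN.symm, h2⟩) ?_
  rintro m1 ⟨h10, hf1⟩
  refine Run.bind (T₀ := 5 + ((5 * c₀ + 1) + ((200 * (N * N) + 300 * N + 400 + B) + T₂)))
    (by simp [h10]; omega) (by simp only [Expr.cost]; omega) ?_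
  simp only [Expr.eval, h10]
  refine Run.bind (T₀ := (5 * c₀ + 1) + ((200 * (N * N) + 300 * N + 400 + B) + T₂))
    (by simp; omega) (by simp only [Expr.cost, Expr.mul_def]; omega) ?_
  simp only [Expr.mul_def, Expr.eval, Op.eval_mul, Function.update_self]
  set E := Function.update (Function.update env 2 N) 3 (N * N) with hE
  have E2 : E 2 = N := by simp [hE]
  have heval : (Expr.var 2 + Expr.lit 2).eval E m1 = N + 2 := by simp [E2]
  refine Run.bind (T₀ := (200 * (N * N) + 300 * N + 400 + B) + T₂)
    (Expr.ok_pow (by simp [E2]; omega) (by rw [heval]; omega) (by rw [heval]; omega))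
    (by simp only [Expr.cost_pow, Expr.cost, Expr.add_def]; omega) ?_
  rw [Expr.eval_pow, heval]
  set E' := Function.update E 4 ((N + 2) ^ c₀) with hE'
  have E0' : E' 0 = a := by simp [hE', hE, e0]
  have E1' : E' 1 = n := by simp [hE', hE, e1]
  have E2' : E' 2 = N := by simp [hE', hE]
  have E3' : E' 3 = N * N := by simp [hE', hE]
  refine Run.seq (R := fun m' => ∃ col piv, Rep N m' col piv ∧
    Eliminated 0 N (colOf A) (fun _ => 0) col piv ∧
      ∀ i < a, ∀ c < n, m' (4 * (N * N) + i * N + c) = (colOf A c i).val)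
    (run_eliminate hp₀ hc (A := A) hN han hoff' E0' E1' E2' E3' (by simp [hE'])
      (fun i hi c hcn => ?_) (fun x hx => ?_) hW le_rfl
      fun m' col piv h1 h2 h3 => ⟨col, piv, h1, h2, h3⟩) ?_
  · have := listAt_encode.mp hA ⟨i, hi⟩ ⟨c, hcn⟩
    rw [hf1 _ (by omega), add_assoc, this]
    exact congrArg ZMod.val (colOf_fin_fin A ⟨i, hi⟩ ⟨c, hcn⟩).symm
  · rw [hf1 _ (by omega), h0 x (by omega)]
  · rintro m' ⟨col, piv, h1, h2, h3⟩
    exact hp E' m' col piv E0' E1' E2' E3' h1 h2 h3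

/-! ### Output of the inverse. -/

/-- At most one column has its pivot in row `i`, so each entry of the matrix of `E` is available in
constant time. -/
theorem elim_single {N : ℕ} {col : ℕ → ℕ → ZMod 2} {piv : ℕ → ℕ} {i : ℕ} (p : ℕ)
    (hinj : ∀ c c', piv c ≠ 0 → piv c = piv c' → c = c') :
    ((∀ c, piv c ≠ i + 1) →
      elim col piv 0 N (Pi.single i 1) p = Pi.single (M := fun _ => ZMod 2) i 1 p) ∧
    ∀ c < N, piv c = i + 1 →
      elim col piv 0 N (Pi.single i 1) p = Pi.single (M := fun _ => ZMod 2) i 1 p + col c p := by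
  have hterm : ∀ c, piv c ≠ i + 1 →
      (if piv c = 0 then (0 : ℕ → ZMod 2)
        else (Pi.single i 1 : ℕ → ZMod 2) (piv c - 1) • col c) = 0 := fun c hc => by
    split_ifs with h
    · rfl
    · rw [Pi.single_eq_of_ne (by omega), zero_smul]
  refine ⟨fun h => ?_, fun c hc h => ?_⟩
  · rw [elim_apply, Finset.sum_eq_zero fun c _ => hterm c (h c), add_zero]
  · rw [elim_apply, Finset.sum_eq_single c (fun c' _ hne => hterm c' fun h' => hne
      (hinj c' c (by omega) (h'.trans h.symm))) (fun hn => absurd hc (by simpa using hn))]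
    simp [h]

/-- Write the inverse matrix, after the elimination. -/
def writeInverse : Prog :=
  .fill 5 (.var 1) (.var 1) (.lit 0) (.var 1)
    (((.lit 1 - ((.var 7 + .lit 1) - .get (.lit 7 * .var 3 + .var 5)) -
      (.get (.lit 7 * .var 3 + .var 5) - (.var 7 + .lit 1))) +
      (.lit 1 - (.lit 1 - .get (.lit 8 * .var 3 + .var 7))) *
        .get (.lit 5 * .var 3 + (.get (.lit 7 * .var 3 + .var 5) - .lit 1) * .var 2 +
          (.get (.lit 8 * .var 3 + .var 7) - .lit 1))) % .lit 2)

theorem run_writeInverse {n N W : ℕ} {env m : ℕ → ℕ} {A : Matrix (Fin n) (Fin n) (ZMod 2)}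
    {col : ℕ → ℕ → ZMod 2} {piv : ℕ → ℕ} (hA : A.rank = n) (hnN : n ≤ N) (e1 : env 1 = n)
    (e2 : env 2 = N) (e3 : env 3 = N * N) (hR : Rep N m col piv)
    (hE : Eliminated 0 N (colOf A) (fun _ => 0) col piv) (hW : 10 * (N * N) + 10 < W) :
    Run W 5 writeInverse (120 * (N * N) + 30 * N + 20) env m
      fun m' => ListAt m' 0 (encode A⁻¹) := by
  have hNN : N ≤ N * N := Nat.le_mul_self N
  have hnn : n * n ≤ N * N := Nat.mul_le_mul hnN hnN
  have hinj : ∀ c c', piv c ≠ 0 → piv c = piv c' → c = c' := fun c c' => hE.piv_inj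
  refine Run.fill n n 0 n (fun j i => (elim col piv 0 N (Pi.single i 1) (piv j - 1)).val)
    (by simp [e1]; omega) (by simp [e1]) le_rfl (fun j hj m' => by simp [e1]; omega)
    (fun j hj i hi m' hm' => ?_) ?_ (fun m' h1 _ => listAt_encode.mpr fun j i => ?_)
  · obtain ⟨hpj, -⟩ := hE.inv_apply hnN hA ⟨j, hj⟩ ⟨i, hi⟩
    change piv j ≠ 0 at hpj
    have hpN := hR.piv_le j
    have hlow : ∀ x, 5 * (N * N) ≤ x → m' x = m x := fun x hx => hm' x fun i' hi' j' hj' _ => by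
      have := addr_lt hi' hj'
      omega
    have hgp : m' (7 * (N * N) + j) = piv j := by rw [hlow _ (by omega), hR.piv_mem j (by omega)]
    obtain ⟨p, hp⟩ : ∃ p, piv j = p + 1 := ⟨piv j - 1, by omega⟩
    have hpos := addr_lt hi hj
    have hpos' := addr_lt hj hi
    -- Two truncated differences give the indicator of `piv j = i + 1`.
    have hij : (1 - (i + 1 - piv j) - (piv j - (i + 1))) =
        (Pi.single (M := fun _ => ZMod 2) i 1 p).val := by
      by_cases h : p = i
      · rw [h, Pi.single_eq_same, ZMod.val_one]
        omega
      · rw [Pi.single_eq_of_ne h, ZMod.val_zero]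
        omega
    have hpp : piv j - 1 = p := by omega
    set E := fillEnv env 5 j n i n with hEE
    have E1 : E 1 = n := by simp [hEE, fillEnv, e1]
    have E2 : E 2 = N := by simp [hEE, fillEnv, e2]
    have E3 : E 3 = N * N := by simp [hEE, fillEnv, e3]
    have E5 : E 5 = j := by simp [hEE, fillEnv]
    have E7 : E 7 = i := by simp [hEE, fillEnv]
    obtain ⟨hs0, hs1⟩ := elim_single (N := N) (col := col) (piv := piv) (i := i) p hinj
    have hv := zmod_val_lt (Pi.single (M := fun _ => ZMod 2) i 1 p)
    rcases hR.used i (by omega) with ⟨hu, hu'⟩ | ⟨c, hu, hu'⟩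
    · rw [← hlow _ (by omega)] at hu
      -- Row `i` is no pivot row: its stored column index 0 makes the address truncate to column 0,
      -- and the value read is multiplied by 0.
      have hg : m' (5 * (N * N) + p * N + (0 - 1)) = (col 0 p).val := by
        rw [hlow _ (by omega), hR.mat p (by omega) 0 (by omega)]
      have hv' := zmod_val_lt (col 0 p)
      have ha := addr_lt (show p < N by omega) (show 0 < N by omega)
      simp only [Expr.add_def, Expr.mul_def, Expr.sub_def, Expr.mod_def, Expr.Ok, Expr.eval,
        Op.eval_add, Op.eval_mul, Op.eval_sub, Op.eval_mod, E1, E2, E3, E5, E7, hgp, hu, hpp, hg,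
        hij, hs0 hu']
      and_intros
      all_goals first | exact trivial | omega
    · rw [← hlow _ (by omega)] at hu
      have hcN := (hE.lt_of_ne_zero (c := c) (by omega)).1
      have ha := addr_lt (show p < N by omega) hcN
      have hg : m' (5 * (N * N) + p * N + (c + 1 - 1)) = (col c p).val := by
        rw [Nat.add_sub_cancel, hlow _ (by omega), hR.mat p (by omega) c hcN]
      have hv' := zmod_val_lt (col c p)
      have hu1 : 1 - (1 - (c + 1)) = 1 := by omega
      simp only [Expr.add_def, Expr.mul_def, Expr.sub_def, Expr.mod_def, Expr.Ok, Expr.eval,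
        Op.eval_add, Op.eval_mul, Op.eval_sub, Op.eval_mod, E1, E2, E3, E5, E7, hgp, hu, hpp, hg,
        hij, hu1, hs1 c hcN hu', one_mul, ← val_add_zmod_two]
      and_intros
      all_goals first | exact trivial | omega
  · have h1 : n * (2 + n * 100 + 19) ≤ N * (21 + N * 100) := Nat.mul_le_mul hnN (by omega)
    have h2 : N * (21 + N * 100) = 100 * (N * N) + 21 * N := by ring
    refine le_trans (b := 2 + n * (2 + n * 100 + 19) + 7) ?_ (by omega)
    simp only [Expr.cost, Expr.add_def, Expr.mul_def, Expr.sub_def, Expr.mod_def]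
    gcongr
    all_goals omega
  · rw [(hE.inv_apply hnN hA j i).2, ← h1 j j.2 i i.2, zero_add, zero_add]

/-! ### List of the columns, those with a pivot first. -/

/-- Append the columns `c < n` with a nonzero value of `e` to the list at `9 * (N * N)`, whose
length is in the memory cell `0`; the column `c` is in the register `d`. -/
def appendColumns (d : ℕ) (e : Expr) : Prog :=
  .for d (.var 1) (.ite (d + 2) e
    (.seq (.put (d + 2) (.lit 9 * .var 3 + .get (.lit 0)) (.var d))
      (.put (d + 2) (.lit 0) (.get (.lit 0) + .lit 1)))
    (.skip (d + 2)))

/-- A selected column lands at the place given by `s` plus the number of selected columns before it,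
as in `position`. Under `hs` the list has at most `n` entries in both uses. -/
theorem run_appendColumns {d n N s W : ℕ} {e : Expr} {env m : ℕ → ℕ} {Q : (ℕ → ℕ) → Prop}
    (P : ℕ → Prop) [DecidablePred P] (hd : 4 ≤ d) (hnN : n ≤ N) (e1 : env 1 = n)
    (e3 : env 3 = N * N) (h0 : m 0 = s) (hs : s + Nat.count P n = n ∨ s = 0)
    (hW : 10 * (N * N) + 10 < W) (hce : e.cost ≤ 10)
    (he : ∀ c < n, ∀ m' : ℕ → ℕ, (∀ x, 7 * (N * N) ≤ x → x < 8 * (N * N) → m' x = m x) →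
      e.Ok W (d + 2) (Function.update (Function.update env d c) (d + 1) n) m' ∧
      (e.eval (Function.update (Function.update env d c) (d + 1) n) m' ≠ 0 ↔ P c))
    (hQ : ∀ m' : ℕ → ℕ, m' 0 = s + Nat.count P n →
      (∀ c < n, P c → m' (9 * (N * N) + (s + Nat.count P c)) = c) →
      (∀ x, 0 < x → (x < 9 * (N * N) + s ∨ 10 * (N * N) ≤ x) → m' x = m x) → Q m') :
    Run W d (appendColumns d e) (50 * N + 10) env m Q := by
  have hNN : N ≤ N * N := Nat.le_mul_self N
  have hcn := Nat.count_le (p := P) (n := n)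
  refine Run.for (T₀ := 30) (fun i m' => m' 0 = s + Nat.count P i ∧
      (∀ c < i, P c → m' (9 * (N * N) + (s + Nat.count P c)) = c) ∧
      ∀ x, 0 < x → (x < 9 * (N * N) + s ∨ 10 * (N * N) ≤ x) → m' x = m x) n (by simp [e1])
    (by simp [e1]; omega) (by simp only [Expr.cost]; omega)
    ⟨by simp [h0], fun _ h => absurd h (Nat.not_lt_zero _), fun _ _ _ => rfl⟩ ?_
    (fun m' h => hQ m' h.1 h.2.1 h.2.2)
  rintro i hi m1 ⟨hc, hl, hf⟩
  obtain ⟨ho, hiff⟩ := he i hi m1 fun x h1 h2 => hf x (by omega) (by omega)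
  have hci : Nat.count P (i + 1) ≤ Nat.count P n := Nat.count_monotone P hi
  have hci' : Nat.count P i ≤ i := Nat.count_le _
  set E := Function.update (Function.update env d i) (d + 1) n with hE
  have E3 : E 3 = N * N := by
    rw [hE, Function.update_of_ne (by omega), Function.update_of_ne (by omega), e3]
  have Ed : E d = i := by rw [hE, Function.update_of_ne (by omega), Function.update_self]
  refine Run.ite (T₀ := 16) ho (by omega) (fun hne => ?_) (fun h0 => ?_)
  · have hPi := hiff.mp hne
    rw [Nat.count_succ, if_pos hPi] at hci
    refine Run.mono (T := 10 + 6) (Q := fun m' => m' = Function.update (Function.update m1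
      (9 * (N * N) + (s + Nat.count P i)) i) 0 (s + Nat.count P i + 1)) ?_ (by omega) ?_
    · refine Run.seq (R := fun m' => m' = Function.update m1 (9 * (N * N) + (s + Nat.count P i)) i)
        (Run.put ?_ ?_ (by simp) ?_) ?_
      · simp [E3, hc]
        omega
      · simp [Ed]
        omega
      · simp [E3, hc, Ed]
      · rintro m2 rfl
        have hg : Function.update m1 (9 * (N * N) + (s + Nat.count P i)) i 0 =
            s + Nat.count P i := by rw [Function.update_of_ne (by omega), hc]
        refine Run.put ?_ ?_ (by simp) ?_
        · simp
          omega
        · simp only [Expr.add_def, Expr.Ok, Expr.eval, Op.eval_add, hg]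
          omega
        · simp only [Expr.add_def, Expr.eval, Op.eval_add, hg]
    · rintro m2 rfl
      refine ⟨?_, fun c hci2 hPc => ?_, fun x hx hx' => ?_⟩
      · rw [Function.update_self, Nat.count_succ, if_pos hPi, add_assoc]
      · rw [Function.update_of_ne (by omega)]
        rcases Nat.lt_succ_iff_lt_or_eq.mp hci2 with h | rfl
        · have := Nat.count_strict_mono hPc h
          rw [Function.update_of_ne (by omega), hl c h hPc]
        · rw [Function.update_self]
      · rw [Function.update_of_ne (by omega), Function.update_of_ne (by omega), hf x hx hx']
  · have hPi : ¬ P i := fun h => hiff.mpr h h0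
    refine Run.skip (by omega) (by omega) ⟨?_, fun c hci2 hPc => ?_, hf⟩
    · rw [Nat.count_succ, if_neg hPi, add_zero, hc]
    · rcases Nat.lt_succ_iff_lt_or_eq.mp hci2 with h | rfl
      · exact hl c h hPc
      · exact absurd hPc hPi

/-- List the columns at `9 * (N * N)`, first those with a pivot, put the rank in the register `5`,
and go on with the program `p`. -/
def withColumns (p : Prog) : Prog :=
  .seq (.put 5 (.lit 0) (.lit 0)) <|
  .seq (appendColumns 5 (.get (.lit 7 * .var 3 + .var 5))) <|
  .bind 5 (.get (.lit 0)) <|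
  .seq (appendColumns 6 (.lit 1 - .get (.lit 7 * .var 3 + .var 6))) p

/-- The two passes write each column `c` at its position, so the list is a table of the inverse
permutation. -/
theorem run_withColumns {n N W T : ℕ} {env m : ℕ → ℕ} {col : ℕ → ℕ → ZMod 2} {piv : ℕ → ℕ}
    {p : Prog} {Q : (ℕ → ℕ) → Prop} (hnN : n ≤ N) (hN : 1 ≤ N) (e1 : env 1 = n)
    (e3 : env 3 = N * N) (hR : Rep N m col piv) (hW : 10 * (N * N) + 10 < W)
    (hp : ∀ m' : ℕ → ℕ,
      (∀ j : Fin n, m' (9 * (N * N) + j) = ((positionPerm piv n).symm j : ℕ)) →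
      (∀ x, 0 < x → x < 9 * (N * N) → m' x = m x) →
      Run W 6 p T (Function.update env 5 (numPivots piv n)) m' Q) :
    Run W 5 (withColumns p) (100 * N + 30 + T) env m Q := by
  have hNN : N ≤ N * N := Nat.le_mul_self N
  have hcount := numPivots_add_count piv n
  refine Run.mono (T := 3 + ((50 * N + 10) + (2 + ((50 * N + 10) + T)))) (Q := Q) ?_ (by omega)
    (fun _ h => h)
  refine Run.seq (R := fun m' => m' = Function.update m 0 0)
    (Run.put (by simp; omega) (by simp; omega) (by simp) (by simp)) ?_
  rintro _ rfl
  have hf1 : ∀ x, 0 < x → Function.update m 0 0 x = m x := fun x hx =>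
    Function.update_of_ne (by omega) _ _
  refine Run.seq (R := fun m' => m' 0 = numPivots piv n ∧
      (∀ c < n, piv c ≠ 0 → m' (9 * (N * N) + numPivots piv c) = c) ∧
      (∀ x, 0 < x → x < 9 * (N * N) → m' x = m x)) ?_ ?_
  · refine run_appendColumns (s := 0) (fun c => piv c ≠ 0) (by omega) hnN e1 e3 (by simp) (.inr rfl)
      hW (by simp) (fun c hc m' hm' => ?_) (fun m' h1 h2 h3 => ⟨?_, fun c hc hp => ?_,
        fun x hx hx' => ?_⟩)
    · have hg : m' (7 * (N * N) + c) = piv c := by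
        rw [hm' _ (by omega) (by omega), hf1 _ (by omega), hR.piv_mem c (by omega)]
      have := hR.piv_le c
      simp [e3, hg]
      omega
    · rw [h1, zero_add]
      rfl
    · have := h2 c hc hp
      rwa [zero_add] at this
    · rw [h3 x hx (by omega), hf1 x hx]
  rintro m1 ⟨h10, hl1, hf1⟩
  refine Run.bind (T₀ := (50 * N + 10) + T) (by simp [h10]; omega) (by simp only [Expr.cost]; omega)
    ?_
  simp only [Expr.eval, h10]
  refine Run.seq (R := fun m' => (∀ c < n, m' (9 * (N * N) + position piv n c) = c) ∧
      (∀ x, 0 < x → x < 9 * (N * N) → m' x = m x)) ?_ ?_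
  · refine run_appendColumns (s := numPivots piv n) (fun c => piv c = 0) (by omega) hnN
      (by simp [e1]) (by simp [e3]) h10 (.inl hcount) hW (by simp) (fun c hc m' hm' => ?_)
      (fun m' h1 h2 h3 => ⟨fun c hc => ?_, fun x hx hx' => ?_⟩)
    · have hg : m' (7 * (N * N) + c) = piv c := by
        rw [hm' _ (by omega) (by omega), hf1 _ (by omega) (by omega), hR.piv_mem c (by omega)]
      have := hR.piv_le c
      simp [e3, hg]
      omega
    · unfold position
      split_ifs with h
      · have := numPivots_lt h hc
        rw [h3 _ (by omega) (by omega), hl1 c hc h]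
      · exact h2 c hc (by simpa using h)
    · rw [h3 x hx (by omega), hf1 x hx hx']
  rintro m2 ⟨hl2, hf2⟩
  refine hp m2 (fun j => ?_) hf2
  have := hl2 _ ((positionPerm piv n).symm j).2
  rwa [position_symm] at this

/-! ### Output of the earliest basis and of the decomposition. -/

section

variable {a n N W r : ℕ} {env m : ℕ → ℕ} {A : Matrix (Fin a) (Fin n) (ZMod 2)}
  {col : ℕ → ℕ → ZMod 2} {piv : ℕ → ℕ}

/-- Write at the address `base` the columns of the matrix that have a pivot; their number is in the
register `5`. -/
def fillBasis (base : Expr) : Prog :=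
  .fill 6 (.var 0) (.var 5) base (.var 5)
    (.get (.lit 4 * .var 3 + .var 6 * .var 2 + .get (.lit 9 * .var 3 + .var 8)))

/-- The bound `hB` keeps the output below `4 * (N * N)`, away from the original matrix and the
column list that are being read. -/
theorem run_fillBasis {base : Expr} {B : ℕ} {Q : (ℕ → ℕ) → Prop} (hr : r = numPivots piv n)
    (han : a ≤ n) (hnN : n ≤ N) (e0 : env 0 = a) (e2 : env 2 = N) (e3 : env 3 = N * N)
    (e5 : env 5 = r) (hm : ∀ i < a, ∀ c < n, m (4 * (N * N) + i * N + c) = (colOf A c i).val)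
    (hl : ∀ k < r, m (9 * (N * N) + k) = nthPivot piv k) (hW : 10 * (N * N) + 10 < W)
    (hB : B + n * n ≤ 4 * (N * N)) (hbc : base.cost ≤ 20)
    (hb : ∀ i < a, ∀ j < r, ∀ m', base.Ok W 10 (fillEnv env 6 i a j r) m' ∧
      base.eval (fillEnv env 6 i a j r) m' = B)
    (hQ : ∀ m' : ℕ → ℕ, ListAt m' B (encode (A.submatrix id (pivotEmb piv n hr))) →
      (∀ x, x < B ∨ B + a * r ≤ x → m' x = m x) → Q m') :
    Run W 6 (fillBasis base) (100 * (N * N) + 30 * N + 20) env m Q := by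
  have hNN : N ≤ N * N := Nat.le_mul_self N
  have hrn : r ≤ n := hr ▸ numPivots_le piv n
  have har : a * r ≤ n * n := Nat.mul_le_mul han hrn
  refine Run.fill a r B r (fun i k => (colOf A (nthPivot piv k) i).val)
    (by simp [e0]; omega) (by simp [e0]) le_rfl (fun j hj m' => by simp [e5]; omega)
    (fun i hi k hk m' hm' => ⟨hb i hi k hk m', ?_⟩) ?_ (fun m' h1 h2 => hQ m' ?_ fun x hx => ?_)
  · have hq := (nthPivot_spec (hr ▸ hk)).1
    have hpos := addr_lt hi hk
    have ha := addr_lt (show i < N by omega) (show nthPivot piv k < N by omega)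
    have hlow : ∀ x, 4 * (N * N) ≤ x → m' x = m x := fun x hx => hm' x fun i' hi' j' hj' _ => by
      have := addr_lt hi' hj'
      omega
    have hg1 : m' (9 * (N * N) + k) = nthPivot piv k := by rw [hlow _ (by omega), hl k hk]
    have hg2 : m' (4 * (N * N) + i * N + nthPivot piv k) = (colOf A (nthPivot piv k) i).val := by
      rw [hlow _ (by omega), hm i hi _ hq]
    have hv := zmod_val_lt (colOf A (nthPivot piv k) i)
    set E := fillEnv env 6 i a k r with hE
    have E2 : E 2 = N := by simp [hE, fillEnv, e2]
    have E3 : E 3 = N * N := by simp [hE, fillEnv, e3]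
    have E5 : E 5 = r := by simp [hE, fillEnv, e5]
    have E6 : E 6 = i := by simp [hE, fillEnv]
    have E8 : E 8 = k := by simp [hE, fillEnv]
    simp only [Expr.add_def, Expr.mul_def, Expr.Ok, Expr.eval, Op.eval_add, Op.eval_mul, E2, E3, E5,
      E6, E8, hg1, hg2]
    and_intros
    all_goals first | exact trivial | omega
  · have h1 : a * (2 + r * 65 + 19) ≤ N * (21 + N * 65) :=
      Nat.mul_le_mul (by omega) (by omega)
    have h2 : N * (21 + N * 65) = 65 * (N * N) + 21 * N := by ring
    refine le_trans (b := 2 + a * (2 + r * 65 + 19) + 7) ?_ (by omega)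
    simp only [Expr.cost, Expr.add_def, Expr.mul_def]
    gcongr
    all_goals omega
  · refine listAt_encode.mpr fun i k => ?_
    rw [← add_assoc, h1 i i.2 k k.2]
    exact congrArg ZMod.val (colOf_fin_fin A i (pivotEmb piv n hr k))
  · refine h2 x fun i hi k hk => ?_
    have := addr_lt hi hk
    omega

/-- Write the rank, the numbers of the columns with a pivot, and these columns. -/
def writeBasis : Prog :=
  .seq (.put 6 (.lit 0) (.var 5)) <|
  .seq (.fill 6 (.lit 1) (.var 5) (.lit 1) (.var 5) (.get (.lit 9 * .var 3 + .var 8))) <|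
  fillBasis (.lit 1 + .var 5)

theorem run_writeBasis (hr : r = numPivots piv n) (han : a ≤ n) (hnN : n ≤ N) (hN : 1 ≤ N)
    (e0 : env 0 = a) (e2 : env 2 = N) (e3 : env 3 = N * N) (e5 : env 5 = r)
    (hm : ∀ i < a, ∀ c < n, m (4 * (N * N) + i * N + c) = (colOf A c i).val)
    (hl : ∀ k < r, m (9 * (N * N) + k) = nthPivot piv k) (hW : 10 * (N * N) + 10 < W) :
    Run W 6 writeBasis (100 * (N * N) + 80 * N + 80) env m fun m' => ListAt m' 0
      (r :: ((List.ofFn fun i => (pivotEmb piv n hr i : ℕ)) ++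
        encode (A.submatrix id (pivotEmb piv n hr)))) := by
  have hNN : N ≤ N * N := Nat.le_mul_self N
  have hrn : r ≤ n := hr ▸ numPivots_le piv n
  have hnn : n * n ≤ N * N := Nat.mul_le_mul hnN hnN
  refine Run.mono (T := 4 + ((50 * N + 40) + (100 * (N * N) + 30 * N + 20))) ?_ (by omega)
    (fun _ h => h)
  refine Run.seq (R := fun m' => m' = Function.update m 0 r)
    (Run.put (by simp; omega) (by simp [e5]; omega) (by simp) (by simp [e5])) ?_
  rintro _ rfl
  refine Run.seq (R := fun m' => m' 0 = r ∧ (∀ k < r, m' (1 + k) = nthPivot piv k) ∧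
    ∀ x, 4 * (N * N) ≤ x → m' x = m x) ?_ ?_
  · refine Run.fill 1 r 1 r (fun _ k => nthPivot piv k) (by simp; omega) (by simp) le_rfl
      (fun i hi m' => by simp [e5]; omega) (fun i hi k hk m' hm' => ?_) ?_
      (fun m' h1 h2 => ⟨?_, fun k hk => ?_, fun x hx => ?_⟩)
    · have hq := (nthPivot_spec (hr ▸ hk)).1
      have hpos := addr_lt hi hk
      have hg : m' (9 * (N * N) + k) = nthPivot piv k := by
        rw [hm' _ fun i' hi' j' hj' _ => ?_, Function.update_of_ne (by omega), hl k hk]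
        have := addr_lt hi' hj'
        omega
      set E := fillEnv env 6 i 1 k r with hE
      have E3 : E 3 = N * N := by simp [hE, fillEnv, e3]
      have E5 : E 5 = r := by simp [hE, fillEnv, e5]
      have E8 : E 8 = k := by simp [hE, fillEnv]
      simp only [Expr.add_def, Expr.mul_def, Expr.Ok, Expr.eval, Op.eval_add, Op.eval_mul, E3, E5,
        E8, hg]
      and_intros
      all_goals first | exact trivial | omega
    · simp only [Expr.cost, Expr.add_def, Expr.mul_def]
      omega
    · rw [h2 0 fun i _ k _ => by omega, Function.update_self]
    · simpa using h1 0 (by omega) k hk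
    · rw [h2 x fun i hi k hk => ?_, Function.update_of_ne (by omega)]
      have := addr_lt hi hk
      omega
  rintro m1 ⟨h0, h1, h2⟩
  refine run_fillBasis (B := 1 + r) hr han hnN e0 e2 e3 e5
    (fun i hi c hc => by rw [h2 _ (by omega), hm i hi c hc])
    (fun k hk => by rw [h2 _ (by omega), hl k hk]) hW (by omega) (by decide)
    (fun i hi k hk m' => ?_) (fun m' h3 h4 => ?_)
  · simp [fillEnv, e5]
    omega
  · rw [listAt_cons, listAt_append, listAt_ofFn, List.length_ofFn]
    refine ⟨by rw [h4 0 (by omega), h0], fun k => ?_, by simpa using h3⟩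
    rw [zero_add, h4 _ (by omega), h1 k k.2, pivotEmb_val]

/-- Write the rank, the permutation matrix, the basis and the coordinates. -/
def writeDecomposition : Prog :=
  .seq (.put 6 (.lit 0) (.var 5)) <|
  .seq (.fill 6 (.var 1) (.var 1) (.lit 1) (.var 1)
    (.lit 1 - (.var 6 - .get (.lit 9 * .var 3 + .var 8)) -
      (.get (.lit 9 * .var 3 + .var 8) - .var 6))) <|
  .seq (fillBasis (.lit 1 + .var 1 * .var 1))
    (.fill 6 (.var 5) (.var 1 - .var 5) (.lit 1 + .var 1 * .var 1 + .var 0 * .var 5)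
      (.var 1 - .var 5)
      (.get (.lit 5 * .var 3 +
        (.get (.lit 7 * .var 3 + .get (.lit 9 * .var 3 + .var 6)) - .lit 1) * .var 2 +
        .get (.lit 9 * .var 3 + (.var 5 + .var 8)))))

theorem run_writeDecomposition (hr : r = numPivots piv n) (han : a ≤ n) (hnN : n ≤ N) (hN : 1 ≤ N)
    (e0 : env 0 = a) (e1 : env 1 = n) (e2 : env 2 = N) (e3 : env 3 = N * N) (e5 : env 5 = r)
    (hm : ∀ i < a, ∀ c < n, m (4 * (N * N) + i * N + c) = (colOf A c i).val)
    (hmat : ∀ i < N, ∀ c < N, m (5 * (N * N) + i * N + c) = (col c i).val)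
    (hpiv : ∀ c < N, m (7 * (N * N) + c) = piv c) (hle : ∀ c, piv c ≤ N)
    (hl : ∀ j : Fin n, m (9 * (N * N) + j) = ((positionPerm piv n).symm j : ℕ))
    (hW : 10 * (N * N) + 10 < W) :
    Run W 6 writeDecomposition (300 * (N * N) + 100 * N + 60) env m fun m' => ListAt m' 0
      (r :: (encode ((positionPerm piv n).permMatrix (ZMod 2)) ++
        encode (A.submatrix id (pivotEmb piv n hr)) ++ encode (coordMatrix col piv n r))) := by
  have hNN : N ≤ N * N := Nat.le_mul_self N
  have hrn : r ≤ n := hr ▸ numPivots_le piv n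
  have hnn : n * n ≤ N * N := Nat.mul_le_mul hnN hnN
  -- The output has at most `1 + 3 * (n * n)` entries, so it ends before the arrays that start at `4
  -- * (N * N)`.
  have har : a * r ≤ n * n := Nat.mul_le_mul han hrn
  have hrr : r * (n - r) ≤ n * n := Nat.mul_le_mul hrn (by omega)
  refine Run.mono (T := 4 + ((100 * (N * N) + 30 * N + 20) + ((100 * (N * N) + 30 * N + 20) +
    (100 * (N * N) + 30 * N + 15)))) ?_ (by omega) (fun _ h => h)
  refine Run.seq (R := fun m' => m' = Function.update m 0 r)
    (Run.put (by simp; omega) (by simp [e5]; omega) (by simp) (by simp [e5])) ?_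
  rintro _ rfl
  refine Run.seq (R := fun m' => m' 0 = r ∧
    ListAt m' 1 (encode ((positionPerm piv n).permMatrix (ZMod 2))) ∧
    ∀ x, 1 + n * n ≤ x → m' x = m x) ?_ ?_
  · refine Run.fill n n 1 n (fun i j => if h : j < n then
        if ((positionPerm piv n).symm ⟨j, h⟩ : ℕ) = i then 1 else 0 else 0)
      (by simp [e1]; omega) (by simp [e1]) le_rfl
      (fun i hi m' => by simp [e1]; omega) (fun i hi k hk m' hm' => ?_) ?_
      (fun m' h1 h2 => ⟨?_, ?_, fun x hx => ?_⟩)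
    · have hpos := addr_lt hi hk
      have hlt := ((positionPerm piv n).symm ⟨k, hk⟩).2
      have hg : m' (9 * (N * N) + k) = ((positionPerm piv n).symm ⟨k, hk⟩ : ℕ) := by
        rw [hm' _ fun i' hi' j' hj' _ => ?_, Function.update_of_ne (by omega), hl ⟨k, hk⟩]
        have := addr_lt hi' hj'
        omega
      simp only [dif_pos hk]
      generalize ((positionPerm piv n).symm ⟨k, hk⟩ : ℕ) = q at *
      set E := fillEnv env 6 i n k n with hE
      have E1 : E 1 = n := by simp [hE, fillEnv, e1]
      have E3 : E 3 = N * N := by simp [hE, fillEnv, e3]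
      have E6 : E 6 = i := by simp [hE, fillEnv]
      have E8 : E 8 = k := by simp [hE, fillEnv]
      simp only [Expr.add_def, Expr.mul_def, Expr.sub_def, Expr.Ok, Expr.eval, Op.eval_add,
        Op.eval_mul, Op.eval_sub, E1, E3, E6, E8, hg]
      and_intros
      all_goals first | exact trivial | omega | (split_ifs <;> omega)
    · have h1 : n * (2 + n * 65 + 19) ≤ N * (21 + N * 65) :=
        Nat.mul_le_mul (by omega) (by omega)
      have h2 : N * (21 + N * 65) = 65 * (N * N) + 21 * N := by ring
      refine le_trans (b := 2 + n * (2 + n * 65 + 19) + 7) ?_ (by omega)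
      simp only [Expr.cost, Expr.add_def, Expr.mul_def, Expr.sub_def]
      gcongr
      all_goals omega
    · rw [h2 0 fun i _ k _ => by omega, Function.update_self]
    · refine listAt_encode.mpr fun i k => ?_
      rw [← add_assoc, h1 i i.2 k k.2, dif_pos k.2, permMatrix_apply]
      simp only [Fin.eta, ← Fin.ext_iff]
      split_ifs <;> rfl
    · rw [h2 x fun i hi k hk => ?_, Function.update_of_ne (by omega)]
      have := addr_lt hi hk
      omega
  rintro m1 ⟨h0, hP, hf1⟩
  refine Run.seq (R := fun m' => m' 0 = r ∧
    ListAt m' 1 (encode ((positionPerm piv n).permMatrix (ZMod 2))) ∧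
    ListAt m' (1 + n * n) (encode (A.submatrix id (pivotEmb piv n hr))) ∧
    ∀ x, 1 + n * n + a * r ≤ x → m' x = m x) ?_ ?_
  · refine run_fillBasis (B := 1 + n * n) hr han hnN e0 e2 e3 e5
      (fun i hi c hc => by rw [hf1 _ (by omega), hm i hi c hc])
      (fun k hk => ?_) hW (by omega) (by decide) (fun i hi k hk m' => ?_)
      (fun m' h3 h4 => ⟨by rw [h4 0 (by omega), h0], fun k hk => ?_, h3, fun x hx => ?_⟩)
    · rw [hf1 _ (by omega), ← positionPerm_symm_of_lt (n := n) (j := ⟨k, by omega⟩) (hr ▸ hk)]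
      exact hl ⟨k, by omega⟩
    · simp [fillEnv, e1]
      omega
    · rw [← hP k hk]
      rw [length_encode] at hk
      exact h4 _ (by omega)
    · rw [h4 x (by omega), hf1 x (by omega)]
  rintro m2 ⟨h0, hP, hB, hf2⟩
  refine Run.fill r (n - r) (1 + n * n + a * r) (n - r)
    (fun k t => if h : r + t < n then
      (col ((positionPerm piv n).symm ⟨r + t, h⟩) (piv (nthPivot piv k) - 1)).val else 0)
    (by simp [e5]; omega) (by simp [e5]) le_rfl
    (fun i hi m' => by simp [e1, e5]; omega) (fun k hk t ht m' hm' => ?_) ?_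
    (fun m' h1 h2 => ?_)
  · have hpos := addr_lt hk ht
    have htn : r + t < n := by omega
    have hlow : ∀ x, 4 * (N * N) ≤ x → m' x = m x := fun x hx => by
      rw [hm' x fun i' hi' j' hj' _ => ?_, hf2 x (by omega)]
      have := addr_lt hi' hj'
      omega
    obtain ⟨hq, hq0, -⟩ := nthPivot_spec (hr ▸ hk)
    have hg1 : m' (9 * (N * N) + k) = nthPivot piv k := by
      rw [hlow _ (by omega), ← positionPerm_symm_of_lt (n := n) (j := ⟨k, by omega⟩) (hr ▸ hk)]
      exact hl ⟨k, by omega⟩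
    have hg2 : m' (7 * (N * N) + nthPivot piv k) = piv (nthPivot piv k) := by
      rw [hlow _ (by omega), hpiv _ (by omega)]
    have hg3 : m' (9 * (N * N) + (r + t)) = ((positionPerm piv n).symm ⟨r + t, htn⟩ : ℕ) := by
      rw [hlow _ (by omega)]
      exact hl ⟨r + t, htn⟩
    have hs := ((positionPerm piv n).symm ⟨r + t, htn⟩).2
    simp only [dif_pos htn]
    have hpN := hle (nthPivot piv k)
    generalize ((positionPerm piv n).symm ⟨r + t, htn⟩ : ℕ) = q at *
    generalize nthPivot piv k = c at *
    have ha := addr_lt (show piv c - 1 < N by omega) (show q < N by omega)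
    have hg4 : m' (5 * (N * N) + (piv c - 1) * N + q) = (col q (piv c - 1)).val := by
      rw [hlow _ (by omega), hmat _ (by omega) _ (by omega)]
    have hv := zmod_val_lt (col q (piv c - 1))
    set E := fillEnv env 6 k r t (n - r) with hE
    have E0 : E 0 = a := by simp [hE, fillEnv, e0]
    have E1 : E 1 = n := by simp [hE, fillEnv, e1]
    have E2 : E 2 = N := by simp [hE, fillEnv, e2]
    have E3 : E 3 = N * N := by simp [hE, fillEnv, e3]
    have E5 : E 5 = r := by simp [hE, fillEnv, e5]
    have E6 : E 6 = k := by simp [hE, fillEnv]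
    have E8 : E 8 = t := by simp [hE, fillEnv]
    simp only [Expr.add_def, Expr.mul_def, Expr.sub_def, Expr.Ok, Expr.eval, Op.eval_add,
      Op.eval_mul, Op.eval_sub, E0, E1, E2, E3, E5, E6, E8, hg1, hg2, hg3, hg4]
    and_intros
    all_goals first | exact trivial | omega
  · have h1 : r * (5 + (n - r) * 80 + 19) ≤ N * (24 + N * 80) :=
      Nat.mul_le_mul (by omega) (by omega)
    have h2 : N * (24 + N * 80) = 80 * (N * N) + 24 * N := by ring
    refine le_trans (b := 2 + r * (5 + (n - r) * 80 + 19) + 7) ?_ (by omega)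
    simp only [Expr.cost, Expr.add_def, Expr.mul_def, Expr.sub_def]
    gcongr
    all_goals omega
  · have hf3 : ∀ x, x < 1 + n * n + a * r → m' x = m2 x := fun x hx => h2 x fun i _ k _ => by omega
    rw [listAt_cons, listAt_append, listAt_append, List.length_append, length_encode,
      length_encode, zero_add]
    refine ⟨by rw [hf3 0 (by omega), h0], ⟨fun k hk => ?_, fun k hk => ?_⟩, ?_⟩
    · rw [← hP k hk]
      rw [length_encode] at hk
      exact hf3 _ (by omega)
    · rw [← hB k hk]
      rw [length_encode] at hk
      exact hf3 _ (by omega)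
    · refine listAt_encode.mpr fun k t => ?_
      rw [← add_assoc, ← add_assoc, h1 k k.2 t t.2, dif_pos (by omega)]
      rfl

end

/-! ### The running time. -/

/-- A bound on the time of the three computations. -/
def totalTime (c₀ b : ℕ) (T₀ : ℕ → ℕ) (n : ℕ) : ℕ :=
  eliminationTime c₀ b T₀ n + (400 * (padded n * padded n) + 300 * padded n + 300)

section

variable {ω : ℝ} {T₀ : ℕ → ℕ}

/-- The elimination multiplies small blocks for every `n`, so the asymptotic bound is needed for all
`w ≥ 1`. The finitely many exceptions are absorbed in the constant, because `w ^ ω ≥ 1`. -/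
theorem exists_bound_of_isBigO
    (hT : (fun n => (T₀ n : ℝ)) =O[Filter.atTop] fun n : ℕ => (n : ℝ) ^ ω)
    (hω : 0 ≤ ω) : ∃ C : ℝ, 0 ≤ C ∧ ∀ w : ℕ, 1 ≤ w → (T₀ w : ℝ) ≤ C * (w : ℝ) ^ ω := by
  obtain ⟨C, hC⟩ := hT.bound
  obtain ⟨n₀, hn₀⟩ := Filter.eventually_atTop.mp hC
  refine ⟨|C| + ∑ k ∈ Finset.range n₀, (T₀ k : ℝ), by positivity, fun w hw => ?_⟩
  have h1 : (1 : ℝ) ≤ (w : ℝ) ^ ω := Real.one_le_rpow (by exact_mod_cast hw) hω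
  have hsum : 0 ≤ ∑ k ∈ Finset.range n₀, (T₀ k : ℝ) := by positivity
  rcases le_or_gt n₀ w with h | h
  · have h2 := hn₀ w h
    rw [Real.norm_of_nonneg (by positivity), Real.norm_of_nonneg (by positivity)] at h2
    refine h2.trans (mul_le_mul_of_nonneg_right ?_ (by positivity))
    linarith [le_abs_self C]
  · have h2 : (T₀ w : ℝ) ≤ ∑ k ∈ Finset.range n₀, (T₀ k : ℝ) :=
      Finset.single_le_sum (f := fun k => (T₀ k : ℝ)) (fun _ _ => by positivity)
        (Finset.mem_range.mpr h)
    calc (T₀ w : ℝ) ≤ (|C| + ∑ k ∈ Finset.range n₀, (T₀ k : ℝ)) * 1 := by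
          linarith [abs_nonneg C]
      _ ≤ _ := mul_le_mul_of_nonneg_left h1 (by positivity)

theorem rpow_eq_self_mul {x : ℝ} (hx : 0 < x) (ω : ℝ) : x ^ ω = x * x ^ (ω - 1) := by
  rw [Real.rpow_sub_one hx.ne']
  field_simp

/-- `N / w` products at cost `C * w ^ ω` give `N * w ^ (ω - 1)`. The other terms, at most quadratic
in `w` or linear in `N`, are absorbed because `w ≤ w ^ (ω - 1)`. -/
theorem stepTime_le {C : ℝ} {N b w : ℕ} (hω : 2 < ω) (hw : 1 ≤ w) (hwN : w ∣ N)
    (hN : 1 ≤ N) (hT : (T₀ w : ℝ) ≤ C * (w : ℝ) ^ ω) :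
    ((stepTime N b T₀ w + 6 : ℕ) : ℝ) ≤ (2 * C + b + 2600) * N * (w : ℝ) ^ (ω - 1) := by
  obtain ⟨k, rfl⟩ := hwN
  have hk : 1 ≤ k := Nat.pos_of_mul_pos_left hN
  have hdiv : w * k / w = k := Nat.mul_div_cancel_left k hw
  have hw' : (1 : ℝ) ≤ w := by exact_mod_cast hw
  have hk' : (1 : ℝ) ≤ k := by exact_mod_cast hk
  have hθ : (w : ℝ) ≤ (w : ℝ) ^ (ω - 1) := by
    simpa using Real.rpow_le_rpow_of_exponent_le hw' (show (1 : ℝ) ≤ ω - 1 by linarith)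
  rw [rpow_eq_self_mul (by linarith)] at hT
  rw [stepTime, hdiv]
  push_cast
  generalize (w : ℝ) ^ (ω - 1) = y at *
  generalize (w : ℝ) = x at *
  generalize (k : ℝ) = z at *
  generalize (T₀ w : ℝ) = t at *
  have hy : 1 ≤ y := hw'.trans hθ
  have hxx : x * x ≤ x * y := mul_le_mul_of_nonneg_left hθ (by linarith)
  have h1 : 1 ≤ x * y := one_le_mul_of_one_le_of_one_le hw' hy
  have hb : (b : ℝ) ≤ b * (x * y) := le_mul_of_one_le_right (by positivity) h1
  have hzx : x * y ≤ z * (x * y) := le_mul_of_one_le_left (by linarith) hk'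
  have hxz : x * z ≤ x * z * y := le_mul_of_one_le_right (by positivity) hy
  have h2 : z * (2 * t + b + 700 * (x * x) + 500) ≤ z * ((2 * C + b + 1200) * (x * y)) := by
    refine mul_le_mul_of_nonneg_left ?_ (by linarith)
    nlinarith
  have h3 : (2 * C + b + 2600) * (x * z) * y =
      z * ((2 * C + b + 1200) * (x * y)) + 1400 * (z * (x * y)) := by ring
  have h4 : x * z * y = z * (x * y) := by ring
  linarith

/-- With `q = 2 ^ (ω - 1)` and `D = 2 * C + b + 2600`, the recursion reads `t (ℓ + 1) ≤ 2 * t ℓ + 2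
* D * N * q ^ ℓ`. It is solved by `t ℓ = α * N * q ^ ℓ` with `2 * α + 2 * D = q * α`, that is, `α =
2 * D / (q - 2)`; here `ω > 2` gives `q > 2`. -/
theorem blockTime_le {C : ℝ} {N b : ℕ} (hω : 2 < ω) (hC : 0 ≤ C) (hN : 1 ≤ N)
    (hT : ∀ w : ℕ, 1 ≤ w → (T₀ w : ℝ) ≤ C * (w : ℝ) ^ ω) (ℓ : ℕ) (hℓ : 2 ^ ℓ ∣ N) :
    (blockTime N b T₀ ℓ : ℝ) ≤ 2 * (2 * C + b + 2600) / ((2 : ℝ) ^ (ω - 1) - 2) * N *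
      ((2 ^ ℓ : ℕ) : ℝ) ^ (ω - 1) := by
  have hq : (2 : ℝ) < (2 : ℝ) ^ (ω - 1) := by
    simpa using Real.rpow_lt_rpow_of_exponent_lt (one_lt_two (α := ℝ))
      (show (1 : ℝ) < ω - 1 by linarith)
  have hpow : ∀ k : ℕ, ((2 ^ k : ℕ) : ℝ) ^ (ω - 1) = ((2 : ℝ) ^ (ω - 1)) ^ k := fun k => by
    rw [Nat.cast_pow, Nat.cast_ofNat, ← Real.rpow_natCast, ← Real.rpow_natCast,
      ← Real.rpow_mul (by norm_num), ← Real.rpow_mul (by norm_num), mul_comm]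
  induction ℓ with
  | zero =>
    have : 0 < (2 : ℝ) ^ (ω - 1) - 2 := by linarith
    rw [blockTime]
    simp only [Nat.cast_zero]
    positivity
  | succ ℓ ih =>
    have hdvd : 2 ^ ℓ ∣ N := (pow_dvd_pow 2 (Nat.le_succ ℓ)).trans hℓ
    have h1 := ih hdvd
    have h2 := stepTime_le (b := b) hω Nat.one_le_two_pow hdvd hN (hT _ Nat.one_le_two_pow)
    rw [hpow] at h1 h2 ⊢
    rw [blockTime, pow_succ]
    push_cast at h1 h2 ⊢
    generalize (2 : ℝ) ^ (ω - 1) = q at *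
    have hq' : q - 2 ≠ 0 := by linarith
    refine le_trans (b := 2 * (2 * (2 * C + b + 2600) / (q - 2) * N * q ^ ℓ) +
      2 * ((2 * C + b + 2600) * N * q ^ ℓ)) (by linarith) (le_of_eq ?_)
    field_simp
    ring

theorem totalTime_isBigO (hω : 2 < ω)
    (hT : (fun n => (T₀ n : ℝ)) =O[Filter.atTop] fun n : ℕ => (n : ℝ) ^ ω) (c₀ b : ℕ) :
    (fun n => (totalTime c₀ b T₀ n : ℝ)) =O[Filter.atTop] fun n : ℕ => (n : ℝ) ^ ω := by
  obtain ⟨C, hC, hC'⟩ := exists_bound_of_isBigO hT (by linarith)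
  set α := 2 * (2 * C + b + 2600) / ((2 : ℝ) ^ (ω - 1) - 2) with hα
  -- `3 ^ ω` pays for the padding, as `padded n ≤ 3 * n`. The number 2100 is the sum of the
  -- coefficients 600, 700 and 800 of the quadratic, linear and constant terms of the total time.
  refine Asymptotics.IsBigO.of_bound ((α + (2100 + 5 * c₀)) * 3 ^ ω) ?_
  filter_upwards [Filter.eventually_ge_atTop 1] with n hn
  have hN : 1 ≤ padded n := Nat.one_le_two_pow
  have hN3 : padded n ≤ 3 * n := (padded_le n).trans (by omega)
  have hα0 : 0 ≤ α := by
    have hq : (2 : ℝ) < (2 : ℝ) ^ (ω - 1) := by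
      simpa using Real.rpow_lt_rpow_of_exponent_lt (one_lt_two (α := ℝ))
        (show (1 : ℝ) < ω - 1 by linarith)
    have : 0 < (2 : ℝ) ^ (ω - 1) - 2 := by linarith
    positivity
  have hN' : (1 : ℝ) ≤ padded n := by exact_mod_cast hN
  have h1 := blockTime_le (b := b) hω hC hN hC' (Nat.clog 2 n) dvd_rfl
  rw [← hα, mul_assoc, show 2 ^ Nat.clog 2 n = padded n from rfl,
    ← rpow_eq_self_mul (by linarith)] at h1
  have h2 : (padded n : ℝ) * padded n ≤ (padded n : ℝ) ^ ω := by
    rw [← sq, ← Real.rpow_natCast]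
    exact Real.rpow_le_rpow_of_exponent_le hN' (by push_cast; linarith)
  have h3 : (padded n : ℝ) ^ ω ≤ 3 ^ ω * (n : ℝ) ^ ω := by
    rw [← Real.mul_rpow (by norm_num) (by positivity)]
    exact Real.rpow_le_rpow (by positivity) (by exact_mod_cast hN3) (by linarith)
  have h4 : (padded n : ℝ) ≤ padded n * padded n := le_mul_of_one_le_left (by linarith) hN'
  have h5 : (1 : ℝ) ≤ (padded n : ℝ) ^ ω := Real.one_le_rpow hN' (by linarith)
  have h6 : (c₀ : ℝ) ≤ c₀ * (padded n : ℝ) ^ ω := le_mul_of_one_le_right (by positivity) h5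
  rw [Real.norm_of_nonneg (by positivity), Real.norm_of_nonneg (by positivity), totalTime,
    eliminationTime, mul_assoc]
  push_cast
  refine le_trans (b := (α + (2100 + 5 * c₀)) * (padded n : ℝ) ^ ω) (by linarith)
    (mul_le_mul_of_nonneg_left h3 (by positivity))

end

/-! ### Assembly of the three programs. -/

theorem solvableInTime_of_run {Q : Problem} {f : ℕ → ℝ} (p : Prog) (c : ℕ) (T : ℕ → ℕ)
    (hT : (fun n => (T n : ℝ)) =O[Filter.atTop] f)
    (h : ∀ x : Q.Inst,
      Run ((Q.size x + 2) ^ c) 0 p (T (Q.size x)) (fun _ => 0) (State.init (Q.input x)).mem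
        fun m' => ∃ out, Q.IsOutput x out ∧ ListAt m' 0 out) : Q.SolvableInTime f := by
  refine ⟨p, c, T, hT, fun x => ?_⟩
  obtain ⟨s, t, h1, h2, -, out, ho, h4⟩ := h x (State.init (Q.input x)) (fun r hr => by omega) rfl
  exact ⟨out, s, t, h1, h2, fun k hk => by simpa using h4 k hk, ho⟩

/-- The left side is at most `22 = 10 + 2 + 10` times `(padded n + 2) ^ (c₀ + 2)`. With `padded n +
2 ≤ (n + 2) ^ 2` and `22 < 2 ^ 5` the exponent becomes `5 + 2 * (c₀ + 2)`. -/
theorem word_size_bound (c₀ n : ℕ) :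
    10 * (padded n * padded n) + 2 * padded n * (padded n * (padded n + 2) ^ c₀) + 10 <
      (n + 2) ^ (2 * c₀ + 9) := by
  have h1 : padded n + 2 ≤ (n + 2) ^ 2 := by
    have := padded_le n
    calc padded n + 2 ≤ 2 * n + 3 := by omega
      _ ≤ (n + 2) ^ 2 := by ring_nf; omega
  have hS : 1 ≤ (padded n + 2) ^ c₀ := Nat.one_le_pow _ _ (by omega)
  have h2 : 10 * (padded n * padded n) + 2 * padded n * (padded n * (padded n + 2) ^ c₀) + 10 ≤
      22 * (padded n + 2) ^ (c₀ + 2) := by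
    rw [pow_add]
    generalize (padded n + 2) ^ c₀ = S at *
    generalize padded n = N at *
    obtain ⟨s, rfl⟩ := Nat.exists_eq_add_of_le hS
    ring_nf
    nlinarith [Nat.zero_le (s * N), Nat.zero_le (s * N ^ 2), Nat.zero_le s, Nat.zero_le N]
  calc _ ≤ 22 * (padded n + 2) ^ (c₀ + 2) := h2
    _ ≤ 22 * ((n + 2) ^ 2) ^ (c₀ + 2) := Nat.mul_le_mul_left _ (Nat.pow_le_pow_left h1 _)
    _ < (n + 2) ^ 5 * ((n + 2) ^ 2) ^ (c₀ + 2) := by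
      refine Nat.mul_lt_mul_of_pos_right ?_ (by positivity)
      calc 22 < 2 ^ 5 := by norm_num
        _ ≤ (n + 2) ^ 5 := Nat.pow_le_pow_left (by omega) _
    _ = (n + 2) ^ (2 * c₀ + 9) := by
      rw [← pow_mul, ← pow_add]
      congr 1
      ring

section

variable {p₀ : Prog} {c₀ : ℕ} {T₀ : ℕ → ℕ} {f : ℕ → ℝ}

theorem solvableInTime_inversion (hp₀ : Multiplies p₀ c₀ T₀) (hc : 3 ≤ c₀)
    (hT : (fun n => (totalTime c₀ p₀.regBound T₀ n : ℝ)) =O[Filter.atTop] f) :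
    inversion.SolvableInTime f := by
  refine solvableInTime_of_run (.bind 0 (.get (.lit 0)) (.bind 1 (.get (.lit 0))
    (withElimination 1 c₀ p₀ writeInverse))) (2 * c₀ + 9) _ hT fun ⟨n, A, hA⟩ => ?_
  refine Run.mono ?_ le_rfl fun m' h => ⟨encode A⁻¹, rfl, h⟩
  change Run ((n + 2) ^ (2 * c₀ + 9)) 0 _ (totalTime c₀ p₀.regBound T₀ n) _
    (State.init (n :: encode A)).mem _
  have hL := listAt_cons.mp (listAt_init (n :: encode A))
  have hz : ∀ x, 1 + n * n ≤ x → (State.init (n :: encode A)).mem x = 0 := fun x hx =>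
    init_mem_of_le (by rw [List.length_cons, length_encode]; omega)
  generalize (State.init (n :: encode A)).mem = m at *
  have hnN := le_padded n
  have hNN : padded n ≤ padded n * padded n := Nat.le_mul_self _
  have hW := word_size_bound c₀ n
  generalize (n + 2) ^ (2 * c₀ + 9) = W at *
  have hget : ∀ d env, (Expr.get (.lit 0)).Ok W d env m := fun d env => by
    simp [hL.1]
    omega
  have heval : ∀ env, (Expr.get (.lit 0)).eval env m = n := fun env => by simp [hL.1]
  refine Run.bind (T₀ := 2 + (eliminationTime c₀ p₀.regBound T₀ n +
    (120 * (padded n * padded n) + 30 * padded n + 20))) (hget _ _)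
    (by rw [totalTime]; simp only [Expr.cost]; omega) ?_
  refine Run.bind (T₀ := eliminationTime c₀ p₀.regBound T₀ n +
    (120 * (padded n * padded n) + 30 * padded n + 20)) (hget _ _) le_rfl ?_
  rw [heval, heval]
  exact run_withElimination hp₀ hc (A := A) rfl le_rfl le_rfl (by omega) (by simp) (by simp) hL.2 hz
    (by omega) fun env' m' col piv e0 e1 e2 e3 hR hE hm =>
    run_writeInverse hA hnN e1 e2 e3 hR hE (by omega)

/-- The program that reads the dimensions of a matrix, eliminates, lists the columns, and goes on
with the program `p`. -/
def wideProgram (c₀ : ℕ) (p₀ p : Prog) : Prog :=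
  .bind 0 (.get (.lit 0)) (.bind 1 (.get (.lit 1)) (withElimination 2 c₀ p₀ (withColumns p)))

theorem run_wideProgram (hp₀ : Multiplies p₀ c₀ T₀) (hc : 3 ≤ c₀) {a n : ℕ} (han : a ≤ n)
    {A : Matrix (Fin a) (Fin n) (ZMod 2)} {p : Prog} {Q : (ℕ → ℕ) → Prop}
    (hp : ∀ (W : ℕ) (env m : ℕ → ℕ) (col : ℕ → ℕ → ZMod 2) (piv : ℕ → ℕ),
      10 * (padded n * padded n) + 10 < W → env 0 = a → env 1 = n → env 2 = padded n →
      env 3 = padded n * padded n → env 5 = A.rank →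
      Eliminated 0 (padded n) (colOf A) (fun _ => 0) col piv → (∀ c, piv c ≤ padded n) →
      (∀ i < a, ∀ c < n, m (4 * (padded n * padded n) + i * padded n + c) = (colOf A c i).val) →
      (∀ i < padded n, ∀ c < padded n,
        m (5 * (padded n * padded n) + i * padded n + c) = (col c i).val) →
      (∀ c < padded n, m (7 * (padded n * padded n) + c) = piv c) →
      (∀ j : Fin n, m (9 * (padded n * padded n) + j) = ((positionPerm piv n).symm j : ℕ)) →
      Run W 6 p (300 * (padded n * padded n) + 100 * padded n + 80) env m Q) :
    Run ((n + 2) ^ (2 * c₀ + 9)) 0 (wideProgram c₀ p₀ p) (totalTime c₀ p₀.regBound T₀ n)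
      (fun _ => 0) (State.init (a :: n :: encode A)).mem Q := by
  have hL := listAt_cons.mp (listAt_init (a :: n :: encode A))
  rw [listAt_cons] at hL
  have hz : ∀ x, 2 + a * n ≤ x → (State.init (a :: n :: encode A)).mem x = 0 := fun x hx =>
    init_mem_of_le (by rw [List.length_cons, List.length_cons, length_encode]; omega)
  generalize (State.init (a :: n :: encode A)).mem = m at *
  have hnN := le_padded n
  have hN : 1 ≤ padded n := Nat.one_le_two_pow
  have hNN : padded n ≤ padded n * padded n := Nat.le_mul_self _
  have hW := word_size_bound c₀ n
  generalize (n + 2) ^ (2 * c₀ + 9) = W at *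
  have h1 : m 1 = n := hL.2.1
  set Z := padded n * padded n with hZ
  refine Run.bind (T₀ := 2 + (eliminationTime c₀ p₀.regBound T₀ n +
    (100 * padded n + 30 + (300 * Z + 100 * padded n + 80)))) (by simp [hL.1]; omega)
    (by rw [totalTime]; simp only [Expr.cost]; omega) ?_
  refine Run.bind (T₀ := eliminationTime c₀ p₀.regBound T₀ n +
    (100 * padded n + 30 + (300 * Z + 100 * padded n + 80)))
    (by simp [h1]; omega) le_rfl ?_
  simp only [Expr.eval, hL.1, h1]
  refine run_withElimination hp₀ hc (A := A) rfl han (by omega) le_rfl (by simp) (by simp) hL.2.2 hz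
    (by omega) fun env' m' col piv e0 e1 e2 e3 hR hE hm =>
    run_withColumns hnN hN e1 e3 hR (by omega) fun m2 hl hf => ?_
  refine hp W _ m2 col piv (by omega) (by simp [e0]) (by simp [e1]) (by simp [e2])
    (by simp [e3, hZ]) (by simp [hE.rank_eq hnN]) hE hR.piv_le
    (fun i hi c hcn => ?_) (fun i hi c hcn => ?_)
    (fun c hcn => ?_) hl
  · have := addr_lt (show i < padded n by omega) (show c < padded n by omega)
    rw [hf _ (by omega) (by omega), hm i hi c hcn]
  · have := addr_lt hi hcn
    rw [hf _ (by omega) (by omega), hR.mat i hi c hcn]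
  · rw [hf _ (by omega) (by omega), hR.piv_mem c hcn]

theorem solvableInTime_earliestBasis (hp₀ : Multiplies p₀ c₀ T₀) (hc : 3 ≤ c₀)
    (hT : (fun n => (totalTime c₀ p₀.regBound T₀ n : ℝ)) =O[Filter.atTop] f) :
    earliestBasis.SolvableInTime f := by
  refine solvableInTime_of_run (wideProgram c₀ p₀ writeBasis) (2 * c₀ + 9) _ hT
    fun ⟨a, n, han, A⟩ => run_wideProgram hp₀ hc han (A := A)
      fun W env m col piv hW e0 e1 e2 e3 e5 hE hle hm _ _ hl => ?_
  have hr := hE.rank_eq (le_padded n)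
  refine (run_writeBasis hr han (le_padded n) Nat.one_le_two_pow e0 e2 e3 e5 hm
    (fun k hk => ?_) hW).mono (by omega) fun m' h =>
    ⟨_, ⟨_, hE.isEarliestBasis (le_padded n), rfl⟩, h⟩
  have hkn := hk.trans_le A.rank_le_width
  rw [← positionPerm_symm_of_lt (n := n) (j := ⟨k, hkn⟩) (hr ▸ hk)]
  exact hl ⟨k, hkn⟩

theorem solvableInTime_earliestBasisCoordinates (hp₀ : Multiplies p₀ c₀ T₀) (hc : 3 ≤ c₀)
    (hT : (fun n => (totalTime c₀ p₀.regBound T₀ n : ℝ)) =O[Filter.atTop] f) :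
    earliestBasisCoordinates.SolvableInTime f :=
  solvableInTime_of_run (wideProgram c₀ p₀ writeDecomposition) (2 * c₀ + 9) _ hT
    fun ⟨_, n, han, A⟩ => run_wideProgram hp₀ hc han (A := A)
      fun _ _ _ _ _ hW e0 e1 e2 e3 e5 hE hle hm hmat hpiv hl =>
        (run_writeDecomposition (hE.rank_eq (le_padded n)) han (le_padded n)
          Nat.one_le_two_pow e0 e1 e2 e3 e5 hm hmat hpiv hle hl hW).mono (by omega) fun _ h =>
          ⟨_, ⟨_, _, _, _, hE.isEarliestBasis (le_padded n), rfl,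
            hE.decomposition (le_padded n), rfl⟩, h⟩

end

/-- Raising the exponent to at least 3 only weakens the bound on the values, and makes room for the
operands in a region of `(w + 2) ^ c₀` cells. -/
theorem exists_multiplies {f : ℕ → ℝ} (h : multiplication.SolvableInTime f) :
    ∃ (p₀ : Prog) (c₀ : ℕ) (T₀ : ℕ → ℕ), 3 ≤ c₀ ∧ Multiplies p₀ c₀ T₀ ∧
      (fun n => (T₀ n : ℝ)) =O[Filter.atTop] f := by
  obtain ⟨p, c, T, hT, h⟩ := h
  refine ⟨p, max c 3, T, le_max_right _ _, fun x => ?_, hT⟩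
  obtain ⟨_, s, t, h1, h2, h3, rfl⟩ := h x
  exact ⟨s, t, h1.mono (Nat.pow_le_pow_right (Nat.le_add_left 1 (x.n + 1)) (le_max_left c 3)), h2,
    h3⟩

end BinaryMatrix

theorem proposition3p1 (ω : ℝ) (hω : 2 < ω)
    (hmul : BinaryMatrix.multiplication.SolvableInTime (fun n => (n : ℝ) ^ ω)) :
    BinaryMatrix.inversion.SolvableInTime (fun n => (n : ℝ) ^ ω) ∧
    BinaryMatrix.earliestBasis.SolvableInTime (fun n => (n : ℝ) ^ ω) ∧
    BinaryMatrix.earliestBasisCoordinates.SolvableInTime (fun n => (n : ℝ) ^ ω) := by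
  obtain ⟨p₀, c₀, T₀, hc, hp₀, hT₀⟩ := BinaryMatrix.exists_multiplies hmul
  have hT := BinaryMatrix.totalTime_isBigO hω hT₀ c₀ p₀.regBound
  exact ⟨BinaryMatrix.solvableInTime_inversion hp₀ hc hT,
    BinaryMatrix.solvableInTime_earliestBasis hp₀ hc hT,
    BinaryMatrix.solvableInTime_earliestBasisCoordinates hp₀ hc hT⟩
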